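/- Let $G$ be a countable discrete amenable group with identity $1$, i.e. for every nonempty finite $K\subseteq G$ and $\delta>0$ there is a nonempty finite $F\subseteq G$ that is $(K,\delta)$-invariant: $|KF\,\triangle\,F|<\delta|F|$. Let $X=\mathbb N^G$, where $\mathbb N=\{0,1,2,\dots\}$, with the product topology, the $\sigma$-algebra $\mathcal B$ generated by the cylinder sets $[w]=\{x\in X: x_F=w\}$ ($F\subseteq G$ finite, $w\in\mathbb N^F$), and the action $(g\cdot x)(h)=x(hg)$. Write $\lim_{F\to G}\varphi(F)=L$ if for every $\epsilon>0$ there are a nonempty finite $K\subseteq G$ and $\delta>0$ such that $|\varphi(F)-L|<\epsilon$ for every $(K,\delta)$-invariant finite $F$. An exhausting sequence is a strictly increasing sequence $(E_m)_{m\ge 0}$ of finite subsets of $G$ with $E_0=\emptyset$, $E_1=\{1\}$ and $\bigcup_m E_m=G$. For $\phi\colon X\to\mathbb R$ and finite $F\subseteq G$ put $\phi_F(x)=\sum_{g\in F}\phi(g\cdot x)$ and $\delta_F(\phi)=\sup\{|\phi(x)-\phi(y)|: x_F=y_F\}$. The potential $\phi$ is exp-summable if $\sum_{a\in\mathbb N}\exp\bigl(\sup\{\phi(x):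 x(1)=a\}\bigr)<\infty$, and has summable variation according to $(E_m)$ if $\sum_{m\ge1}|E_{m+1}^{-1}\setminus E_m^{-1}|\,\delta_{E_m}(\phi)<\infty$. For a probability measure $\nu$ on $X$ let $H_F(\nu)=-\sum_{w\in\mathbb N^F}\nu([w])\log\nu([w])$ and let $h(\nu)=\lim_{F\to G}H_F(\nu)/|F|$ be its entropy (this limit exists and is finite for the measures $\nu$ considered in the next sentence). A $G$-invariant probability measure $\mu$ is an equilibrium measure for $\phi$ if $\int\phi\,d\mu>-\infty$ and $$h(\mu)+\int\phi\,d\mu=\sup\Bigl\{h(\nu)+\int\phi\,d\nu:\ \nu\text{ a }G\text{-invariant probability measure with }\int\phi\,d\nu>-\infty\Bigr\}.$$ For nonempty finite $K\subseteq G$ let $\mathcal B_{K^c}$ be the $\sigma$-algebra generated by the coordinates outside $K$, let $wx_{K^c}$ be the configuration equal to $w$ on $K$ and to $x$ off $K$, and let $$\gamma_K(B,x)=\lim_{m\to\infty}\frac{\sum_{w\in\mathbb N^K}\exp\bigl(\phi_{E_m}(wx_{K^c})\bigr)\mathbf 1_{\{wx_{K^c}\in B\}}}{\sum_{v\in\mathbb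 N^K}\exp\bigl(\phi_{E_m}(vx_{K^c})\bigr)}\qquad(B\in\mathcal B,\ x\in X).$$ A probability measure $\mu$ on $X$ is a DLR measure for $\phi$ if, for every nonempty finite $K\subseteq G$ and every $B\in\mathcal B$, $\mu(B\mid\mathcal B_{K^c})(x)=\gamma_K(B,x)$ for $\mu$-almost every $x$ (the limit defining $\gamma_K(B,x)$ existing for such $x$). **Theorem.** Let $\phi\colon X\to\mathbb R$ be an exp-summable potential with summable variation according to an exhausting sequence $(E_m)_m$. Then every $G$-invariant probability measure that is an equilibrium measure for $\phi$ is a DLR measure for $\phi$. -/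

import Mathlib

open MeasureTheory ProbabilityTheory Filter Topology
open scoped Pointwise ENNReal

namespace GibbsShift

/-- Configurations on the group `G` over the alphabet `ℕ`, with the product topology and the product
σ-algebra. -/
abbrev Config (G : Type*) := G → ℕ

/-- The translation action `(g · x)(h) = x (h g)`. -/
def shift {G : Type*} [Group G] (g : G) (x : Config G) : Config G := fun h => x (h * g)

open Classical in
/-- `F` is `(K, δ)`-invariant: `|K F Δ F| < δ |F|`. -/
def IsInvariantSet {G : Type*} [Group G] (K : Finset G) (δ : ℝ) (F : Finset G) : Prop :=
  ((symmDiff (K * F) F).card : ℝ) < δ * (F.card : ℝ)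

/-- Amenability: for every nonempty finite `K` and every `δ > 0` there is a `(K, δ)`-invariant
nonempty finite set. (Nonemptiness of `F` is forced by the strict inequality.) -/
def IsAmenable (G : Type*) [Group G] : Prop :=
  ∀ K : Finset G, K.Nonempty → ∀ δ : ℝ, 0 < δ → ∃ F : Finset G, IsInvariantSet K δ F

theorem IsInvariantSet.mono {G : Type*} [Group G] {K K' F : Finset G} {δ δ' : ℝ}
    (hK : K.Nonempty) (hsub : K ⊆ K') (hδ : 2 * δ' ≤ δ)
    (h : IsInvariantSet K' δ' F) : IsInvariantSet K δ F := by
  classical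
  simp only [IsInvariantSet] at h ⊢
  have key : (symmDiff (K * F) F).card ≤ 2 * (symmDiff (K' * F) F).card := by
    have h1 : (symmDiff (K * F) F).card ≤ ((K * F) \ F).card + (F \ (K * F)).card :=
      Finset.card_union_le _ _
    have h2 : (F \ (K * F)).card ≤ ((K * F) \ F).card :=
      Finset.card_sdiff_le_card_sdiff_iff.2 (Finset.card_le_card_mul_left hK)
    have h3 : ((K * F) \ F).card ≤ (symmDiff (K' * F) F).card := by
      apply Finset.card_le_card
      intro a ha
      rw [Finset.mem_sdiff] at ha
      exact Finset.mem_symmDiff.2 (Or.inl ⟨Finset.mul_subset_mul_right hsub ha.1, ha.2⟩)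
    omega
  have key' : ((symmDiff (K * F) F).card : ℝ) ≤ 2 * ((symmDiff (K' * F) F).card : ℝ) := by
    exact_mod_cast key
  have hF : (0 : ℝ) ≤ (F.card : ℝ) := Nat.cast_nonneg _
  have h4 : 2 * δ' * (F.card : ℝ) ≤ δ * (F.card : ℝ) := mul_le_mul_of_nonneg_right hδ hF
  linarith

/-- The filter of "`F` becoming more and more invariant" on finite subsets of `G`: a property holds
eventually iff, for some nonempty finite `K` and some `δ > 0`, it holds for all `(K, δ)`-invariant
finite sets `F`. -/
def moreInvariant (G : Type*) [Group G] : Filter (Finset G) where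
  sets := {S | ∃ K : Finset G, K.Nonempty ∧ ∃ δ : ℝ, 0 < δ ∧
    ∀ F : Finset G, IsInvariantSet K δ F → F ∈ S}
  univ_sets := ⟨{1}, Finset.singleton_nonempty 1, 1, one_pos, fun _ _ => Set.mem_univ _⟩
  sets_of_superset := by
    rintro S T ⟨K, hK, δ, hδ, h⟩ hST
    exact ⟨K, hK, δ, hδ, fun F hF => hST (h F hF)⟩
  inter_sets := by
    classical
    rintro S T ⟨K, hK, δ, hδ, h⟩ ⟨L, hL, η, hη, h'⟩
    refine ⟨K ∪ L, hK.mono Finset.subset_union_left, min δ η / 2, by positivity, ?_⟩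
    intro F hF
    refine ⟨h F (hF.mono hK ?_ ?_),
      h' F (hF.mono hL ?_ ?_)⟩
    · exact Finset.subset_union_left
    · linarith [min_le_left δ η]
    · exact Finset.subset_union_right
    · linarith [min_le_right δ η]

/-- Exhausting sequences: `E 0 = ∅`, `E 1 = {1}`, strictly increasing, with union `G`. -/
structure IsExhausting {G : Type*} [Group G] (E : ℕ → Finset G) : Prop where
  zero : E 0 = ∅
  one : E 1 = {1}
  strictMono : StrictMono E
  exhausts : ∀ g : G, ∃ m, g ∈ E m

/-- The variation `δ_E(φ) = sup {|φ x - φ y| : x_E = y_E}`, in `[0, ∞]`. -/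
noncomputable def variation {G : Type*} (φ : Config G → ℝ) (E : Finset G) : ℝ≥0∞ :=
  ⨆ (x : Config G) (y : Config G) (_ : ∀ g ∈ E, x g = y g), ENNReal.ofReal |φ x - φ y|

open Classical in
/-- The sum of variations `V(φ) = ∑_{m ≥ 1} |E_{m+1}⁻¹ \ E_m⁻¹| δ_{E_m}(φ)`, in `[0, ∞]`. -/
noncomputable def sumVariation {G : Type*} [Group G] (E : ℕ → Finset G) (φ : Config G → ℝ) :
    ℝ≥0∞ :=
  ∑' m : ℕ, (((E (m + 2))⁻¹ \ (E (m + 1))⁻¹).card : ℝ≥0∞) * variation φ (E (m + 1))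

/-- `φ` has summable variation according to `E`. -/
def HasSummableVariation {G : Type*} [Group G] (E : ℕ → Finset G) (φ : Config G → ℝ) : Prop :=
  sumVariation E φ < ∞

/-- `φ_F(x) = ∑_{g ∈ F} φ(g · x)`. -/
noncomputable def energy {G : Type*} [Group G] (φ : Config G → ℝ) (F : Finset G)
    (x : Config G) : ℝ :=
  ∑ g ∈ F, φ (shift g x)

/-- The cylinder set `[w]` of a pattern `w` on `F`. -/
def cyl {G : Type*} (F : Finset G) (w : F → ℕ) : Set (Config G) := {x | ∀ g : F, x g = w g}

/-- The partition function `Z_F(φ) = ∑_w exp (sup φ_F([w]))`, in `[0, ∞]`. -/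
noncomputable def partitionFunction {G : Type*} [Group G] (φ : Config G → ℝ) (F : Finset G) :
    ℝ≥0∞ :=
  ∑' w : F → ℕ, EReal.exp (⨆ x ∈ cyl F w, (energy φ F x : EReal))

/-- `φ` is exp-summable: `Z_{1}(φ) < ∞`. -/
def ExpSummable {G : Type*} [Group G] (φ : Config G → ℝ) : Prop :=
  partitionFunction φ ({1} : Finset G) < ∞

open Classical in
/-- The configuration `w x_{Kᶜ}`: equal to `w` on `K` and to `x` off `K`. -/
noncomputable def glue {G : Type*} (K : Finset G) (w : K → ℕ) (x : Config G) : Config G :=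
  fun g => if h : g ∈ K then w ⟨g, h⟩ else x g

/-- The finite-volume ratio
`∑_w exp(φ_F(w x_{Kᶜ})) 1_{w x_{Kᶜ} ∈ B} / ∑_v exp(φ_F(v x_{Kᶜ}))`. The Gibbsian specification
`γ_K(B, x)` of `φ` is its limit along `F = E_m`, `m → ∞`. -/
noncomputable def gibbsRatio {G : Type*} [Group G] (φ : Config G → ℝ) (F K : Finset G)
    (B : Set (Config G)) (x : Config G) : ℝ≥0∞ :=
  (∑' w : K → ℕ, B.indicator (fun y => ENNReal.ofReal (Real.exp (energy φ F y))) (glue K w x)) /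
    ∑' v : K → ℕ, ENNReal.ofReal (Real.exp (energy φ F (glue K v x)))

/-- `μ` is a DLR measure for `φ`: for all nonempty finite `K` and measurable `B`, for `μ`-almost
every `x`, the limit `γ_K(B, x)` of the finite-volume ratios exists and equals the conditional
probability `μ(B | 𝓑_{Kᶜ})(x)`, where `𝓑_{Kᶜ}` is generated by the coordinates outside `K`. -/
structure IsDLR {G : Type*} [Group G] (E : ℕ → Finset G) (φ : Config G → ℝ)
    (μ : Measure (Config G)) : Prop where
  isProbabilityMeasure : IsProbabilityMeasure μ
  condProb : ∀ K : Finset G, K.Nonempty → ∀ B : Set (Config G), MeasurableSet B →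
    ∀ᵐ x ∂μ, Tendsto (fun m => gibbsRatio φ (E m) K B x) atTop
      (𝓝 (ENNReal.ofReal ((μ⟦B | cylinderEvents (X := fun _ : G => ℕ) (K : Set G)ᶜ⟧) x)))

/-- `μ` is `G`-invariant. -/
def IsShiftInvariant {G : Type*} [Group G] (μ : Measure (Config G)) : Prop :=
  ∀ g : G, μ.map (shift g) = μ

/-- The Shannon entropy `H_F(ν) = -∑_w ν([w]) log ν([w])` over patterns `w` on `F`, in `[0, ∞]`. -/
noncomputable def shannonEntropy {G : Type*} (ν : Measure (Config G)) (F : Finset G) : ℝ≥0∞ :=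
  ∑' w : F → ℕ, ENNReal.ofReal (Real.negMulLog (ν.real (cyl F w)))

/-- The entropy `h(ν) = lim_{F → G} H_F(ν) / |F|` as `F` becomes more and more invariant, written
as an upper limit in `[0, ∞]` so that it is defined without a convergence proof. -/
noncomputable def entropy {G : Type*} [Group G] (ν : Measure (Config G)) : ℝ≥0∞ :=
  limsup (fun F : Finset G => shannonEntropy ν F / (F.card : ℝ≥0∞)) (moreInvariant G)

/-- The invariant probability measures `ν` with `∫ φ dν > -∞`. The potentials considered are
measurable and bounded above, so that `∫ φ dν > -∞` means integrability. -/
structure IsAdmissible {G : Type*} [Group G] (φ : Config G → ℝ) (ν : Measure (Config G)) :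
    Prop where
  isProbabilityMeasure : IsProbabilityMeasure ν
  invariant : IsShiftInvariant ν
  integrable : Integrable φ ν

/-- `μ` is an equilibrium measure for `φ`: it is invariant, `∫ φ dμ > -∞`, and
`h(μ) + ∫ φ dμ` is the supremum of `h(ν) + ∫ φ dν` over the invariant `ν` with `∫ φ dν > -∞`. -/
structure IsEquilibrium {G : Type*} [Group G] (φ : Config G → ℝ) (μ : Measure (Config G)) :
    Prop where
  admissible : IsAdmissible φ μ
  maximizes : (entropy μ : EReal) + ((∫ x, φ x ∂μ : ℝ) : EReal) =
    ⨆ (ν : Measure (Config G)) (_ : IsAdmissible φ ν),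
      ((entropy ν : EReal) + ((∫ x, φ x ∂ν : ℝ) : EReal))

end GibbsShift

/-! The heart is a variational comparison, `IsEquilibrium.exp_mul_le`: if overwriting the pattern of
`U` on `L` by that of `U'` changes the total energy by at least `c`, whatever stands off `L`, then
`e^c μ[U] ≤ μ[U']`. Write `p = μ[U]`, `q = μ[U']` and suppose `e^c p > q`. Choose, independently of
the configuration, a stationary random set of sites `g` of density `ρ > 0` whose translates `L g`
are disjoint; at each of them that shows `U`, write `U'` with probability `t`. The resulting law is
again invariant. Per site its energy has grown by at least `ρ p t c` and its entropy by at least `ρ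
p t log((1-t)p / (q+tp))`. For small `t` the sum is positive, which contradicts maximality.

The energy estimate uses only the regularity that summable variation provides (`IsRegular`);
amenability makes boundary terms negligible. The entropy estimate adds one site at a time
(`law_insert`): each step moves a proportion `t` of the mass between paired atoms
(`ofReal_add_le_tsum_negMulLog_of_transfer`), and the gain survives averaging over the random sites
because entropy is concave (`lintegral_shannonEntropy_le`).

Apply the comparison in both directions to patterns on `L ⊇ K` that differ only on `K`, with `L` so
large that energy differences are nearly constant on cylinders over `L`. In the limit this is
detailed balance between any two patterns on `K`, given the outside
(`IsEquilibrium.crossMeasure_comm`). Summing over patterns shows that the normalised weights are a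
version of the conditional probability (`IsEquilibrium.setLIntegral_weightSum`). Exp-summability
enters twice: it makes the one-site entropy finite, and it dominates the finite-volume weights, so
that their ratios converge. -/

namespace GibbsShift

variable {G : Type*}

/-! ### The translation action. -/

section Shift

variable [Group G]

@[simp] theorem shift_apply (g h : G) (x : Config G) : shift g x h = x (h * g) := rfl

theorem shift_shift (g h : G) (x : Config G) : shift g (shift h x) = shift (g * h) x := by
  ext k; simp [mul_assoc]

theorem shift_one (x : Config G) : shift (1 : G) x = x := by
  ext k; simp

theorem measurable_shift (g : G) : Measurable (shift g : Config G → Config G) :=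
  measurable_pi_lambda _ fun _ => measurable_pi_apply _

end Shift

/-- The regularity of a potential that is used below: it is uniformly continuous, its variation over
the identity coordinate is bounded, and a change of the configuration on a finite set has a summable
effect on the translates. -/
structure IsRegular [Group G] (φ : Config G → ℝ) : Prop where
  uniform : ∀ ε : ℝ, 0 < ε → ∃ F : Finset G, ∀ x y : Config G, (∀ g ∈ F, x g = y g) →
    |φ x - φ y| ≤ ε
  bounded : ∃ δ : ℝ, ∀ x y : Config G, x 1 = y 1 → |φ x - φ y| ≤ δ
  decay : ∃ r : G → ℝ, Summable r ∧ (∀ g, 0 ≤ r g) ∧ ∀ (K : Finset G) (x y : Config G),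
    (∀ g ∉ K, x g = y g) → ∀ g ∉ K, |φ (shift g y) - φ (shift g x)| ≤ ∑ k ∈ K, r (k * g⁻¹)

/-! ### From summable variation to regularity. -/

section Variation

theorem ofReal_abs_sub_le_variation (φ : Config G → ℝ) {F : Finset G} {x y : Config G}
    (h : ∀ g ∈ F, x g = y g) : ENNReal.ofReal |φ x - φ y| ≤ variation φ F :=
  le_iSup_of_le x (le_iSup_of_le y (le_iSup_of_le h le_rfl))

theorem abs_sub_le_variation (φ : Config G → ℝ) {F : Finset G} {x y : Config G}
    (hF : variation φ F ≠ ∞) (h : ∀ g ∈ F, x g = y g) : |φ x - φ y| ≤ (variation φ F).toReal := by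
  rw [← ENNReal.ofReal_le_iff_le_toReal hF]
  exact ofReal_abs_sub_le_variation φ h

variable [Group G] {E : ℕ → Finset G} {φ : Config G → ℝ}

open Classical in
theorem IsExhausting.card_ne_zero (hE : IsExhausting E) (m : ℕ) :
    (E (m + 2) \ E (m + 1)).card ≠ 0 := by
  rw [Finset.card_ne_zero, Finset.sdiff_nonempty]
  exact (hE.strictMono (Nat.lt_succ_self (m + 1))).2

-- Inversion is a bijection, so the multiplicities in `sumVariation` are the sizes of the layers
-- themselves.
open Classical in
theorem card_inv_sdiff (E : ℕ → Finset G) (m : ℕ) :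
    ((E (m + 2))⁻¹ \ (E (m + 1))⁻¹).card = (E (m + 2) \ E (m + 1)).card := by
  rw [← Finset.card_inv (E (m + 2) \ E (m + 1))]
  congr 1
  ext g
  simp [Finset.mem_inv']

open Classical in
theorem tsum_card_mul_variation (hvar : HasSummableVariation E φ) :
    ∑' m : ℕ, ((E (m + 2) \ E (m + 1)).card : ℝ≥0∞) * variation φ (E (m + 1)) ≠ ∞ := by
  have h := hvar.ne
  unfold sumVariation at h
  convert h using 5
  exact (card_inv_sdiff E _).symm

open Classical in
theorem IsExhausting.variation_le (hE : IsExhausting E) (m : ℕ) :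
    variation φ (E (m + 1)) ≤
      ((E (m + 2) \ E (m + 1)).card : ℝ≥0∞) * variation φ (E (m + 1)) := by
  refine le_mul_of_one_le_left' ?_
  exact_mod_cast Nat.one_le_iff_ne_zero.2 (hE.card_ne_zero m)

theorem IsExhausting.variation_ne_top (hE : IsExhausting E) (hvar : HasSummableVariation E φ)
    (m : ℕ) : variation φ (E (m + 1)) ≠ ∞ :=
  ne_top_of_le_ne_top (ENNReal.ne_top_of_tsum_ne_top (tsum_card_mul_variation hvar) m)
    (hE.variation_le m)

theorem IsExhausting.tendsto_variation (hE : IsExhausting E) (hvar : HasSummableVariation E φ) :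
    Tendsto (fun m => variation φ (E (m + 1))) atTop (𝓝 0) := by
  refine tendsto_of_tendsto_of_tendsto_of_le_of_le tendsto_const_nhds
    (ENNReal.tendsto_atTop_zero_of_tsum_ne_top (tsum_card_mul_variation hvar))
    (fun _ => zero_le) fun m => hE.variation_le m

open Classical in
/-- The variation attached to the layer `E (m + 2) \ E (m + 1)` containing a group element. -/
noncomputable def layerVariation (E : ℕ → Finset G) (φ : Config G → ℝ) (h : G) : ℝ≥0∞ :=
  ∑' m : ℕ, if h ∈ E (m + 2) \ E (m + 1) then variation φ (E (m + 1)) else 0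

/-- After exchanging the sums, each layer contributes its variation once per element. This makes
`layerVariation` the summable function `r` of `IsRegular`. -/
theorem tsum_layerVariation_ne_top (hvar : HasSummableVariation E φ) :
    ∑' h, layerVariation E φ h ≠ ∞ := by
  classical
  unfold layerVariation
  rw [ENNReal.tsum_comm]
  convert tsum_card_mul_variation hvar using 3 with m
  rw [tsum_eq_sum (s := E (m + 2) \ E (m + 1)) (fun b hb => if_neg hb),
    Finset.sum_congr rfl (fun b hb => if_pos hb)]
  simp

/-- Seen from `g`, a change on `K` takes place on `K g⁻¹`. Let `E n` be the first set of the
sequence that meets `K g⁻¹`: the translates agree on `E (n - 1)`, whose variation is charged to the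
element of `K g⁻¹` in the layer just reached. -/
theorem IsExhausting.ofReal_abs_sub_le_sum_layerVariation (hE : IsExhausting E) {K : Finset G}
    {x y : Config G} (hxy : ∀ g ∉ K, x g = y g) {g : G} (hg : g ∉ K) (hK : K.Nonempty) :
    ENNReal.ofReal |φ (shift g y) - φ (shift g x)| ≤ ∑ k ∈ K, layerVariation E φ (k * g⁻¹) := by
  classical
  have hex : ∃ n, ∃ k ∈ K, k * g⁻¹ ∈ E n := by
    obtain ⟨k, hk⟩ := hK
    obtain ⟨n, hn⟩ := hE.exhausts (k * g⁻¹)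
    exact ⟨n, k, hk, hn⟩
  obtain ⟨k, hk, hkn⟩ := Nat.find_spec hex
  have hmin := fun m => Nat.find_min hex (m := m)
  set n := Nat.find hex with hn
  -- `E 0` is empty and `E 1 = {1}` would force `g ∈ K`, so `n` is at least `2` and the layer
  -- exists.
  obtain _ | _ | m := n
  · simp [hE.zero] at hkn
  · simp only [zero_add, hE.one, Finset.mem_singleton, mul_inv_eq_one] at hkn
    exact absurd (hkn ▸ hk) hg
  · have h1 := hmin (m + 1) (by omega)
    push Not at h1
    have h2 : variation φ (E (m + 1)) ≤ layerVariation E φ (k * g⁻¹) := by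
      refine le_trans ?_ (ENNReal.le_tsum m)
      rw [if_pos (Finset.mem_sdiff.2 ⟨hkn, h1 k hk⟩)]
    refine le_trans (ofReal_abs_sub_le_variation φ (F := E (m + 1)) ?_)
      (h2.trans (Finset.single_le_sum (f := fun k => layerVariation E φ (k * g⁻¹))
        (fun _ _ => zero_le) hk))
    intro e he
    simp only [shift_apply]
    refine (hxy _ fun h => h1 _ h ?_).symm
    simpa using he

theorem IsExhausting.isRegular (hE : IsExhausting E) (hvar : HasSummableVariation E φ) :
    IsRegular φ where
  uniform ε hε := by
    have h := (hE.tendsto_variation hvar).eventually (gt_mem_nhds (ENNReal.ofReal_pos.2 hε))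
    obtain ⟨m, hm⟩ := h.exists
    refine ⟨E (m + 1), fun x y hxy => (abs_sub_le_variation φ (hE.variation_ne_top hvar m)
      hxy).trans ?_⟩
    exact ENNReal.toReal_le_of_le_ofReal hε.le hm.le
  bounded := by
    refine ⟨(variation φ (E 1)).toReal, fun x y hxy =>
      abs_sub_le_variation φ (hE.variation_ne_top hvar 0) ?_⟩
    simpa [hE.one] using hxy
  decay := by
    have hD := tsum_layerVariation_ne_top hvar
    refine ⟨fun h => (layerVariation E φ h).toReal, ENNReal.summable_toReal hD,
      fun _ => ENNReal.toReal_nonneg, fun K x y hxy g hg => ?_⟩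
    rcases K.eq_empty_or_nonempty with rfl | hK
    · have : x = y := funext fun g => hxy g (by simp)
      simp [this]
    rw [← ENNReal.toReal_sum fun k _ => ENNReal.ne_top_of_tsum_ne_top hD _,
      ← ENNReal.ofReal_le_iff_le_toReal]
    · exact hE.ofReal_abs_sub_le_sum_layerVariation hxy hg hK
    · exact ENNReal.sum_ne_top.2 fun k _ => ENNReal.ne_top_of_tsum_ne_top hD _

end Variation

/-! ### Energy differences in infinite volume. -/

section Hamiltonian

variable [Group G] {φ : Config G → ℝ}

theorem IsRegular.continuous (hφ : IsRegular φ) : Continuous φ := by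
  rw [continuous_iff_continuousAt]
  intro x
  rw [ContinuousAt, Metric.tendsto_nhds]
  intro ε hε
  obtain ⟨F, hF⟩ := hφ.uniform (ε / 2) (half_pos hε)
  have h : ∀ᶠ y in 𝓝 x, ∀ g ∈ F, y g = x g := by
    rw [Filter.eventually_all_finset]
    intro g _
    exact (continuous_apply g).continuousAt.eventually ((isOpen_discrete {x g}).mem_nhds rfl)
  filter_upwards [h] with y hy
  rw [Real.dist_eq]
  linarith [hF y x hy]

theorem IsRegular.measurable [Countable G] (hφ : IsRegular φ) : Measurable φ :=
  hφ.continuous.measurable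

/-- The energy difference `∑_g (φ(g · y) - φ(g · x))` between two configurations which agree off a
finite set. -/
noncomputable def energyDiff (φ : Config G → ℝ) (x y : Config G) : ℝ :=
  ∑' g : G, (φ (shift g y) - φ (shift g x))

theorem energyDiff_self (x : Config G) : energyDiff φ x x = 0 := by
  simp [energyDiff]

/-- The majorant of the effect on the translate by `g` of a change on `K`. -/
def majorant (r : G → ℝ) (K : Finset G) (g : G) : ℝ := ∑ k ∈ K, r (k * g⁻¹)

theorem summable_majorant {r : G → ℝ} (hr : Summable r) (K : Finset G) :
    Summable (majorant r K) :=
  summable_sum fun k _ => ((Equiv.inv G).trans (Equiv.mulLeft k)).summable_iff.2 hr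

theorem IsRegular.summable_energyDiff (hφ : IsRegular φ) {K : Finset G} {x y : Config G}
    (hxy : ∀ g ∉ K, x g = y g) : Summable fun g => φ (shift g y) - φ (shift g x) := by
  obtain ⟨r, hr, -, h⟩ := hφ.decay
  refine (summable_majorant hr K).of_norm_bounded_eventually ?_
  exact (K.finite_toSet.subset fun g hg => by
    by_contra hgK
    exact hg (h K x y hxy g hgK))

theorem IsRegular.energyDiff_add (hφ : IsRegular φ) {K : Finset G} {x y z : Config G}
    (hxy : ∀ g ∉ K, x g = y g) (hyz : ∀ g ∉ K, y g = z g) :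
    energyDiff φ x y + energyDiff φ y z = energyDiff φ x z := by
  rw [energyDiff, energyDiff, energyDiff,
    ← (hφ.summable_energyDiff hxy).tsum_add (hφ.summable_energyDiff hyz)]
  congr 1
  ext g
  ring

/-- Energy differences are approximated by those in finite volume, uniformly in the
configurations. -/
theorem IsRegular.exists_finset_abs_sum_sub_energyDiff_le (hφ : IsRegular φ) (K : Finset G) {ε : ℝ}
    (hε : 0 < ε) : ∃ T : Finset G, ∀ F : Finset G, T ⊆ F → ∀ x y : Config G,
      (∀ g ∉ K, x g = y g) → |∑ g ∈ F, (φ (shift g y) - φ (shift g x)) - energyDiff φ x y| ≤ ε := by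
  classical
  obtain ⟨r, hr, hr0, h⟩ := hφ.decay
  have hs := summable_majorant hr K
  have h0 : ∀ g, 0 ≤ majorant r K g := fun g => Finset.sum_nonneg fun _ _ => hr0 _
  have h1 := hs.hasSum.eventually (lt_mem_nhds (sub_lt_self (∑' g, majorant r K g) hε))
  obtain ⟨T, hT⟩ := eventually_atTop.1 h1
  -- `K` is included because the decay bound is only available at sites off `K`; the tail is then
  -- bounded by that of the majorant.
  refine ⟨T ∪ K, fun F hF x y hxy => ?_⟩
  have hTF := hT F (Finset.subset_union_left.trans hF)
  have h2 := (hφ.summable_energyDiff hxy).sum_add_tsum_subtype_compl F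
  have h3 := hs.sum_add_tsum_subtype_compl F
  have h4 : |∑' g : {g // g ∉ F}, (φ (shift (g : G) y) - φ (shift (g : G) x))| ≤
      ∑' g : {g // g ∉ F}, majorant r K g := by
    refine tsum_of_norm_bounded (f := fun g : {g // g ∉ F} =>
      φ (shift (g : G) y) - φ (shift (g : G) x)) (hs.subtype _).hasSum fun g => ?_
    exact h K x y hxy g fun hg => g.2 (hF (Finset.mem_union_right _ hg))
  rw [energyDiff, ← h2, sub_add_cancel_left, abs_neg]
  linarith

end Hamiltonian

/-! ### Gluing a pattern into a configuration. -/

section Glue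

theorem glue_of_mem {K : Finset G} (w : K → ℕ) (x : Config G) {g : G} (hg : g ∈ K) :
    glue K w x g = w ⟨g, hg⟩ := by simp [glue, hg]

theorem glue_of_notMem {K : Finset G} (w : K → ℕ) (x : Config G) {g : G} (hg : g ∉ K) :
    glue K w x g = x g := by simp [glue, hg]

theorem glue_eq_glue_of_notMem {K : Finset G} (w v : K → ℕ) (x : Config G) :
    ∀ g ∉ K, glue K w x g = glue K v x g := fun g hg => by
  rw [glue_of_notMem _ _ hg, glue_of_notMem _ _ hg]

theorem glue_glue {K : Finset G} (w v : K → ℕ) (x : Config G) :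
    glue K w (glue K v x) = glue K w x := by
  ext g
  by_cases hg : g ∈ K
  · rw [glue_of_mem _ _ hg, glue_of_mem _ _ hg]
  · rw [glue_of_notMem _ _ hg, glue_of_notMem _ _ hg, glue_of_notMem _ _ hg]

theorem glue_eq_self {K : Finset G} {w : K → ℕ} {x : Config G} (h : x ∈ cyl K w) :
    glue K w x = x := by
  ext g
  by_cases hg : g ∈ K
  · rw [glue_of_mem _ _ hg]; exact (h ⟨g, hg⟩).symm
  · rw [glue_of_notMem _ _ hg]

theorem measurable_glue (K : Finset G) (w : K → ℕ) : Measurable (glue K w) := by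
  refine measurable_pi_lambda _ fun g => ?_
  by_cases hg : g ∈ K
  · simp only [glue_of_mem _ _ hg]; exact measurable_const
  · simp only [glue_of_notMem _ _ hg]; exact measurable_pi_apply g

theorem measurableSet_cyl (F : Finset G) (w : F → ℕ) : MeasurableSet (cyl F w) := by
  have : cyl F w = ⋂ g : F, (fun x : Config G => x g) ⁻¹' {w g} := by
    ext x; simp [cyl]
  rw [this]
  exact MeasurableSet.iInter fun g => measurable_pi_apply _ (measurableSet_singleton _)

end Glue

end GibbsShift

namespace GibbsShift

variable {G : Type*}

/-! ### Shannon entropy: monotonicity and subadditivity. -/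

section Entropy

/-- The pattern of a configuration on a finite set. -/
def pat (F : Finset G) (x : Config G) : F → ℕ := fun g => x g

theorem measurable_pat (F : Finset G) : Measurable (pat F) :=
  measurable_pi_lambda _ fun _ => measurable_pi_apply _

theorem mem_cyl_iff {F : Finset G} {w : F → ℕ} {x : Config G} : x ∈ cyl F w ↔ pat F x = w :=
  ⟨fun h => funext h, fun h g => congrFun h g⟩

theorem cyl_eq_preimage (F : Finset G) (w : F → ℕ) : cyl F w = pat F ⁻¹' {w} := by
  ext x; exact mem_cyl_iff

theorem lintegral_pat (ν : Measure (Config G)) (F : Finset G) (f : (F → ℕ) → ℝ≥0∞) :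
    ∫⁻ x, f (pat F x) ∂ν = ∑' w, f w * ν (cyl F w) := by
  rw [← lintegral_map (μ := ν) (f := f) (measurable_of_countable f) (measurable_pat F),
    lintegral_countable']
  refine tsum_congr fun w => ?_
  rw [Measure.map_apply (measurable_pat F) (measurableSet_singleton w), cyl_eq_preimage]

/-- An inequality suffices and covers `b = 0`, which occurs for cylinders of measure zero. -/
theorem real_div_mul_le {a : ℝ} (ha : 0 ≤ a) (b : ℝ) : a / b * b ≤ a := by
  rcases eq_or_ne b 0 with rfl | hb
  · simpa using ha
  · rw [div_mul_cancel₀ a hb]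

theorem tsum_measure_cyl (ν : Measure (Config G)) (F : Finset G) :
    ∑' w : F → ℕ, ν (cyl F w) = ν Set.univ := by
  have := lintegral_pat ν F fun _ => 1
  simpa using this.symm

variable (ν : Measure (Config G)) [IsProbabilityMeasure ν]

/-- Entropy as the mean of the information function, so that entropy inequalities can be checked
pointwise almost everywhere. -/
theorem shannonEntropy_eq_lintegral (F : Finset G) :
    shannonEntropy ν F =
      ∫⁻ x, ENNReal.ofReal (-Real.log (ν.real (cyl F (pat F x)))) ∂ν := by
  rw [lintegral_pat ν F fun w => ENNReal.ofReal (-Real.log (ν.real (cyl F w))), shannonEntropy]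
  refine tsum_congr fun w => ?_
  rw [← ofReal_measureReal (μ := ν), ← ENNReal.ofReal_mul', Real.negMulLog]
  · congr 1; ring
  · exact measureReal_nonneg

theorem ae_measureReal_cyl_pos (F : Finset G) : ∀ᵐ x ∂ν, 0 < ν.real (cyl F (pat F x)) := by
  rw [ae_iff]
  have : {x | ¬ 0 < ν.real (cyl F (pat F x))} =
      ⋃ w : {w : F → ℕ // ν (cyl F w) = 0}, cyl F w.1 := by
    ext x
    simp only [Set.mem_ofPred_eq, not_lt, Set.mem_iUnion, Subtype.exists, mem_cyl_iff]
    constructor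
    · intro h
      refine ⟨_, ?_, rfl⟩
      exact (measureReal_eq_zero_iff).1 (le_antisymm h measureReal_nonneg)
    · rintro ⟨w, hw, rfl⟩
      simp [measureReal_def, hw]
  rw [this, measure_iUnion_null_iff]
  exact fun w => w.2

theorem cyl_pat_anti {F F' : Finset G} (h : F ⊆ F') (x : Config G) :
    cyl F' (pat F' x) ⊆ cyl F (pat F x) :=
  fun _ hy g => hy ⟨g, h g.2⟩

theorem shannonEntropy_mono {F F' : Finset G} (h : F ⊆ F') :
    shannonEntropy ν F ≤ shannonEntropy ν F' := by
  rw [shannonEntropy_eq_lintegral, shannonEntropy_eq_lintegral]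
  refine lintegral_mono_ae ?_
  filter_upwards [ae_measureReal_cyl_pos ν F'] with x hx
  refine ENNReal.ofReal_le_ofReal (neg_le_neg (Real.log_le_log hx ?_))
  exact measureReal_mono (cyl_pat_anti h x)

-- Integrate `log s ≤ s - 1` for `s = ρ_A ρ_B / ρ_{A ∪ B}`, the ratio of the product of the
-- marginals to the joint distribution, whose mean is at most `1`.
open Classical in
theorem shannonEntropy_union_le (A B : Finset G) :
    shannonEntropy ν (A ∪ B) ≤ shannonEntropy ν A + shannonEntropy ν B := by
  have hA := Finset.subset_union_left (s₁ := A) (s₂ := B)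
  have hB := Finset.subset_union_right (s₁ := A) (s₂ := B)
  set ρ : (F : Finset G) → Config G → ℝ := fun F x => ν.real (cyl F (pat F x)) with hρ
  have hm : ∀ F : Finset G, Measurable fun x => ENNReal.ofReal (-Real.log (ρ F x)) := fun F =>
    (measurable_of_countable fun w => ENNReal.ofReal (-Real.log (ν.real (cyl F w)))).comp
      (measurable_pat F)
  have h1 : ∫⁻ x, ENNReal.ofReal (ρ A x * ρ B x / ρ (A ∪ B) x) ∂ν ≤ 1 := by
    let rA : (↥(A ∪ B) → ℕ) → (A → ℕ) := fun w g => w ⟨g, hA g.2⟩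
    let rB : (↥(A ∪ B) → ℕ) → (B → ℕ) := fun w g => w ⟨g, hB g.2⟩
    refine (lintegral_pat ν (A ∪ B) fun w =>
      ENNReal.ofReal (ν.real (cyl A (rA w)) * ν.real (cyl B (rB w)) /
        ν.real (cyl (A ∪ B) w))).le.trans ?_
    calc _ ≤ ∑' w : ↥(A ∪ B) → ℕ, ν (cyl A (rA w)) * ν (cyl B (rB w)) := by
          refine ENNReal.tsum_le_tsum fun w => ?_
          rw [← ofReal_measureReal (μ := ν) (s := cyl (A ∪ B) w),
            ← ofReal_measureReal (μ := ν) (s := cyl A (rA w)),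
            ← ofReal_measureReal (μ := ν) (s := cyl B (rB w)),
            ← ENNReal.ofReal_mul measureReal_nonneg, ← ENNReal.ofReal_mul' measureReal_nonneg]
          exact ENNReal.ofReal_le_ofReal (real_div_mul_le
            (mul_nonneg measureReal_nonneg measureReal_nonneg) _)
      -- `A` and `B` may overlap: restricting a pattern to both is injective but need not be onto
      -- the pairs.
      _ ≤ ∑' ab : (A → ℕ) × (B → ℕ), ν (cyl A ab.1) * ν (cyl B ab.2) := by
          refine ENNReal.tsum_comp_le_tsum_of_injective (f := fun w => (rA w, rB w)) ?_
            fun ab : (A → ℕ) × (B → ℕ) => ν (cyl A ab.1) * ν (cyl B ab.2)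
          intro w w' h
          ext g
          rcases Finset.mem_union.1 g.2 with hg | hg
          · exact congrFun (congrArg Prod.fst h) ⟨g, hg⟩
          · exact congrFun (congrArg Prod.snd h) ⟨g, hg⟩
      _ = 1 := by
          rw [ENNReal.tsum_prod (f := fun a b => ν (cyl A a) * ν (cyl B b))]
          simp [ENNReal.tsum_mul_left, tsum_measure_cyl]
  -- The entropies may be infinite, so the constant in `log s ≤ s - 1` is kept on the left and
  -- cancelled at the end.
  have h2 : shannonEntropy ν (A ∪ B) + 1 ≤ shannonEntropy ν A + shannonEntropy ν B + 1 := by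
    refine le_trans ?_ (add_le_add_right h1 _)
    rw [shannonEntropy_eq_lintegral, shannonEntropy_eq_lintegral, shannonEntropy_eq_lintegral,
      ← lintegral_add_left (hm A), ← lintegral_add_left (f := fun x => ENNReal.ofReal (-Real.log (ρ A x)) +
        ENNReal.ofReal (-Real.log (ρ B x))) ((hm A).add (hm B))]
    conv_lhs => rw [← measure_univ (μ := ν), ← lintegral_one, ← lintegral_add_left (hm (A ∪ B))]
    refine lintegral_mono_ae ?_
    filter_upwards [ae_measureReal_cyl_pos ν (A ∪ B)] with x hx
    have hxA : 0 < ρ A x := hx.trans_le (measureReal_mono (cyl_pat_anti hA x))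
    have hxB : 0 < ρ B x := hx.trans_le (measureReal_mono (cyl_pat_anti hB x))
    have l0 : ∀ F, 0 ≤ -Real.log (ρ F x) := fun F =>
      neg_nonneg.2 (Real.log_nonpos measureReal_nonneg measureReal_le_one)
    change ENNReal.ofReal (-Real.log (ρ _ x)) + 1 ≤ ENNReal.ofReal (-Real.log (ρ A x)) +
      ENNReal.ofReal (-Real.log (ρ B x)) + _
    rw [← ENNReal.ofReal_add (l0 _) (l0 _), ← ENNReal.ofReal_add (add_nonneg (l0 _) (l0 _))
      (by positivity), ← ENNReal.ofReal_one, ← ENNReal.ofReal_add (l0 _) zero_le_one]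
    refine ENNReal.ofReal_le_ofReal ?_
    have := Real.log_le_sub_one_of_pos (div_pos (mul_pos hxA hxB) hx)
    rw [Real.log_div (mul_pos hxA hxB).ne' hx.ne', Real.log_mul hxA.ne' hxB.ne'] at this
    simp only [hρ] at this ⊢
    linarith
  exact (ENNReal.add_le_add_iff_right ENNReal.one_ne_top).1 h2

theorem shannonEntropy_empty : shannonEntropy ν ∅ = 0 := by
  rw [shannonEntropy]
  refine ENNReal.tsum_eq_zero.2 fun w => ?_
  have : cyl ∅ w = Set.univ := Set.eq_univ_of_forall fun x g => absurd g.2 (Finset.notMem_empty _)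
  simp [this]

theorem shannonEntropy_le_sum (F : Finset G) :
    shannonEntropy ν F ≤ ∑ f ∈ F, shannonEntropy ν {f} := by
  classical
  induction F using Finset.induction_on with
  | empty => simp [shannonEntropy_empty]
  | insert f F hf ih =>
    rw [Finset.sum_insert hf, Finset.insert_eq]
    exact (shannonEntropy_union_le ν {f} F).trans (add_le_add_right ih _)

end Entropy

/-! ### Mixtures, patterns and events outside a finite set. -/

section Patterns

variable {F : Finset G} {μ : Measure (Config G)}

/-- Concavity of entropy: Jensen's inequality for `-s log s`, atom by atom. -/
theorem lintegral_shannonEntropy_le (ν : Measure (Config G)) {Ω : Type*}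
    [MeasurableSpace Ω] (P : Measure Ω) [IsProbabilityMeasure P] (κ : Ω → Measure (Config G))
    [∀ a, IsProbabilityMeasure (κ a)]
    (F : Finset G) (hκ : ∀ w, Measurable fun a => κ a (cyl F w))
    (hν : ∀ w, ν (cyl F w) = ∫⁻ a, κ a (cyl F w) ∂P) :
    ∫⁻ a, shannonEntropy (κ a) F ∂P ≤ shannonEntropy ν F := by
  unfold shannonEntropy
  have hm : ∀ w : F → ℕ, Measurable fun a => (κ a).real (cyl F w) := fun w => (hκ w).ennreal_toReal
  rw [lintegral_tsum (f := fun w a => ENNReal.ofReal ((κ a).real (cyl F w)).negMulLog)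
    fun w => ((Real.continuous_negMulLog.measurable.comp (hm w)).ennreal_ofReal).aemeasurable]
  refine ENNReal.tsum_le_tsum fun w => ?_
  have hb : ∀ a, (κ a).real (cyl F w) ∈ Set.Icc (0 : ℝ) 1 :=
    fun a => ⟨measureReal_nonneg, measureReal_le_one⟩
  have hi : Integrable (fun a => (κ a).real (cyl F w)) P :=
    Integrable.of_mem_Icc 0 1 (hm w).aemeasurable (ae_of_all _ hb)
  have hi' : Integrable (Real.negMulLog ∘ fun a => (κ a).real (cyl F w)) P := by
    refine Integrable.of_mem_Icc 0 1 (Real.continuous_negMulLog.measurable.comp (hm w)).aemeasurable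
      (ae_of_all _ fun a => ⟨Real.negMulLog_nonneg (hb a).1 (hb a).2, ?_⟩)
    have := Real.negMulLog_le_one_sub_self (hb a).1
    have := (hb a).1
    simp only [Function.comp]; linarith
  have h1 : ν.real (cyl F w) = ∫ a, (κ a).real (cyl F w) ∂P := by
    rw [measureReal_def, hν w]
    exact (integral_toReal (hκ w).aemeasurable (ae_of_all _ fun a => measure_lt_top _ _)).symm
  rw [h1]
  refine (ofReal_integral_eq_lintegral_ofReal hi'
    (ae_of_all _ fun a => Real.negMulLog_nonneg (hb a).1 (hb a).2)).symm.le.trans ?_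
  exact ENNReal.ofReal_le_ofReal (Real.concaveOn_negMulLog.le_map_integral
    Real.continuous_negMulLog.continuousOn isClosed_Ici (ae_of_all _ fun a => (hb a).1) hi hi')

theorem pat_glue (w : F → ℕ) (x : Config G) : pat F (glue F w x) = w :=
  funext fun k => glue_of_mem _ _ k.2

theorem glue_eq_glue_of_eq {K : Finset G} (w : K → ℕ) {x y : Config G} {g : G}
    (h : g ∉ K → x g = y g) : glue K w x g = glue K w y g := by
  by_cases hg : g ∈ K
  · rw [glue_of_mem _ _ hg, glue_of_mem _ _ hg]
  · rw [glue_of_notMem _ _ hg, glue_of_notMem _ _ hg, h hg]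

theorem glue_pat_glue {K L : Finset G} (h : K ⊆ L) (w : K → ℕ) (x y : Config G) :
    glue L (pat L (glue K w x)) y = glue K w (glue L (pat L x) y) := by
  ext g
  by_cases hK : g ∈ K
  · rw [glue_of_mem _ _ (h hK), glue_of_mem _ _ hK]
    exact glue_of_mem _ _ hK
  · rw [glue_of_notMem _ _ hK]
    by_cases hL : g ∈ L
    · rw [glue_of_mem _ _ hL, glue_of_mem _ _ hL]
      exact glue_of_notMem _ _ hK
    · rw [glue_of_notMem _ _ hL, glue_of_notMem _ _ hL]

theorem tsum_indicator_measure_cyl (ν : Measure (Config G)) (F : Finset G) (A : Set (F → ℕ)) :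
    ∑' w, A.indicator (fun w => ν (cyl F w)) w = ν {x | pat F x ∈ A} := by
  have hA : MeasurableSet {x | pat F x ∈ A} := measurable_pat F (Set.to_countable A).measurableSet
  rw [← lintegral_indicator_one hA]
  refine Eq.trans ?_ (lintegral_pat ν F (A.indicator 1)).symm
  refine tsum_congr fun w => ?_
  by_cases hw : w ∈ A <;> simp [hw]

/-- A cylinder over `I` is a countable disjoint union of cylinders over `L`, so the bound may be
proved on any larger window. -/
theorem measure_cyl_le_of_subset {ν₁ ν₂ : Measure (Config G)} {C : ℝ≥0∞} {I L : Finset G}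
    (hIL : I ⊆ L) (h : ∀ z, ν₁ (cyl L z) ≤ C * ν₂ (cyl L z)) (z : I → ℕ) :
    ν₁ (cyl I z) ≤ C * ν₂ (cyl I z) := by
  have h1 : cyl I z = {x | pat L x ∈ {y : L → ℕ | ∀ g : I, y ⟨g, hIL g.2⟩ = z g}} := rfl
  rw [h1, ← tsum_indicator_measure_cyl, ← tsum_indicator_measure_cyl, ← ENNReal.tsum_mul_left]
  refine ENNReal.tsum_le_tsum fun y => ?_
  by_cases hy : y ∈ {y : L → ℕ | ∀ g : I, y ⟨g, hIL g.2⟩ = z g}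
  · rw [Set.indicator_of_mem hy, Set.indicator_of_mem hy]
    exact h y
  · rw [Set.indicator_of_notMem hy]
    exact zero_le

theorem lintegral_eq_tsum_cyl (K : Finset G) (f : Config G → ℝ≥0∞) :
    ∫⁻ x, f x ∂μ = ∑' w : K → ℕ, ∫⁻ x in cyl K w, f x ∂μ := by
  rw [← lintegral_iUnion (measurableSet_cyl K), ← setLIntegral_univ]
  · congr 2
    symm
    exact Set.eq_univ_of_forall fun x => Set.mem_iUnion.2 ⟨pat K x, mem_cyl_iff.2 rfl⟩
  · intro w v hwv
    refine Set.disjoint_left.2 fun x hx hx' => hwv ?_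
    rw [mem_cyl_iff] at hx hx'
    exact hx.symm.trans hx'

theorem measurable_cylinderEvents_glue (K : Finset G) (w : K → ℕ) :
    Measurable[cylinderEvents (X := fun _ : G => ℕ) (K : Set G)ᶜ] (glue K w) := by
  refine @measurable_pi_lambda _ _ _ (cylinderEvents (X := fun _ : G => ℕ) (K : Set G)ᶜ) _ _
    fun g => ?_
  by_cases hg : g ∈ K
  · simp only [glue_of_mem _ _ hg]
    exact measurable_const
  · simp only [glue_of_notMem _ _ hg]
    exact measurable_cylinderEvent_apply (X := fun _ : G => ℕ) (Δ := (K : Set G)ᶜ) (i := g)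
      (by simpa using hg)

/-- Outside coordinates are unchanged by `glue K w`, so every outside event is a preimage under this
idempotent map. -/
theorem glue_mem_iff_of_measurableSet {K : Finset G} {A : Set (Config G)}
    (hA : MeasurableSet[cylinderEvents (X := fun _ : G => ℕ) (K : Set G)ᶜ] A) (w : K → ℕ)
    (x : Config G) : glue K w x ∈ A ↔ x ∈ A := by
  have hle : cylinderEvents (X := fun _ : G => ℕ) (K : Set G)ᶜ ≤
      MeasurableSpace.comap (glue K w) MeasurableSpace.pi := by
    refine iSup₂_le fun i hi => ?_
    have h1 : (fun σ : Config G => σ i) = (fun σ : Config G => σ i) ∘ glue K w := by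
      ext σ
      exact (glue_of_notMem _ _ (by simpa using hi)).symm
    rw [h1, ← MeasurableSpace.comap_comp]
    exact MeasurableSpace.comap_mono (measurable_iff_comap_le.1 (measurable_pi_apply i))
  obtain ⟨A', -, rfl⟩ := hle A hA
  simp [Set.mem_preimage, glue_glue]

end Patterns

/-! ### Consequences of exp-summability. -/

section Bound

variable [Group G] {φ : Config G → ℝ}

theorem ExpSummable.exists_bound (hexp : ExpSummable φ) :
    ∃ f : ℕ → ℝ, Summable f ∧ ∀ x : Config G, Real.exp (φ x) ≤ f (x 1) := by
  have h1 : ∀ x : Config G, energy φ {1} x = φ x := fun x => by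
    simp [energy, shift_one]
  set P : (({1} : Finset G) → ℕ) → ℝ≥0∞ := fun w =>
    EReal.exp (⨆ x ∈ cyl {1} w, (energy φ {1} x : EReal)) with hP
  have hs : ∑' w, P w ≠ ∞ := (show partitionFunction φ {1} < ∞ from hexp).ne
  refine ⟨fun a => (P fun _ => a).toReal, ?_, fun x => ?_⟩
  · refine (ENNReal.summable_toReal hs).comp_injective (i := fun (a : ℕ) _ => a) ?_
    intro a b h
    exact congrFun h ⟨1, Finset.mem_singleton_self 1⟩
  · have hx : x ∈ cyl {1} (fun _ : ({1} : Finset G) => x 1) := fun g => by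
      rw [Finset.mem_singleton.1 g.2]
    have h2 : ((φ x : ℝ) : EReal) ≤ ⨆ y ∈ cyl {1} (fun _ : ({1} : Finset G) => x 1),
        (energy φ {1} y : EReal) := by
      rw [← h1 x]
      exact le_iSup₂_of_le x hx le_rfl
    have h3 := EReal.exp_monotone h2
    rw [EReal.exp_coe] at h3
    exact (ENNReal.ofReal_le_iff_le_toReal (ENNReal.ne_top_of_tsum_ne_top hs _)).1 h3

/-- The one-site entropy of a measure that integrates an exp-summable potential is finite. -/
theorem ExpSummable.shannonEntropy_one_ne_top (hexp : ExpSummable φ) (μ : Measure (Config G))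
    [IsProbabilityMeasure μ] (hint : Integrable φ μ) : shannonEntropy μ {1} ≠ ∞ := by
  obtain ⟨f, hf, hφf⟩ := hexp.exists_bound
  let one : ({1} : Finset G) := ⟨1, Finset.mem_singleton_self 1⟩
  have h1 : ∫⁻ x, ENNReal.ofReal (f (x 1) / μ.real (cyl {1} (pat {1} x))) ∂μ ≠ ∞ := by
    have h := lintegral_pat μ {1} fun w => ENNReal.ofReal (f (w one) / μ.real (cyl {1} w))
    refine ne_top_of_le_ne_top ?_ h.le
    have h2 : ∑' a, ENNReal.ofReal (f a) ≠ ∞ := hf.tsum_ofReal_ne_top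
    have h3 : ∑' w : ({1} : Finset G) → ℕ, ENNReal.ofReal (f (w one)) ≠ ∞ := by
      refine ne_top_of_le_ne_top h2 (ENNReal.tsum_comp_le_tsum_of_injective
        (f := fun w : ({1} : Finset G) → ℕ => w one) ?_ fun a => ENNReal.ofReal (f a))
      intro w w' h
      ext g
      have : g = one := Subtype.ext (Finset.mem_singleton.1 g.2)
      rw [this]; exact h
    refine ne_top_of_le_ne_top h3 (ENNReal.tsum_le_tsum fun w => ?_)
    have hf0 : 0 ≤ f (w one) := (Real.exp_pos _).le.trans (hφf fun _ => w one)
    rw [← ofReal_measureReal (μ := μ), ← ENNReal.ofReal_mul' measureReal_nonneg]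
    exact ENNReal.ofReal_le_ofReal (real_div_mul_le hf0 _)
  have h2 : ∫⁻ x, ‖φ x‖ₑ ∂μ ≠ ∞ := hint.2.ne
  rw [shannonEntropy_eq_lintegral]
  refine ne_top_of_le_ne_top (ENNReal.add_ne_top.2 ⟨h2, h1⟩) ?_
  rw [← lintegral_add_left' hint.1.enorm]
  refine lintegral_mono_ae ?_
  filter_upwards [ae_measureReal_cyl_pos μ {1}] with x hx
  have hf0 : 0 < f (x 1) := (Real.exp_pos _).trans_le (hφf x)
  rw [← ofReal_norm, ← ENNReal.ofReal_add (norm_nonneg _) (by positivity)]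
  refine ENNReal.ofReal_le_ofReal ?_
  -- With `ρ` the mass of the one-site cylinder, `log s ≤ s - 1` at `s = f / ρ` gives `-log ρ ≤ f /
  -- ρ - log f ≤ f / ρ - φ`, and the mean of `f / ρ` is at most `∑ f`.
  have h3 := Real.log_le_sub_one_of_pos (div_pos hf0 hx)
  rw [Real.log_div hf0.ne' hx.ne'] at h3
  have h4 : φ x ≤ Real.log (f (x 1)) := (Real.le_log_iff_exp_le hf0).2 (hφf x)
  have h5 : -φ x ≤ ‖φ x‖ := neg_le_abs _
  linarith

end Bound

/-! ### Entropy gained by moving mass between atoms. -/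

section Transfer

/-- Tangents at the new masses bound the gain below by `t x log r` with `r = (1-t)x / (y+tx)`. Then
`log r ≥ log lam + 1 - lam / r` makes the bound linear in `x` and `y`, so that it can be summed over
atoms with one common `lam`. -/
theorem negMulLog_add_le_of_transfer {t lam x y : ℝ} (ht0 : 0 < t) (ht1 : t < 1) (hlam : 0 < lam)
    (hx : 0 ≤ x) (hy : 0 ≤ y) :
    x.negMulLog + y.negMulLog + (t * x * Real.log lam + t * x - t * lam / (1 - t) * (y + t * x)) ≤
      ((1 - t) * x).negMulLog + (y + t * x).negMulLog := by
  have ht' : 0 < 1 - t := sub_pos.2 ht1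
  have tangent : ∀ a b : ℝ, 0 < a → 0 ≤ b →
      b.negMulLog ≤ a.negMulLog + (-Real.log a - 1) * (b - a) := by
    intro a b ha hb
    simp only [Real.negMulLog]
    rcases hb.eq_or_lt with rfl | hb
    · simp only [neg_zero, zero_mul]; linarith
    · have h := Real.log_le_sub_one_of_pos (div_pos ha hb)
      rw [Real.log_div ha.ne' hb.ne'] at h
      have h' := mul_le_mul_of_nonneg_left h hb.le
      have : b * (a / b - 1) = a - b := by field_simp
      linarith
  rcases hx.eq_or_lt with rfl | hx
  · simp only [mul_zero, zero_mul, add_zero, zero_sub, zero_add, Real.negMulLog_zero]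
    have : 0 ≤ t * lam / (1 - t) * y := by positivity
    linarith
  · have h1 := tangent ((1 - t) * x) x (mul_pos ht' hx) hx.le
    have ha2 : 0 < y + t * x := by positivity
    have h2 := tangent (y + t * x) y ha2 hy
    have h3 := Real.one_sub_inv_le_log_of_pos
      (show 0 < (1 - t) * x / (lam * (y + t * x)) by positivity)
    rw [Real.log_div (by positivity) (by positivity), Real.log_mul hlam.ne' ha2.ne', inv_div] at h3
    have h4 := mul_le_mul_of_nonneg_left h3 (show 0 ≤ t * x by positivity)
    have h5 : t * x * (1 - lam * (y + t * x) / ((1 - t) * x)) =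
        t * x - t * lam / (1 - t) * (y + t * x) := by
      field_simp
    nlinarith [h1, h2, h4, h5]

/-- Each term of `B` is moved next to its partner in `A`, so that two such sums can be compared term
by term. -/
theorem tsum_eq_tsum_pair {ι : Type*} (A B : Set ι) [DecidablePred (· ∈ A)] [DecidablePred (· ∈ B)]
    (hAB : Disjoint A B) (s : ι ≃ ι) (hs : ∀ z, s z ∈ B ↔ z ∈ A) (f : ι → ℝ≥0∞) :
    ∑' z, f z = ∑' z, if z ∈ A then f z + f (s z) else if z ∈ B then 0 else f z := by
  have h1 : ∑' z, f z = ∑' z, ((if z ∈ B then f z else 0) + if z ∈ B then 0 else f z) :=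
    tsum_congr fun z => by split_ifs <;> simp
  rw [h1, ENNReal.tsum_add, ← s.tsum_eq, ← ENNReal.tsum_add]
  refine tsum_congr fun z => ?_
  simp only [hs]
  by_cases hA : z ∈ A
  · have hB : z ∉ B := fun h => Set.disjoint_left.1 hAB hA h
    simp [hA, hB, add_comm]
  · simp [hA]

/-- The entropy gained when a proportion `t` of the mass of every atom in `A` is moved to the
corresponding atom in `B`. -/
theorem ofReal_add_le_tsum_negMulLog_of_transfer {ι : Type*} {m m' : ι → ℝ} (hm0 : ∀ z, 0 ≤ m z)
    (hm1 : ∀ z, m z ≤ 1) (hm0' : ∀ z, 0 ≤ m' z) (hm1' : ∀ z, m' z ≤ 1) {A B : Set ι}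
    (hAB : Disjoint A B) (s : ι ≃ ι) (hs : ∀ z, s z ∈ B ↔ z ∈ A) {t p q : ℝ}
    (ht0 : 0 < t) (ht1 : t < 1) (hA : ∀ z ∈ A, m' z = (1 - t) * m z)
    (hB : ∀ z ∈ A, m' (s z) = m (s z) + t * m z) (hrest : ∀ z, z ∉ A → z ∉ B → m' z = m z)
    (hp : 0 < p) (hq : 0 ≤ q) (hpA : ∑' z, A.indicator (fun z => ENNReal.ofReal (m z)) z =
      ENNReal.ofReal p)
    (hqB : ∑' z, A.indicator (fun z => ENNReal.ofReal (m (s z))) z = ENNReal.ofReal q)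
    {h : ℝ} (hh : ENNReal.ofReal h ≤ ∑' z, ENNReal.ofReal (m z).negMulLog) :
    ENNReal.ofReal (h + t * p * Real.log ((1 - t) * p / (q + t * p))) ≤
      ∑' z, ENNReal.ofReal (m' z).negMulLog := by
  classical
  have ht' : 0 < 1 - t := sub_pos.2 ht1
  set lam := (1 - t) * p / (q + t * p) with hlam
  have hden : 0 < q + t * p := by positivity
  have hlam0 : 0 < lam := by positivity
  -- The gain on the pair `z, s z` is at least `α m(z) - β m(s z)`. Adding `|α|` on both sides keeps
  -- all terms nonnegative, as sums in `[0, ∞]` require.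
  set α := t * Real.log lam + t - t * lam / (1 - t) * t with hα
  set β := t * lam / (1 - t) with hβ
  have hβ0 : 0 ≤ β := by positivity
  have hα0 : 0 ≤ α + |α| := by linarith [neg_abs_le α]
  have e0 : ∀ z, 0 ≤ (m z).negMulLog := fun z => Real.negMulLog_nonneg (hm0 z) (hm1 z)
  have e0' : ∀ z, 0 ≤ (m' z).negMulLog := fun z => Real.negMulLog_nonneg (hm0' z) (hm1' z)
  have key : ∑' z, ENNReal.ofReal (m z).negMulLog + ENNReal.ofReal ((α + |α|) * p) ≤
      ∑' z, ENNReal.ofReal (m' z).negMulLog + ENNReal.ofReal (|α| * p + β * q) := by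
    rw [tsum_eq_tsum_pair A B hAB s hs fun z => ENNReal.ofReal (m z).negMulLog,
      tsum_eq_tsum_pair A B hAB s hs fun z => ENNReal.ofReal (m' z).negMulLog,
      ENNReal.ofReal_mul hα0, ENNReal.ofReal_add (mul_nonneg (abs_nonneg α) hp.le)
        (mul_nonneg hβ0 hq),
      ENNReal.ofReal_mul (abs_nonneg α), ENNReal.ofReal_mul hβ0, ← hpA, ← hqB,
      ← ENNReal.tsum_mul_left, ← ENNReal.tsum_mul_left, ← ENNReal.tsum_mul_left,
      ← ENNReal.tsum_add, ← ENNReal.tsum_add, ← ENNReal.tsum_add]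
    refine ENNReal.tsum_le_tsum fun z => ?_
    by_cases hzA : z ∈ A
    · simp only [hzA, if_true, Set.indicator_of_mem]
      rw [← ENNReal.ofReal_mul hα0, ← ENNReal.ofReal_mul (abs_nonneg _), ← ENNReal.ofReal_mul hβ0,
        ← ENNReal.ofReal_add (e0 _) (e0 _), ← ENNReal.ofReal_add (e0' _) (e0' _),
        ← ENNReal.ofReal_add (add_nonneg (e0 _) (e0 _)) (mul_nonneg hα0 (hm0 _)),
        ← ENNReal.ofReal_add (mul_nonneg (abs_nonneg _) (hm0 _)) (mul_nonneg hβ0 (hm0 _)),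
        ← ENNReal.ofReal_add (add_nonneg (e0' _) (e0' _)) (add_nonneg
          (mul_nonneg (abs_nonneg _) (hm0 _)) (mul_nonneg hβ0 (hm0 _)))]
      refine ENNReal.ofReal_le_ofReal ?_
      have h1 := negMulLog_add_le_of_transfer ht0 ht1 hlam0 (hm0 z) (hm0 (s z))
      rw [hA z hzA, hB z hzA]
      rw [← hβ] at h1
      have : α * m z = t * m z * Real.log lam + t * m z - β * t * m z := by rw [hα]; ring
      linarith
    · simp only [hzA, if_false, not_false_eq_true, Set.indicator_of_notMem, mul_zero, add_zero]
      by_cases hzB : z ∈ B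
      · simp [hzB]
      · simp [hzB, hrest z hzA hzB]
  by_cases htop : ∑' z, ENNReal.ofReal (m' z).negMulLog = ∞
  · rw [htop]; exact le_top
  have h1 : ENNReal.ofReal (h + (α + |α|) * p) ≤
      ∑' z, ENNReal.ofReal (m' z).negMulLog + ENNReal.ofReal (|α| * p + β * q) :=
    (ENNReal.ofReal_add_le).trans ((add_le_add_left hh _).trans key)
  have h2 : h + (α + |α|) * p ≤
      (∑' z, ENNReal.ofReal (m' z).negMulLog).toReal + (|α| * p + β * q) := by
    rw [← ENNReal.ofReal_toReal htop, ← ENNReal.ofReal_add ENNReal.toReal_nonneg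
      (by positivity)] at h1
    exact (ENNReal.ofReal_le_ofReal_iff (by positivity)).1 h1
  -- `lam` was chosen as the ratio of the total masses after the transfer, so that `β (q + t p) = t
  -- p` and only the logarithm remains.
  have h3 : α * p - β * q = t * p * Real.log lam := by
    have : β * (q + t * p) = t * p := by
      rw [hβ, hlam]; field_simp
    have : α * p = t * p * Real.log lam + t * p - β * t * p := by rw [hα]; ring
    linarith
  refine ENNReal.ofReal_le_of_le_toReal ?_
  linarith

end Transfer

end GibbsShift

namespace GibbsShift

variable {G : Type*}

/-! ### Interiors of nearly invariant sets. -/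

section Core

variable [Group G]

open Classical in
/-- The elements `g` of `F` with `Q g ⊆ F`. -/
noncomputable def core (Q F : Finset G) : Finset G := F.filter fun g => ∀ q ∈ Q, q * g ∈ F

theorem mem_core {Q F : Finset G} {g : G} : g ∈ core Q F ↔ g ∈ F ∧ ∀ q ∈ Q, q * g ∈ F := by
  simp [core]

theorem core_subset (Q F : Finset G) : core Q F ⊆ F := fun _ hg => (mem_core.1 hg).1

-- If `f ∈ F` is not in the core, then `q f ∉ F` for some `q ∈ Q`, and `f` lies in a translate by
-- `q⁻¹` of the boundary. At most `|Q|` copies of the boundary occur, which explains the choice of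
-- `δ`.
open Classical in
theorem eventually_card_sdiff_core_le (Q : Finset G) {η : ℝ} (hη : 0 < η) :
    ∀ᶠ F in moreInvariant G, 0 < F.card ∧ ((F \ core Q F).card : ℝ) ≤ η * F.card := by
  have hδ : 0 < η / (Q.card + 1) := by positivity
  refine ⟨insert 1 Q, Finset.insert_nonempty _ _, _, hδ, fun F hF => ?_⟩
  have hF' : ((symmDiff (insert 1 Q * F) F).card : ℝ) < η / (Q.card + 1) * F.card := hF
  refine ⟨?_, ?_⟩
  · by_contra h
    rw [Nat.pos_iff_ne_zero, not_not] at h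
    rw [h, Nat.cast_zero, mul_zero] at hF'
    exact absurd hF' (not_lt.2 (Nat.cast_nonneg _))
  · have h1 : F \ core Q F ⊆ Q.biUnion fun q => (symmDiff (insert 1 Q * F) F).image (q⁻¹ * ·) := by
      intro f hf
      rw [Finset.mem_sdiff, mem_core] at hf
      have hf2 := hf.2
      push Not at hf2
      obtain ⟨q, hq, hqf⟩ := hf2 hf.1
      refine Finset.mem_biUnion.2 ⟨q, hq, Finset.mem_image.2 ⟨q * f, ?_, by simp⟩⟩
      exact Finset.mem_symmDiff.2 (Or.inl ⟨Finset.mul_mem_mul (Finset.mem_insert_of_mem hq) hf.1,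
        hqf⟩)
    have h2 : (F \ core Q F).card ≤ Q.card * (symmDiff (insert 1 Q * F) F).card :=
      (Finset.card_le_card h1).trans
        (Finset.card_biUnion_le_card_mul _ _ _ fun _ _ => Finset.card_image_le)
    calc ((F \ core Q F).card : ℝ) ≤ Q.card * (symmDiff (insert 1 Q * F) F).card := by
          exact_mod_cast h2
      _ ≤ Q.card * (η / (Q.card + 1) * F.card) := by gcongr
      _ = (Q.card / (Q.card + 1)) * (η * F.card) := by ring
      _ ≤ 1 * (η * F.card) := by
          gcongr
          exact (div_le_one (by positivity)).2 (by linarith)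
      _ = η * F.card := one_mul _

end Core

/-! ### Rewriting patterns on disjoint translates. -/

section Replace

variable [Group G]

/-- The pattern of `x` on `L g` is that of `U` on `L`. -/
def Matches (L : Finset G) (U : Config G) (g : G) (x : Config G) : Prop :=
  ∀ l ∈ L, x (l * g) = U l

/-- The translates `L g`, `g ∈ τ`, are pairwise disjoint. -/
def IsSep (L : Finset G) (τ : Set G) : Prop :=
  ∀ g ∈ τ, ∀ g' ∈ τ, ∀ l ∈ L, ∀ l' ∈ L, l * g = l' * g' → g = g'

theorem IsSep.mono {L : Finset G} {τ τ' : Set G} (h : IsSep L τ) (hsub : τ' ⊆ τ) : IsSep L τ' :=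
  fun g hg g' hg' => h g (hsub hg) g' (hsub hg')

open Classical in
/-- The configuration obtained from `x` by writing the pattern of `U'` on each `L g`, `g ∈ τ`. -/
noncomputable def repl (L : Finset G) (U' : Config G) (τ : Set G) (x : Config G) : Config G :=
  fun h => if ∃ l ∈ L, l⁻¹ * h ∈ τ then ∑ l ∈ L with l⁻¹ * h ∈ τ, U' l else x h

variable {L : Finset G} {U U' : Config G} {τ τ' : Set G} {x : Config G}

/-- Separation leaves exactly one term in the sum that defines `repl`. -/
theorem repl_mul (hτ : IsSep L τ) {g l : G} (hg : g ∈ τ) (hl : l ∈ L) :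
    repl L U' τ x (l * g) = U' l := by
  classical
  have h : ∃ k ∈ L, k⁻¹ * (l * g) ∈ τ := ⟨l, hl, by simpa using hg⟩
  rw [repl, if_pos h, Finset.sum_eq_single l]
  · intro k hk hkl
    rw [Finset.mem_filter] at hk
    have h1 := hτ _ hk.2 g hg k hk.1 l hl (by simp)
    refine absurd ?_ hkl
    have h2 : k⁻¹ * l * g = 1 * g := by rw [mul_assoc, h1, one_mul]
    exact (inv_mul_eq_one.1 (mul_right_cancel h2))
  · intro hn
    exact absurd (Finset.mem_filter.2 ⟨hl, by simpa using hg⟩) hn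

theorem repl_of_notMem {h : G} (hh : ∀ l ∈ L, l⁻¹ * h ∉ τ) : repl L U' τ x h = x h := by
  rw [repl, if_neg]
  rintro ⟨l, hl, hm⟩
  exact hh l hl hm

theorem repl_congr {h : G} (hh : ∀ l ∈ L, (l⁻¹ * h ∈ τ ↔ l⁻¹ * h ∈ τ')) :
    repl L U' τ x h = repl L U' τ' x h := by
  classical
  have h1 : (∃ l ∈ L, l⁻¹ * h ∈ τ) ↔ ∃ l ∈ L, l⁻¹ * h ∈ τ' :=
    exists_congr fun l => and_congr_right fun hl => hh l hl
  simp only [repl, h1]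
  congr 1
  exact Finset.sum_congr (Finset.filter_congr hh) fun _ _ => rfl

/-- Replacements on disjoint translates do not interfere; this drives the inductions on the set of
sites. -/
theorem repl_insert {g : G} (hτ : IsSep L (insert g τ)) :
    repl L U' (insert g τ) x = repl L U' {g} (repl L U' τ x) := by
  ext h
  by_cases hh : ∃ l ∈ L, l⁻¹ * h = g
  · obtain ⟨l, hl, rfl⟩ := hh
    have h1 := repl_mul (U' := U') (x := x) hτ (Set.mem_insert (l⁻¹ * h) τ) hl
    have h2 := repl_mul (U' := U') (x := repl L U' τ x) (hτ.mono
      (Set.singleton_subset_iff.2 (Set.mem_insert (l⁻¹ * h) τ))) (Set.mem_singleton (l⁻¹ * h)) hl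
    rw [mul_inv_cancel_left] at h1 h2
    rw [h1, h2]
  · push Not at hh
    rw [repl_of_notMem (τ := {g}) hh]
    exact repl_congr fun l hl => by simp [hh l hl]

theorem repl_empty : repl L U' ∅ x = x := by
  ext h; exact repl_of_notMem fun _ _ => Set.notMem_empty _

theorem repl_mul_of_notMem {g l : G} (hτ : IsSep L (insert g τ)) (hg : g ∉ τ) (hl : l ∈ L) :
    repl L U' τ x (l * g) = x (l * g) := by
  refine repl_of_notMem fun k hk hkτ => hg ?_
  have := hτ _ (Set.mem_insert_of_mem g hkτ) g (Set.mem_insert _ _) k hk l hl (by simp)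
  rwa [this] at hkτ

theorem matches_repl_iff {V : Config G} {g : G} (hτ : IsSep L (insert g τ)) (hg : g ∉ τ) :
    Matches L V g (repl L U' τ x) ↔ Matches L V g x :=
  forall₂_congr fun l hl => by rw [repl_mul_of_notMem hτ hg hl]

/-- Replacement is equivariant, which is why the random replacement below yields an invariant law.
-/
theorem shift_repl (s : G) :
    shift s (repl L U' τ x) = repl L U' {g | g * s ∈ τ} (shift s x) := by
  ext h
  have h1 : ∀ l : G, l⁻¹ * h ∈ {g | g * s ∈ τ} ↔ l⁻¹ * (h * s) ∈ τ := fun l => by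
    rw [Set.mem_ofPred_eq, mul_assoc]
  have h2 : (∃ l ∈ L, l⁻¹ * h ∈ {g | g * s ∈ τ}) ↔ ∃ l ∈ L, l⁻¹ * (h * s) ∈ τ := by
    exact exists_congr fun l => and_congr_right fun _ => h1 l
  rw [shift_apply, repl, repl]
  by_cases h3 : ∃ l ∈ L, l⁻¹ * (h * s) ∈ τ
  · rw [if_pos h3, if_pos (h2.2 h3)]
    refine Finset.sum_congr (Finset.ext fun l => ?_) fun _ _ => rfl
    simp only [Finset.mem_filter, h1]
  · rw [if_neg h3, if_neg fun h4 => h3 (h2.1 h4), shift_apply]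

theorem matches_shift {s g : G} : Matches L U g (shift s x) ↔ Matches L U (g * s) x := by
  simp [Matches, mul_assoc]

theorem isSep_singleton (g : G) : IsSep L {g} := by
  rintro _ rfl _ rfl _ _ _ _ _
  rfl

theorem glue_pat (L : Finset G) (x : Config G) (h : Matches L U 1 x) : glue L (pat L U) x = x :=
  glue_eq_self fun g => by simpa [pat] using h g g.2

theorem repl_singleton_one : repl L U' {1} x = glue L (pat L U') x := by
  ext h
  by_cases hh : h ∈ L
  · rw [glue_of_mem _ _ hh]
    simpa [pat] using repl_mul (U' := U') (x := x) (isSep_singleton (1 : G))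
      (Set.mem_singleton 1) hh
  · rw [glue_of_notMem _ _ hh]
    refine repl_of_notMem fun l hl hl' => hh ?_
    rw [Set.mem_singleton_iff, inv_mul_eq_one] at hl'
    exact hl' ▸ hl

theorem shift_repl_singleton (g : G) :
    shift g (repl L U' {g} x) = glue L (pat L U') (shift g x) := by
  rw [shift_repl, ← repl_singleton_one]
  congr 1
  ext h
  simp

end Replace

/-! ### Effect of replacements on the energy. -/

section EnergyReplace

variable [Group G] {φ : Config G → ℝ} {L : Finset G} {U U' : Config G}

theorem energy_shift_sub (F : Finset G) (g : G) (x y : Config G) [DecidableEq G] :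
    energy φ F y - energy φ F x =
      ∑ k ∈ F.image (· * g⁻¹), (φ (shift k (shift g y)) - φ (shift k (shift g x))) := by
  rw [Finset.sum_image fun a _ b _ h => mul_right_cancel h, energy, energy,
    ← Finset.sum_sub_distrib]
  simp [shift_shift]

/-- Replace one site at a time. For `g` in the core, the window seen from `g` contains `T`, so the
change within `F` is the infinite-volume difference up to `ε`. By separation, `U` still stands on `L
g` when its turn comes. -/
theorem IsRegular.exists_le_energy_repl (hφ : IsRegular φ) {c : ℝ}
    (hc : ∀ x, c ≤ energyDiff φ (glue L (pat L U) x) (glue L (pat L U') x)) {ε : ℝ} (hε : 0 < ε) :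
    ∃ T : Finset G, ∀ (F τ : Finset G) (x : Config G), IsSep L (τ : Set G) → τ ⊆ core T F →
      (∀ g ∈ τ, Matches L U g x) →
      energy φ F x + τ.card * (c - ε) ≤ energy φ F (repl L U' τ x) := by
  classical
  obtain ⟨T, hT⟩ := hφ.exists_finset_abs_sum_sub_energyDiff_le L hε
  refine ⟨T, fun F τ x => ?_⟩
  induction τ using Finset.induction_on with
  | empty => intro _ _ _; simp [repl_empty]
  | insert g τ hg ih =>
    intro hsep hτ hm
    rw [Finset.coe_insert] at hsep ⊢
    have h1 := ih (hsep.mono (Set.subset_insert _ _))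
      ((Finset.subset_insert _ _).trans hτ) fun k hk => hm k (Finset.mem_insert_of_mem hk)
    set y := repl L U' (τ : Set G) x with hy
    have hmy : Matches L U 1 (shift g y) := by
      rw [matches_shift, one_mul, hy, matches_repl_iff hsep (by simpa using hg)]
      exact hm g (Finset.mem_insert_self _ _)
    have hyg : shift g y = glue L (pat L U) (shift g y) := (glue_pat L _ hmy).symm
    have h2 := hT (F.image (· * g⁻¹)) (fun q hq => by
      have := (mem_core.1 (hτ (Finset.mem_insert_self g τ))).2 q hq
      exact Finset.mem_image.2 ⟨q * g, this, by simp⟩) (shift g y) (shift g (repl L U' {g} y))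
      (by
        rw [shift_repl_singleton]
        exact fun h hh => (glue_of_notMem _ _ hh).symm)
    rw [← energy_shift_sub, shift_repl_singleton] at h2
    have h3 := hc (shift g y)
    rw [← hyg] at h3
    rw [repl_insert hsep, Finset.card_insert_of_notMem hg]
    have h4 := (abs_le.1 h2).1
    push_cast
    linarith

/-- The crude bound for boundary sites, uniform in `τ`. Up to `δ`, the value at `f` depends only on
the symbol there, and a replacement can only turn some `U l` into `U' l`, so constant configurations
serve for comparison. -/
theorem IsRegular.exists_abs_sub_repl_le (hφ : IsRegular φ) (L : Finset G) (U U' : Config G) :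
    ∃ C : ℝ, 0 ≤ C ∧ ∀ (τ : Set G) (x : Config G) (f : G), IsSep L τ →
      (∀ g ∈ τ, Matches L U g x) → |φ (shift f (repl L U' τ x)) - φ (shift f x)| ≤ C := by
  obtain ⟨δ, hδ⟩ := hφ.bounded
  have hδ0 : 0 ≤ δ := (abs_nonneg _).trans (hδ (fun _ => 0) (fun _ => 0) rfl)
  have hs : ∀ l ∈ L, |φ (fun _ => U' l) - φ (fun _ => U l)| ≤
      ∑ l ∈ L, |φ (fun _ => U' l) - φ (fun _ => U l)| := fun l hl =>
    Finset.single_le_sum (f := fun l => |φ (fun _ => U' l) - φ (fun _ => U l)|)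
      (fun _ _ => abs_nonneg _) hl
  refine ⟨2 * δ + ∑ l ∈ L, |φ (fun _ => U' l) - φ (fun _ => U l)|, add_nonneg (by positivity)
    (Finset.sum_nonneg fun _ _ => abs_nonneg _), fun τ x f hsep hm => ?_⟩
  by_cases hf : ∃ l ∈ L, l⁻¹ * f ∈ τ
  · obtain ⟨l, hl, hlτ⟩ := hf
    have h1 := repl_mul (U' := U') (x := x) hsep hlτ hl
    have h2 := hm _ hlτ l hl
    rw [mul_inv_cancel_left] at h1 h2
    have h3 := hδ (shift f (repl L U' τ x)) (fun _ => U' l) (by simpa using h1)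
    have h4 := hδ (shift f x) (fun _ => U l) (by simpa using h2)
    have h5 := hs l hl
    rw [abs_le] at h3 h4 h5 ⊢
    constructor <;> linarith [h3.1, h3.2, h4.1, h4.2, h5.1, h5.2]
  · push Not at hf
    have h0 : 0 ≤ ∑ l ∈ L, |φ (fun _ => U' l) - φ (fun _ => U l)| :=
      Finset.sum_nonneg fun _ _ => abs_nonneg _
    have := hδ (shift f (repl L U' τ x)) (shift f x) (by simpa using repl_of_notMem hf)
    linarith

open Classical in
/-- The energy gained by replacing matched translates, up to boundary terms. -/
theorem IsRegular.exists_le_energy_repl_set (hφ : IsRegular φ) {c : ℝ}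
    (hc : ∀ x, c ≤ energyDiff φ (glue L (pat L U) x) (glue L (pat L U') x)) {ε : ℝ} (hε : 0 < ε) :
    ∃ (T Q : Finset G) (C : ℝ), 0 ≤ C ∧ ∀ (F : Finset G) (τ : Set G) (x : Config G), IsSep L τ →
      (∀ g ∈ τ, Matches L U g x) →
      energy φ F x + ((core T F).filter (· ∈ τ)).card * (c - ε) - ε * F.card
        - C * (F \ core Q F).card ≤ energy φ F (repl L U' τ x) := by
  obtain ⟨T, hT⟩ := hφ.exists_le_energy_repl hc hε
  obtain ⟨C, hC0, hC⟩ := hφ.exists_abs_sub_repl_le L U U'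
  obtain ⟨W, hW⟩ := hφ.uniform ε hε
  -- For `f` in this core, the coordinates in `W f` are affected only by sites in `core T F`, where
  -- `τ` and its finite part `D` coincide. Elsewhere both are compared with `x`, hence `2 * C`.
  refine ⟨T, insert 1 T * L⁻¹ * W, 2 * C, by positivity, fun F τ x hsep hm => ?_⟩
  set D := (core T F).filter (· ∈ τ) with hD
  have hDτ : (D : Set G) ⊆ τ := fun g hg => (Finset.mem_filter.1 hg).2
  have h1 := hT F D x (hsep.mono hDτ) (Finset.filter_subset _ _) fun g hg => hm g (hDτ hg)
  set Q := insert 1 T * L⁻¹ * W with hQ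
  have hgood : ∀ f ∈ core Q F,
      |φ (shift f (repl L U' τ x)) - φ (shift f (repl L U' D x))| ≤ ε := by
    intro f hf
    refine hW _ _ fun e he => ?_
    simp only [shift_apply]
    refine repl_congr fun l hl => ⟨fun h => Finset.mem_filter.2 ⟨?_, h⟩, fun h => hDτ h⟩
    have hmem : ∀ q ∈ insert 1 T, q * (l⁻¹ * (e * f)) ∈ F := fun q hq => by
      have := (mem_core.1 hf).2 (q * l⁻¹ * e)
        (Finset.mul_mem_mul (Finset.mul_mem_mul hq (Finset.inv_mem_inv hl)) he)
      simpa [mul_assoc] using this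
    refine mem_core.2 ⟨by simpa using hmem 1 (Finset.mem_insert_self _ _), fun q hq =>
      hmem q (Finset.mem_insert_of_mem hq)⟩
  have hbad : ∀ f, |φ (shift f (repl L U' τ x)) - φ (shift f (repl L U' D x))| ≤ 2 * C := by
    intro f
    have h2 := hC τ x f hsep hm
    have h3 := hC D x f (hsep.mono hDτ) fun g hg => hm g (hDτ hg)
    rw [abs_le] at h2 h3 ⊢
    constructor <;> linarith [h2.1, h2.2, h3.1, h3.2]
  have h2 : energy φ F (repl L U' D x) - energy φ F (repl L U' τ x) ≤
      ε * F.card + 2 * C * (F \ core Q F).card := by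
    rw [energy, energy, ← Finset.sum_sub_distrib, ← Finset.sum_sdiff (core_subset Q F), add_comm]
    refine add_le_add ?_ ?_
    · calc _ ≤ ∑ f ∈ core Q F, ε := Finset.sum_le_sum fun f hf => by
            linarith [(abs_le.1 (hgood f hf)).1]
        _ = ε * (core Q F).card := by simp [mul_comm]
        _ ≤ ε * F.card := by
            gcongr
            exact core_subset Q F
    · calc _ ≤ ∑ f ∈ F \ core Q F, 2 * C := Finset.sum_le_sum fun f hf => by
            linarith [(abs_le.1 (hbad f)).1]
        _ = 2 * C * (F \ core Q F).card := by simp [mul_comm]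
  linarith

end EnergyReplace

end GibbsShift

namespace GibbsShift

variable {G : Type*}

/-! ### Independent coins. -/

section Labels

/-- The distribution of a coin showing `1` with probability `t` and `0` otherwise. -/
noncomputable def coin (t : ℝ) : Measure ℕ :=
  ENNReal.ofReal t • Measure.dirac 1 + ENNReal.ofReal (1 - t) • Measure.dirac 0

theorem isProbabilityMeasure_coin {t : ℝ} (ht0 : 0 < t) (ht1 : t < 1) :
    IsProbabilityMeasure (coin t) := by
  constructor
  simp only [coin, Measure.coe_add, Measure.coe_smul, Pi.add_apply, Pi.smul_apply, measure_univ,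
    smul_eq_mul, mul_one]
  rw [← ENNReal.ofReal_add ht0.le (sub_nonneg.2 ht1.le)]
  simp

theorem coin_apply (t : ℝ) (S : Set ℕ) :
    coin t S = ENNReal.ofReal t * S.indicator 1 1 + ENNReal.ofReal (1 - t) * S.indicator 1 0 := by
  simp [coin]

variable (G) in
/-- Independent coins indexed by `G`. -/
noncomputable def labels (t : ℝ) : Measure (Config G) := Measure.infinitePi fun _ => coin t

theorem isProbabilityMeasure_labels {t : ℝ} (ht0 : 0 < t) (ht1 : t < 1) :
    IsProbabilityMeasure (labels G t) := by
  have := isProbabilityMeasure_coin ht0 ht1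
  unfold labels
  infer_instance

theorem map_shift_labels [Group G] {t : ℝ} (ht0 : 0 < t) (ht1 : t < 1) (g : G) :
    (labels G t).map (shift g) = labels G t := by
  have := isProbabilityMeasure_coin ht0 ht1
  refine Measure.eq_infinitePi _ fun s u hu => ?_
  rw [Measure.map_apply (measurable_shift g) (MeasurableSet.pi s.countable_toSet fun i _ => hu i)]
  have h1 : shift g ⁻¹' (Set.pi s u) =
      Set.pi (s.map (Equiv.mulRight g).toEmbedding) fun i => u (i * g⁻¹) := by
    ext x
    simp only [Set.mem_preimage, Set.mem_pi, Finset.mem_coe, shift_apply, Finset.mem_map_equiv,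
      Equiv.mulRight_symm_apply]
    exact ⟨fun h i hi => by simpa using h _ hi, fun h i hi => by
      simpa using h (i * g) (by simpa using hi)⟩
  rw [h1, labels, Measure.infinitePi_pi _ fun i _ => hu _, Finset.prod_map]
  simp

/-- Conditioning on the coin at `g`. The identity of measures is checked on finite boxes, where the
factor at `g` splits off. -/
theorem labels_update [DecidableEq G] {t : ℝ} (ht0 : 0 < t) (ht1 : t < 1) (g : G)
    {S : Set (Config G)} (hS : MeasurableSet S) :
    labels G t S = ENNReal.ofReal t * labels G t {b | Function.update b g 1 ∈ S} +
      ENNReal.ofReal (1 - t) * labels G t {b | Function.update b g 0 ∈ S} := by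
  have := isProbabilityMeasure_coin ht0 ht1
  have hm : ∀ j : ℕ, Measurable fun b : Config G => Function.update b g j := fun j =>
    measurable_update_left
  have key : ENNReal.ofReal t • (labels G t).map (fun b => Function.update b g 1) +
      ENNReal.ofReal (1 - t) • (labels G t).map (fun b => Function.update b g 0) = labels G t := by
    refine Measure.eq_infinitePi _ fun s u hu => ?_
    have hbox := MeasurableSet.pi s.countable_toSet fun i (_ : i ∈ (s : Set G)) => hu i
    simp only [Measure.coe_add, Measure.coe_smul, Pi.add_apply, Pi.smul_apply, smul_eq_mul]
    rw [Measure.map_apply (hm 1) hbox, Measure.map_apply (hm 0) hbox]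
    by_cases hg : g ∈ s
    · have h1 : ∀ j : ℕ, labels G t ((fun b : Config G => Function.update b g j) ⁻¹' Set.pi s u) =
          (u g).indicator 1 j * ∏ i ∈ s.erase g, coin t (u i) := by
        intro j
        by_cases hj : j ∈ u g
        · have : (fun b : Config G => Function.update b g j) ⁻¹' Set.pi s u =
              Set.pi (s.erase g) u := by
            ext b
            simp only [Set.mem_preimage, Set.mem_pi, Finset.mem_coe, Finset.mem_erase]
            refine ⟨fun h i hi => by simpa [hi.1] using h i hi.2, fun h i hi => ?_⟩
            rcases eq_or_ne i g with rfl | hne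
            · simpa using hj
            · simpa [hne] using h i ⟨hne, hi⟩
          rw [this, labels, Measure.infinitePi_pi _ fun i _ => hu i]
          simp [hj]
        · have : (fun b : Config G => Function.update b g j) ⁻¹' Set.pi s u = ∅ := by
            ext b
            simp only [Set.mem_preimage, Set.mem_pi, Finset.mem_coe, Set.mem_empty_iff_false,
              iff_false]
            exact fun h => hj (by simpa using h g hg)
          rw [this]
          simp [hj]
      rw [h1, h1, ← Finset.mul_prod_erase s (fun i => coin t (u i)) hg, coin_apply]
      ring
    · have h1 : ∀ j : ℕ, (fun b : Config G => Function.update b g j) ⁻¹' Set.pi s u =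
          Set.pi s u := by
        intro j
        ext b
        refine forall₂_congr fun i hi => ?_
        have : i ≠ g := fun h => hg (h ▸ hi)
        simp [this]
      rw [h1, h1, ← add_mul, ← ENNReal.ofReal_add ht0.le (sub_nonneg.2 ht1.le)]
      rw [labels, Measure.infinitePi_pi _ fun i _ => hu i]
      simp
  conv_lhs => rw [← key]
  simp only [Measure.coe_add, Measure.coe_smul, Pi.add_apply, Pi.smul_apply, smul_eq_mul]
  rw [Measure.map_apply (hm 1) hS, Measure.map_apply (hm 0) hS]
  rfl

theorem labels_eq_one {t : ℝ} (ht0 : 0 < t) (ht1 : t < 1) (g : G) :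
    labels G t {b | b g = 1} = ENNReal.ofReal t := by
  have := isProbabilityMeasure_coin ht0 ht1
  have h1 : {b : Config G | b g = 1} = Set.pi ({g} : Finset G) fun _ => {1} := by
    ext b; simp
  rw [h1, labels, Measure.infinitePi_pi _ fun i _ => measurableSet_singleton _]
  simp [coin_apply]

open Classical in
theorem integral_card_filter {Z : Type*} [MeasurableSpace Z] (P : Measure Z) [IsProbabilityMeasure P]
    {τ : Z → Set G} (hτ : ∀ g, MeasurableSet {z | g ∈ τ z}) {r : ℝ}
    (hr : ∀ g, P.real {z | g ∈ τ z} = r) (S : Finset G) :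
    Integrable (fun z => ((S.filter (· ∈ τ z)).card : ℝ)) P ∧
      ∫ z, ((S.filter (· ∈ τ z)).card : ℝ) ∂P = S.card * r := by
  have h1 : (fun z => ((S.filter (· ∈ τ z)).card : ℝ)) =
      fun z => ∑ g ∈ S, {z | g ∈ τ z}.indicator (fun _ => (1 : ℝ)) z := by
    ext z
    rw [Finset.card_filter]
    push_cast
    exact Finset.sum_congr rfl fun g _ => rfl
  have h2 : ∀ g ∈ S, Integrable ({z | g ∈ τ z}.indicator fun _ => (1 : ℝ)) P := fun g _ =>
    (integrable_const 1).indicator (hτ g)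
  rw [h1]
  refine ⟨integrable_finsetSum S h2, ?_⟩
  rw [integral_finsetSum S h2, Finset.sum_congr rfl fun g _ => by
    rw [integral_indicator (hτ g), setIntegral_const, hr, smul_eq_mul, mul_one]]
  simp

theorem isProbabilityMeasure_labels_half : IsProbabilityMeasure (labels G (1 / 2)) :=
  isProbabilityMeasure_labels (by norm_num) (by norm_num)

variable {t : ℝ} {μ : Measure (Config G)}

variable (t μ) in
/-- The joint law of the labels, the configuration and the coins. -/
noncomputable def joint : Measure (Config G × Config G × Config G) :=
  (labels G (1 / 2)).prod (μ.prod (labels G t))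

theorem isProbabilityMeasure_joint [IsProbabilityMeasure μ] (ht0 : 0 < t) (ht1 : t < 1) :
    IsProbabilityMeasure (joint t μ) := by
  have := isProbabilityMeasure_labels_half (G := G)
  have := isProbabilityMeasure_labels (G := G) ht0 ht1
  unfold joint
  infer_instance

theorem integrable_comp_joint [IsProbabilityMeasure μ] (ht0 : 0 < t) (ht1 : t < 1)
    {f : Config G → ℝ} (hf : Integrable f μ) : Integrable (fun z => f z.2.1) (joint t μ) ∧
      ∫ z, f z.2.1 ∂(joint t μ) = ∫ x, f x ∂μ := by
  have := isProbabilityMeasure_labels_half (G := G)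
  have := isProbabilityMeasure_labels (G := G) ht0 ht1
  have h1 : (joint t μ).map (fun z => z.2.1) = μ := by
    have : (fun z : Config G × Config G × Config G => z.2.1) = Prod.fst ∘ Prod.snd := rfl
    rw [this, ← Measure.map_map measurable_fst measurable_snd, joint,
      Measure.map_snd_prod, measure_univ, one_smul, Measure.map_fst_prod, measure_univ, one_smul]
  have hm : Measurable fun z : Config G × Config G × Config G => z.2.1 := by fun_prop
  have hf' : Integrable f ((joint t μ).map fun z => z.2.1) := h1.symm ▸ hf
  refine ⟨hf'.comp_measurable hm, ?_⟩
  conv_rhs => rw [← h1, integral_map hm.aemeasurable hf'.1]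

end Labels

/-! ### The law after random replacements at a fixed set of sites. -/

section Law

variable [Group G]

/-- The sites of `A` whose coin shows `1` and where the configuration has the pattern of `U`. -/
def trigger (L : Finset G) (U : Config G) (A : Set G) (x b : Config G) : Set G :=
  {g | g ∈ A ∧ b g = 1 ∧ Matches L U g x}

theorem measurableSet_matches (L : Finset G) (U : Config G) (g : G) :
    MeasurableSet {x : Config G | Matches L U g x} := by
  have : {x : Config G | Matches L U g x} = ⋂ l ∈ L, (fun x : Config G => x (l * g)) ⁻¹' {U l} := by
    ext x; simp [Matches]
  rw [this]
  exact Finset.measurableSet_biInter L fun l _ => measurable_pi_apply _ (measurableSet_singleton _)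

theorem measurable_repl {Z : Type*} [MeasurableSpace Z] (L : Finset G) (U' : Config G)
    {τ : Z → Set G} (hτ : ∀ g, MeasurableSet {z | g ∈ τ z}) {f : Z → Config G} (hf : Measurable f) :
    Measurable fun z => repl L U' (τ z) (f z) := by
  classical
  refine measurable_pi_lambda _ fun h => ?_
  unfold repl
  refine Measurable.ite ?_ ?_ ((measurable_pi_apply h).comp hf)
  · have : {z | ∃ l ∈ L, l⁻¹ * h ∈ τ z} = ⋃ l ∈ L, {z | l⁻¹ * h ∈ τ z} := by
      ext z; simp
    rw [this]
    exact Finset.measurableSet_biUnion L fun l _ => hτ _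
  · simp only [Finset.sum_filter]
    exact Finset.measurable_sum L fun l _ => Measurable.ite (hτ _) measurable_const measurable_const

theorem measurableSet_mem_trigger {Z : Type*} [MeasurableSpace Z] (L : Finset G) (U : Config G)
    {A : Z → Set G} (hA : ∀ g, MeasurableSet {z | g ∈ A z}) {x b : Z → Config G}
    (hx : Measurable x) (hb : Measurable b) (g : G) :
    MeasurableSet {z | g ∈ trigger L U (A z) (x z) (b z)} :=
  (hA g).inter (((measurable_pi_apply g).comp hb (measurableSet_singleton 1)).inter
    (hx (measurableSet_matches L U g)))

/-- The random replacement of the pattern of `U` by that of `U'` on the translates `L g`,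
`g ∈ A`. -/
noncomputable def resample (L : Finset G) (U U' : Config G) (A : Set G)
    (z : Config G × Config G) : Config G :=
  repl L U' (trigger L U A z.1 z.2) z.1

variable {L : Finset G} {U U' : Config G} {A : Set G}

theorem trigger_subset (x b : Config G) : trigger L U A x b ⊆ A := fun _ h => h.1

theorem measurable_resample (L : Finset G) (U U' : Config G) (A : Set G) :
    Measurable (resample L U U' A) :=
  measurable_repl L U' (measurableSet_mem_trigger L U (A := fun _ => A)
    (fun _ => MeasurableSet.const _) measurable_fst measurable_snd) measurable_fst

/-- The law of the random replacement. -/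
noncomputable def law (L : Finset G) (U U' : Config G) (t : ℝ) (μ : Measure (Config G))
    (A : Set G) : Measure (Config G) :=
  (μ.prod (labels G t)).map (resample L U U' A)

theorem isProbabilityMeasure_law {t : ℝ} (ht0 : 0 < t) (ht1 : t < 1) (μ : Measure (Config G))
    [IsProbabilityMeasure μ] : IsProbabilityMeasure (law L U U' t μ A) := by
  have := isProbabilityMeasure_labels (G := G) ht0 ht1
  exact Measure.isProbabilityMeasure_map (measurable_resample L U U' A).aemeasurable

theorem law_empty {t : ℝ} (ht0 : 0 < t) (ht1 : t < 1) (μ : Measure (Config G))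
    [IsProbabilityMeasure μ] : law L U U' t μ ∅ = μ := by
  have := isProbabilityMeasure_labels (G := G) ht0 ht1
  have h : resample L U U' ∅ = Prod.fst := by
    ext1 z
    have : trigger L U ∅ z.1 z.2 = ∅ := Set.subset_empty_iff.1 (trigger_subset _ _)
    rw [resample, this, repl_empty]
  rw [law, h]
  simp

/-- Earlier replacements never touch `L g`, so the masses `p` and `q` are still available when `g`
is added. -/
theorem law_matches {t : ℝ} (ht0 : 0 < t) (ht1 : t < 1) (μ : Measure (Config G))
    [IsProbabilityMeasure μ] {g : G} (hA : IsSep L (insert g A)) (hg : g ∉ A) (V : Config G) :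
    law L U U' t μ A {x | Matches L V g x} = μ {x | Matches L V g x} := by
  have := isProbabilityMeasure_labels (G := G) ht0 ht1
  rw [law, Measure.map_apply (measurable_resample L U U' A) (measurableSet_matches L V g)]
  have h : resample L U U' A ⁻¹' {x | Matches L V g x} =
      {x | Matches L V g x} ×ˢ Set.univ := by
    ext z
    simp only [Set.mem_preimage, Set.mem_ofPred_eq, Set.mem_prod, Set.mem_univ, and_true]
    exact matches_repl_iff (hA.mono (Set.insert_subset_insert (trigger_subset _ _)))
      fun h => hg (trigger_subset _ _ h)
  rw [h, Measure.prod_prod, measure_univ, mul_one]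

open Classical in
/-- The replacement at the site `g`. -/
noncomputable def replAt (L : Finset G) (U U' : Config G) (g : G) (y : Config G) : Config G :=
  if Matches L U g y then repl L U' {g} y else y

theorem measurable_replAt (L : Finset G) (U U' : Config G) (g : G) :
    Measurable (replAt L U U' g) :=
  Measurable.ite (measurableSet_matches L U g)
    (measurable_repl L U' (fun _ => MeasurableSet.const _) measurable_id) measurable_id

theorem resample_update_zero [DecidableEq G] {g : G} (hg : g ∉ A) (x b : Config G) :
    resample L U U' (insert g A) (x, Function.update b g 0) = resample L U U' A (x, b) := by
  have : trigger L U (insert g A) x (Function.update b g 0) = trigger L U A x b := by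
    ext h
    rcases eq_or_ne h g with rfl | hne
    · simp [trigger, hg]
    · simp only [trigger, Set.mem_insert_iff, hne, false_or, ne_eq, not_false_eq_true,
        Function.update_of_ne, Set.mem_ofPred_eq]
  simp only [resample, this]

theorem resample_update_one [DecidableEq G] {g : G} (hA : IsSep L (insert g A)) (hg : g ∉ A)
    (x b : Config G) : resample L U U' (insert g A) (x, Function.update b g 1) =
      replAt L U U' g (resample L U U' A (x, b)) := by
  have hsub : insert g (trigger L U A x b) ⊆ insert g A :=
    Set.insert_subset_insert (trigger_subset _ _)
  have hiff : Matches L U g (resample L U U' A (x, b)) ↔ Matches L U g x :=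
    matches_repl_iff (hA.mono hsub) fun h => hg (trigger_subset _ _ h)
  by_cases hm : Matches L U g x
  · rw [replAt, if_pos (hiff.2 hm)]
    have : trigger L U (insert g A) x (Function.update b g 1) = insert g (trigger L U A x b) := by
      ext h
      rcases eq_or_ne h g with rfl | hne
      · simp [trigger, hm]
      · simp only [trigger, Set.mem_insert_iff, hne, false_or, ne_eq, not_false_eq_true,
        Function.update_of_ne, Set.mem_ofPred_eq]
    simp only [resample, this]
    exact repl_insert (hA.mono hsub)
  · rw [replAt, if_neg (fun h => hm (hiff.1 h))]
    have : trigger L U (insert g A) x (Function.update b g 1) = trigger L U A x b := by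
      ext h
      rcases eq_or_ne h g with rfl | hne
      · simp [trigger, hm]
      · simp only [trigger, Set.mem_insert_iff, hne, false_or, ne_eq, not_false_eq_true,
        Function.update_of_ne, Set.mem_ofPred_eq]
    simp only [resample, this]

/-- Condition on the coin at `g`: with probability `t` the replacement at `g` is applied on top of
the others, and otherwise nothing changes. -/
theorem law_insert {t : ℝ} (ht0 : 0 < t) (ht1 : t < 1) (μ : Measure (Config G))
    [IsProbabilityMeasure μ] {g : G} (hA : IsSep L (insert g A)) (hg : g ∉ A) {S : Set (Config G)}
    (hS : MeasurableSet S) :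
    (law L U U' t μ (insert g A)).real S = t * (law L U U' t μ A).real (replAt L U U' g ⁻¹' S) +
      (1 - t) * (law L U U' t μ A).real S := by
  classical
  have := isProbabilityMeasure_labels (G := G) ht0 ht1
  have := isProbabilityMeasure_law (L := L) (U := U) (U' := U') (A := A) ht0 ht1 μ
  have hm := measurable_resample L U U'
  have hS' := measurable_replAt L U U' g hS
  have key : law L U U' t μ (insert g A) S =
      ENNReal.ofReal t * law L U U' t μ A (replAt L U U' g ⁻¹' S) +
        ENNReal.ofReal (1 - t) * law L U U' t μ A S := by
    rw [law, law, Measure.map_apply (hm _) hS, Measure.map_apply (hm _) hS,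
      Measure.map_apply (hm _) hS', Measure.prod_apply (hm _ hS), Measure.prod_apply (hm _ hS),
      Measure.prod_apply (hm _ hS'), ← lintegral_const_mul _ (measurable_measure_prodMk_left
      (hm _ hS)), ← lintegral_const_mul _ (measurable_measure_prodMk_left (hm _ hS')),
      ← lintegral_add_left ((measurable_measure_prodMk_left (hm _ hS')).const_mul _)]
    refine lintegral_congr fun x => ?_
    rw [labels_update ht0 ht1 g (measurable_prodMk_left (hm _ hS))]
    congr 3
    · ext b
      simp only [Set.mem_ofPred_eq, Set.mem_preimage, resample_update_one hA hg]
    · ext b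
      simp only [Set.mem_ofPred_eq, Set.mem_preimage, resample_update_zero hg]
  rw [measureReal_def, key, ENNReal.toReal_add (by finiteness) (by finiteness), ENNReal.toReal_mul,
    ENNReal.toReal_mul, ENNReal.toReal_ofReal ht0.le, ENNReal.toReal_ofReal (sub_nonneg.2 ht1.le)]
  rfl

end Law

end GibbsShift

namespace GibbsShift

variable {G : Type*} [Group G] {L F : Finset G} {U U' : Config G} {g : G}

/-! ### Pairing of atoms by exchanging two patterns. -/

section Swap

theorem repl_pat_congr {V : Config G} {τ : Set G} {y y' : Config G} (h : pat F y = pat F y') :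
    pat F (repl L V τ y) = pat F (repl L V τ y') := by
  classical
  ext k
  have := congrFun h k
  simp only [pat] at this
  simp only [pat, repl, this]

theorem matches_repl_singleton (V y : Config G) : Matches L V g (repl L V {g} y) :=
  fun _ hl => repl_mul (isSep_singleton g) (Set.mem_singleton g) hl

theorem repl_singleton_repl_singleton {V W y : Config G} (hy : Matches L V g y) :
    repl L V {g} (repl L W {g} y) = y := by
  ext h
  by_cases hh : ∃ l ∈ L, l⁻¹ * h = g
  · obtain ⟨l, hl, rfl⟩ := hh
    have h1 := matches_repl_singleton (g := l⁻¹ * h) V (repl L W {l⁻¹ * h} y) l hl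
    have h2 := hy l hl
    rw [mul_inv_cancel_left] at h1 h2
    rw [h1, h2]
  · push Not at hh
    rw [repl_of_notMem hh, repl_of_notMem hh]

theorem not_matches_both (hne : ∃ l ∈ L, U l ≠ U' l) {y : Config G} (h : Matches L U g y) :
    ¬ Matches L U' g y := fun h' => by
  obtain ⟨l, hl, hU⟩ := hne
  exact hU ((h l hl).symm.trans (h' l hl))

theorem matches_congr (hg : ∀ l ∈ L, l * g ∈ F) {V y y' : Config G} (h : pat F y = pat F y') :
    Matches L V g y ↔ Matches L V g y' :=
  forall₂_congr fun l hl => by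
    have : y (l * g) = y' (l * g) := congrFun h ⟨l * g, hg l hl⟩
    rw [this]

open Classical in
/-- The involution exchanging the patterns of `U` and `U'` on `L g`. -/
noncomputable def swapAt (L : Finset G) (U U' : Config G) (g : G) (y : Config G) : Config G :=
  if Matches L U g y then repl L U' {g} y else if Matches L U' g y then repl L U {g} y else y

theorem swapAt_swapAt (hne : ∃ l ∈ L, U l ≠ U' l) (y : Config G) :
    swapAt L U U' g (swapAt L U U' g y) = y := by
  by_cases h : Matches L U g y
  · have h1 : swapAt L U U' g y = repl L U' {g} y := if_pos h
    have h2 : Matches L U' g (repl L U' {g} y) := matches_repl_singleton U' y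
    rw [h1, swapAt, if_neg fun h3 => not_matches_both hne h3 h2, if_pos h2,
      repl_singleton_repl_singleton h]
  · by_cases h' : Matches L U' g y
    · have h1 : swapAt L U U' g y = repl L U {g} y := by rw [swapAt, if_neg h, if_pos h']
      rw [h1, swapAt, if_pos (matches_repl_singleton U y), repl_singleton_repl_singleton h']
    · have h1 : swapAt L U U' g y = y := by rw [swapAt, if_neg h, if_neg h']
      rw [h1, h1]

/-- Since `L g ⊆ F`, the exchange is visible inside `F`. It therefore descends to patterns, and the
filling by `0` in `swapPat` is immaterial. -/
theorem swapAt_pat_congr (hg : ∀ l ∈ L, l * g ∈ F) {y y' : Config G} (h : pat F y = pat F y') :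
    pat F (swapAt L U U' g y) = pat F (swapAt L U U' g y') := by
  classical
  simp only [swapAt, matches_congr hg h]
  split_ifs
  exacts [repl_pat_congr h, repl_pat_congr h, h]

/-- The involution of the patterns on `F` exchanging the patterns of `U` and `U'` on `L g`. -/
noncomputable def swapPat (hne : ∃ l ∈ L, U l ≠ U' l) (hg : ∀ l ∈ L, l * g ∈ F) :
    (F → ℕ) ≃ (F → ℕ) :=
  Function.Involutive.toPerm (fun w => pat F (swapAt L U U' g (glue F w 0))) fun w => by
    change pat F (swapAt L U U' g (glue F (pat F (swapAt L U U' g (glue F w 0))) 0)) = w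
    rw [swapAt_pat_congr hg (pat_glue _ _), swapAt_swapAt hne, pat_glue]

theorem swapPat_of_matches (hne : ∃ l ∈ L, U l ≠ U' l) (hg : ∀ l ∈ L, l * g ∈ F) {w : F → ℕ}
    (hw : Matches L U g (glue F w 0)) :
    swapPat hne hg w = pat F (repl L U' {g} (glue F w 0)) := by
  change pat F (swapAt L U U' g (glue F w 0)) = _
  rw [swapAt, if_pos hw]

theorem matches_swapPat_iff (hne : ∃ l ∈ L, U l ≠ U' l) (hg : ∀ l ∈ L, l * g ∈ F) (w : F → ℕ) :
    Matches L U' g (glue F (swapPat hne hg w) 0) ↔ Matches L U g (glue F w 0) := by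
  change Matches L U' g (glue F (pat F (swapAt L U U' g (glue F w 0))) 0) ↔ _
  rw [matches_congr hg (pat_glue _ _), swapAt]
  split_ifs with h3 h4
  · exact iff_of_true (matches_repl_singleton U' _) h3
  · exact iff_of_false (not_matches_both hne (matches_repl_singleton U _)) h3
  · exact iff_of_false h4 h3

theorem replAt_preimage_cyl_of_matches (hne : ∃ l ∈ L, U l ≠ U' l) (hg : ∀ l ∈ L, l * g ∈ F)
    {w : F → ℕ} (hw : Matches L U g (glue F w 0)) : replAt L U U' g ⁻¹' cyl F w = ∅ := by
  ext y
  simp only [Set.mem_preimage, mem_cyl_iff, Set.mem_empty_iff_false, iff_false]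
  intro hy
  have h1 : Matches L U g (replAt L U U' g y) :=
    (matches_congr hg (hy.trans (pat_glue w 0).symm)).2 hw
  by_cases h : Matches L U g y
  · rw [replAt, if_pos h] at h1
    exact not_matches_both hne h1 (matches_repl_singleton U' y)
  · rw [replAt, if_neg h] at h1
    exact h h1

/-- The target atom receives its partner and keeps itself, so `law_insert` gives it the mass `m (s
z) + t * m z` required by the transfer estimate. -/
theorem replAt_preimage_cyl_swapPat (hne : ∃ l ∈ L, U l ≠ U' l) (hg : ∀ l ∈ L, l * g ∈ F)
    {w : F → ℕ} (hw : Matches L U g (glue F w 0)) :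
    replAt L U U' g ⁻¹' cyl F (swapPat hne hg w) = cyl F w ∪ cyl F (swapPat hne hg w) := by
  rw [swapPat_of_matches hne hg hw]
  ext y
  simp only [Set.mem_preimage, mem_cyl_iff, Set.mem_union]
  by_cases h : Matches L U g y
  · rw [replAt, if_pos h]
    constructor
    · intro hy
      left
      have := repl_pat_congr (L := L) (V := U) (τ := {g}) hy
      rwa [repl_singleton_repl_singleton h, repl_singleton_repl_singleton hw, pat_glue] at this
    · rintro (hy | hy)
      · exact repl_pat_congr (hy.trans (pat_glue w 0).symm)
      · exact absurd (matches_repl_singleton U' _)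
          (not_matches_both hne ((matches_congr hg hy).1 h))
  · rw [replAt, if_neg h]
    refine ⟨Or.inr, ?_⟩
    rintro (hy | hy)
    · exact absurd ((matches_congr hg (hy.trans (pat_glue w 0).symm)).2 hw) h
    · exact hy

theorem replAt_preimage_cyl_of_not (hg : ∀ l ∈ L, l * g ∈ F)
    {w : F → ℕ} (hw : ¬ Matches L U g (glue F w 0)) (hw' : ¬ Matches L U' g (glue F w 0)) :
    replAt L U U' g ⁻¹' cyl F w = cyl F w := by
  ext y
  simp only [Set.mem_preimage, mem_cyl_iff]
  by_cases h : Matches L U g y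
  · rw [replAt, if_pos h]
    constructor
    · intro hy
      exact absurd ((matches_congr hg (hy.trans (pat_glue w 0).symm)).1
        (matches_repl_singleton U' y)) hw'
    · intro hy
      exact absurd ((matches_congr hg (hy.trans (pat_glue w 0).symm)).1 h) hw
  · rw [replAt, if_neg h]

end Swap

/-! ### Entropy gained by replacements at a fixed set of sites. -/

section Gain

/-- The entropy gained by one replacement. -/
theorem ofReal_add_le_shannonEntropy_law_insert (hne : ∃ l ∈ L, U l ≠ U' l)
    (hg : ∀ l ∈ L, l * g ∈ F) {t : ℝ} (ht0 : 0 < t) (ht1 : t < 1) (μ : Measure (Config G))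
    [IsProbabilityMeasure μ] {A : Set G} (hA : IsSep L (insert g A)) (hgA : g ∉ A) {p q : ℝ}
    (hp : 0 < p) (hpU : μ.real {x | Matches L U g x} = p) (hqU : μ.real {x | Matches L U' g x} = q)
    {h : ℝ} (hh : ENNReal.ofReal h ≤ shannonEntropy (law L U U' t μ A) F) :
    ENNReal.ofReal (h + t * p * Real.log ((1 - t) * p / (q + t * p))) ≤
      shannonEntropy (law L U U' t μ (insert g A)) F := by
  classical
  have h1 := isProbabilityMeasure_law (L := L) (U := U) (U' := U') (A := A) ht0 ht1 μ
  have h2 := isProbabilityMeasure_law (L := L) (U := U) (U' := U') (A := insert g A) ht0 ht1 μ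
  have hins := fun w => law_insert (U := U) (U' := U') ht0 ht1 μ hA hgA (measurableSet_cyl F w)
  have hreal : ∀ w : F → ℕ, ENNReal.ofReal ((law L U U' t μ A).real (cyl F w)) =
      law L U U' t μ A (cyl F w) := fun w => ofReal_measureReal
  have hmass : ∀ V, law L U U' t μ A {x | pat F x ∈ {w : F → ℕ | Matches L V g (glue F w 0)}} =
      ENNReal.ofReal (μ.real {x | Matches L V g x}) := by
    intro V
    rw [ofReal_measureReal, ← law_matches (U := U) (U' := U') ht0 ht1 μ hA hgA V]
    congr 1
    ext x
    exact matches_congr hg (pat_glue _ _)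
  refine ofReal_add_le_tsum_negMulLog_of_transfer
    (m := fun w => (law L U U' t μ A).real (cyl F w))
    (A := {w | Matches L U g (glue F w 0)}) (B := {w | Matches L U' g (glue F w 0)})
    (fun _ => measureReal_nonneg) (fun _ => measureReal_le_one) (fun _ => measureReal_nonneg)
    (fun _ => measureReal_le_one) ?_ (swapPat hne hg) ?_ ht0 ht1 ?_ ?_ ?_ hp
    (hqU ▸ measureReal_nonneg) ?_ ?_ hh
  · exact Set.disjoint_left.2 fun w hw => not_matches_both hne hw
  · exact matches_swapPat_iff hne hg
  · intro w hw
    rw [hins, replAt_preimage_cyl_of_matches hne hg hw]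
    simp
  · intro w hw
    rw [hins, replAt_preimage_cyl_swapPat hne hg hw, measureReal_union _ (measurableSet_cyl _ _)]
    · ring
    · refine Set.disjoint_left.2 fun y hy hy' => ?_
      rw [mem_cyl_iff] at hy hy'
      rw [swapPat_of_matches hne hg hw] at hy'
      exact not_matches_both hne ((matches_congr hg (hy.trans (pat_glue w 0).symm)).2 hw)
        ((matches_congr hg hy').2 (matches_repl_singleton U' _))
  · intro w hw hw'
    rw [hins, replAt_preimage_cyl_of_not hg hw hw']
    ring
  · simp only [hreal]
    rw [tsum_indicator_measure_cyl, hmass U, hpU]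
  · rw [← hqU, ← hmass U', ← tsum_indicator_measure_cyl]
    refine Eq.trans (tsum_congr fun w => ?_) ((swapPat hne hg).tsum_eq _)
    simp only [Set.indicator_apply, Set.mem_ofPred_eq, matches_swapPat_iff hne hg, hreal]

theorem IsShiftInvariant.measure_matches {μ : Measure (Config G)} (hμ : IsShiftInvariant μ)
    (V : Config G) (g : G) : μ {x | Matches L V g x} = μ (cyl L (pat L V)) := by
  conv_rhs => rw [← hμ g, Measure.map_apply (measurable_shift g) (measurableSet_cyl _ _)]
  congr 1
  ext x
  simp only [Set.mem_preimage, mem_cyl_iff, Matches, Set.mem_ofPred_eq]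
  exact ⟨fun h => funext fun l => h l l.2, fun h l hl => congrFun h ⟨l, hl⟩⟩

/-- By invariance and `law_matches`, every added site sees the same `p` and `q`, so the gains add
up. -/
theorem ofReal_add_le_shannonEntropy_law (hne : ∃ l ∈ L, U l ≠ U' l) {t : ℝ} (ht0 : 0 < t)
    (ht1 : t < 1) {μ : Measure (Config G)} [IsProbabilityMeasure μ] (hμ : IsShiftInvariant μ)
    {p q : ℝ} (hp : 0 < p) (hpU : μ.real (cyl L (pat L U)) = p)
    (hqU : μ.real (cyl L (pat L U')) = q) {h : ℝ} (hh : ENNReal.ofReal h ≤ shannonEntropy μ F)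
    (D : Finset G) (hD : IsSep L (D : Set G)) (hDF : ∀ g ∈ D, ∀ l ∈ L, l * g ∈ F) :
    ENNReal.ofReal (h + D.card * (t * p * Real.log ((1 - t) * p / (q + t * p)))) ≤
      shannonEntropy (law L U U' t μ D) F := by
  classical
  induction D using Finset.induction_on with
  | empty => simpa [law_empty ht0 ht1] using hh
  | insert g D hg ih =>
    rw [Finset.coe_insert] at hD ⊢
    have h1 := ih (hD.mono (Set.subset_insert _ _)) fun k hk => hDF k (Finset.mem_insert_of_mem hk)
    have h2 := ofReal_add_le_shannonEntropy_law_insert hne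
      (hDF g (Finset.mem_insert_self _ _)) ht0 ht1 μ hD (by simpa using hg) (q := q) hp
      (by rw [← hpU, measureReal_def, measureReal_def, hμ.measure_matches])
      (by rw [← hqU, measureReal_def, measureReal_def, hμ.measure_matches]) h1
    rw [Finset.card_insert_of_notMem hg]
    push_cast
    convert h2 using 2
    ring

theorem IsShiftInvariant.shannonEntropy_singleton {μ : Measure (Config G)}
    (hμ : IsShiftInvariant μ) (g : G) : shannonEntropy μ {g} = shannonEntropy μ {1} := by
  let e : ({g} : Finset G) ≃ ({1} : Finset G) :=
    (Equiv.ofUnique _ _)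
  unfold shannonEntropy
  rw [← (e.arrowCongr (Equiv.refl ℕ)).tsum_eq]
  refine tsum_congr fun w => ?_
  have : cyl {g} w = shift g ⁻¹' cyl {1} ((e.arrowCongr (Equiv.refl ℕ)) w) := by
    ext x
    simp only [cyl, Set.mem_ofPred_eq, Set.mem_preimage, Equiv.arrowCongr_apply, Equiv.coe_refl,
      Function.comp, id, shift_apply]
    constructor
    · intro h k
      rw [← h, Finset.mem_singleton.1 k.2, Finset.mem_singleton.1 (e.symm k).2, one_mul]
    · intro h k
      have h1 := h ⟨1, Finset.mem_singleton_self 1⟩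
      rw [one_mul] at h1
      rw [Finset.mem_singleton.1 k.2, h1]
      congr 1
      exact Subsingleton.elim _ _
  rw [this, measureReal_def, ← Measure.map_apply (measurable_shift g) (measurableSet_cyl _ _), hμ g]
  rfl

theorem IsShiftInvariant.shannonEntropy_le {μ : Measure (Config G)} [IsProbabilityMeasure μ]
    (hμ : IsShiftInvariant μ) (F : Finset G) :
    shannonEntropy μ F ≤ F.card * shannonEntropy μ {1} := by
  refine (shannonEntropy_le_sum μ F).trans ?_
  simp [hμ.shannonEntropy_singleton]

open Classical in
/-- The entropy gained by all replacements at the sites of `A`, up to boundary terms. -/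
theorem exists_ofReal_le_shannonEntropy_law (hne : ∃ l ∈ L, U l ≠ U' l) {t : ℝ} (ht0 : 0 < t)
    (ht1 : t < 1) {μ : Measure (Config G)} [IsProbabilityMeasure μ] (hμ : IsShiftInvariant μ)
    (hfin : shannonEntropy μ {1} ≠ ∞) {p q : ℝ} (hp : 0 < p)
    (hpU : μ.real (cyl L (pat L U)) = p) (hqU : μ.real (cyl L (pat L U')) = q) :
    ∃ Q : Finset G, ∀ (F : Finset G) (A : Set G), IsSep L A →
      ENNReal.ofReal ((shannonEntropy μ F).toReal +
        ((core L F).filter (· ∈ A)).card * (t * p * Real.log ((1 - t) * p / (q + t * p))) -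
        (F \ core Q F).card * (shannonEntropy μ {1}).toReal) ≤
      shannonEntropy (law L U U' t μ A) F := by
  refine ⟨insert 1 L * L⁻¹, fun F A hA => ?_⟩
  set Q := insert 1 L * L⁻¹
  set D := (core L F).filter (· ∈ A) with hDdef
  have hDA : (D : Set G) ⊆ A := fun g hg => (Finset.mem_filter.1 hg).2
  have hDL : ∀ g ∈ D, ∀ l ∈ L, l * g ∈ F := fun g hg =>
    (mem_core.1 (Finset.mem_filter.1 hg).1).2
  -- `A` may be infinite. In this window only replacements at sites of `D` are visible, and it
  -- contains their translates entirely. It omits at most `|F \ core Q F|` sites of `F`, each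
  -- costing at most the one-site entropy.
  set F₀ := core Q F ∪ L * D with hF₀
  have hF₀F : F₀ ⊆ F := by
    refine Finset.union_subset (core_subset _ _) fun h hh => ?_
    obtain ⟨l, hl, g, hg, rfl⟩ := Finset.mem_mul.1 hh
    exact hDL g hg l hl
  have hP := isProbabilityMeasure_law (L := L) (U := U) (U' := U') (A := A) ht0 ht1 μ
  have hcore : ∀ h ∈ F₀, ∀ l ∈ L, l⁻¹ * h ∈ A → l⁻¹ * h ∈ D := by
    intro h hh l hl hA'
    rcases Finset.mem_union.1 hh with hh | hh
    · refine Finset.mem_filter.2 ⟨mem_core.2 ⟨?_, fun k hk => ?_⟩, hA'⟩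
      · have := (mem_core.1 hh).2 (1 * l⁻¹)
          (Finset.mul_mem_mul (Finset.mem_insert_self _ _) (Finset.inv_mem_inv hl))
        simpa using this
      · have := (mem_core.1 hh).2 (k * l⁻¹)
          (Finset.mul_mem_mul (Finset.mem_insert_of_mem hk) (Finset.inv_mem_inv hl))
        simpa [mul_assoc] using this
    · obtain ⟨k, hk, g, hg, rfl⟩ := Finset.mem_mul.1 hh
      have := hA _ hA' g (hDA hg) l hl k hk (by simp)
      rwa [this]
  have hlaw : shannonEntropy (law L U U' t μ A) F₀ = shannonEntropy (law L U U' t μ D) F₀ := by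
    unfold shannonEntropy
    refine tsum_congr fun w => ?_
    congr 2
    rw [measureReal_def, measureReal_def, law, law,
      Measure.map_apply (measurable_resample L U U' _) (measurableSet_cyl _ _),
      Measure.map_apply (measurable_resample L U U' _) (measurableSet_cyl _ _)]
    congr 2
    ext z
    refine forall_congr' fun h => ?_
    have : resample L U U' A z h = resample L U U' D z h :=
      repl_congr fun l hl => ⟨fun h1 => ⟨hcore h h.2 l hl h1.1, h1.2⟩, fun h1 => ⟨hDA h1.1, h1.2⟩⟩
    rw [this]
  have hfinF : ∀ S : Finset G, shannonEntropy μ S ≠ ∞ := fun S =>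
    ne_top_of_le_ne_top (ENNReal.mul_ne_top (ENNReal.natCast_ne_top _) hfin)
      (hμ.shannonEntropy_le S)
  have hsub : (shannonEntropy μ F).toReal - (F \ core Q F).card * (shannonEntropy μ {1}).toReal ≤
      (shannonEntropy μ F₀).toReal := by
    have h1 : shannonEntropy μ F ≤
        shannonEntropy μ F₀ + (F \ core Q F).card * shannonEntropy μ {1} := by
      calc shannonEntropy μ F = shannonEntropy μ (F₀ ∪ F \ F₀) := by
            rw [Finset.union_sdiff_of_subset hF₀F]
        _ ≤ shannonEntropy μ F₀ + shannonEntropy μ (F \ F₀) := shannonEntropy_union_le μ _ _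
        _ ≤ _ := by
            gcongr
            refine (hμ.shannonEntropy_le _).trans ?_
            gcongr
            exact Finset.subset_union_left
    have h2 := ENNReal.toReal_mono (ENNReal.add_ne_top.2 ⟨hfinF _, ENNReal.mul_ne_top
      (ENNReal.natCast_ne_top _) hfin⟩) h1
    rw [ENNReal.toReal_add (hfinF _) (ENNReal.mul_ne_top (ENNReal.natCast_ne_top _) hfin),
      ENNReal.toReal_mul, ENNReal.toReal_natCast] at h2
    linarith
  have h3 := ofReal_add_le_shannonEntropy_law (F := F₀) hne ht0 ht1 hμ hp hpU hqU
    (ENNReal.ofReal_toReal (hfinF F₀)).le D (hA.mono hDA) fun g hg l hl =>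
      Finset.mem_union_right _ (Finset.mul_mem_mul hl hg)
  refine le_trans (ENNReal.ofReal_le_ofReal ?_)
    (h3.trans (hlaw.symm.le.trans (shannonEntropy_mono _ hF₀F)))
  linarith

end Gain

end GibbsShift

namespace GibbsShift

variable {G : Type*} [Group G] {L F : Finset G} {U U' : Config G} {g : G}

/-! ### A stationary random separated set of positive density. -/

section Active

open Classical in
/-- The active sites: those labelled `1` all of whose neighbours are labelled `0`. -/
def active (L : Finset G) (a : Config G) : Set G :=
  {g | a g = 1 ∧ ∀ s ∈ (L⁻¹ * L).erase 1, a (s * g) = 0}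

/-- If `L g` and `L g'` meet, then `g' ∈ L⁻¹ L g`, where an active `g` forces the label `0` unless
`g' = g`. -/
theorem isSep_active (L : Finset G) (a : Config G) : IsSep L (active L a) := by
  classical
  intro g hg g' hg' l hl l' hl' h
  by_contra hne
  have h1 : g' = l'⁻¹ * l * g := by rw [mul_assoc, h, inv_mul_cancel_left]
  have h2 : l'⁻¹ * l ≠ 1 := fun h3 => hne (by rw [h1, h3, one_mul])
  have h3 := hg.2 (l'⁻¹ * l) (Finset.mem_erase.2 ⟨h2, Finset.mul_mem_mul (Finset.inv_mem_inv hl')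
    hl⟩)
  rw [← h1, hg'.1] at h3
  exact one_ne_zero h3

theorem mem_active_shift_iff (s : G) (a : Config G) :
    g ∈ active L (shift s a) ↔ g * s ∈ active L a := by
  simp [active, mul_assoc]

theorem measurableSet_mem_active (L : Finset G) (g : G) :
    MeasurableSet {a : Config G | g ∈ active L a} := by
  classical
  have : {a : Config G | g ∈ active L a} = (fun a : Config G => a g) ⁻¹' {1} ∩
      ⋂ s ∈ (L⁻¹ * L).erase 1, (fun a : Config G => a (s * g)) ⁻¹' {0} := by
    ext a; simp [active]
  rw [this]
  exact (measurable_pi_apply g (measurableSet_singleton 1)).inter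
    (Finset.measurableSet_biInter _ fun s _ => measurable_pi_apply _ (measurableSet_singleton 0))

theorem labels_mem_active {t : ℝ} (ht0 : 0 < t) (ht1 : t < 1) (L : Finset G) (g : G) :
    labels G t {a | g ∈ active L a} = labels G t {a | 1 ∈ active L a} := by
  conv_rhs => rw [← map_shift_labels ht0 ht1 g, Measure.map_apply (measurable_shift g)
    (measurableSet_mem_active L 1)]
  congr 1
  ext a
  simp [mem_active_shift_iff]

theorem labels_one_mem_active_pos {t : ℝ} (ht0 : 0 < t) (ht1 : t < 1) (L : Finset G) :
    0 < labels G t {a | 1 ∈ active L a} := by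
  classical
  have := isProbabilityMeasure_coin ht0 ht1
  have h1 : Set.pi (insert 1 ((L⁻¹ * L).erase 1) : Finset G)
      (fun i : G => if i = 1 then ({1} : Set ℕ) else {0}) ⊆ {a | 1 ∈ active L a} := by
    intro a ha
    refine ⟨by simpa using ha 1 (by simp), fun s hs => ?_⟩
    have := ha s (Finset.mem_coe.2 (Finset.mem_insert_of_mem hs))
    simpa [Finset.ne_of_mem_erase hs] using this
  refine lt_of_lt_of_le ?_ (measure_mono h1)
  rw [labels, Measure.infinitePi_pi _ fun i _ => (Set.to_countable _).measurableSet]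
  refine CanonicallyOrderedAdd.prod_pos.2 fun i _ => ?_
  split_ifs
  · simp [coin_apply, ht0]
  · simp [coin_apply, ht1]

end Active

/-! ### The competitor: replacements at random active sites. -/

section Mixture

theorem ofReal_integral_le_lintegral_ofReal {Z : Type*} [MeasurableSpace Z] {P : Measure Z}
    {f : Z → ℝ} (hf : Integrable f P) :
    ENNReal.ofReal (∫ z, f z ∂P) ≤ ∫⁻ z, ENNReal.ofReal (f z) ∂P := by
  have h1 := ofReal_integral_eq_lintegral_ofReal hf.pos_part (ae_of_all _ fun z => le_max_right _ _)
  have h2 : ∀ z, ENNReal.ofReal (max (f z) 0) = ENNReal.ofReal (f z) := fun z => by simp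
  simp only [h2] at h1
  rw [← h1]
  exact ENNReal.ofReal_le_ofReal (integral_mono hf hf.pos_part fun z => le_max_left _ _)

variable (L U U') in
/-- The random replacement at the active sites. -/
noncomputable def resampleActive (z : Config G × Config G × Config G) : Config G :=
  resample L U U' (active L z.1) z.2

variable {t : ℝ} {μ : Measure (Config G)}

theorem measurableSet_mem_trigger_active (L : Finset G) (U : Config G) (g : G) :
    MeasurableSet {z : Config G × Config G × Config G |
      g ∈ trigger L U (active L z.1) z.2.1 z.2.2} :=
  measurableSet_mem_trigger L U (A := fun z : Config G × Config G × Config G => active L z.1)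
    (fun g => measurable_fst (measurableSet_mem_active L g)) (by fun_prop) (by fun_prop) g

theorem measurable_resampleActive (L : Finset G) (U U' : Config G) :
    Measurable (resampleActive L U U') :=
  measurable_repl L U' (measurableSet_mem_trigger_active L U) (by fun_prop)

variable (L U U' t μ) in
/-- The invariant law of the random replacement at the active sites. -/
noncomputable def mixture : Measure (Config G) := (joint t μ).map (resampleActive L U U')

theorem isProbabilityMeasure_mixture [IsProbabilityMeasure μ] (ht0 : 0 < t) (ht1 : t < 1) :
    IsProbabilityMeasure (mixture L U U' t μ) := by
  have := isProbabilityMeasure_joint (μ := μ) ht0 ht1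
  exact Measure.isProbabilityMeasure_map (measurable_resampleActive L U U').aemeasurable

/-- The joint law is invariant under the diagonal action, and choosing and rewriting the sites are
equivariant operations. -/
theorem isShiftInvariant_mixture [IsProbabilityMeasure μ] (ht0 : 0 < t) (ht1 : t < 1)
    (hμ : IsShiftInvariant μ) :
    IsShiftInvariant (mixture L U U' t μ) := by
  intro s
  have := isProbabilityMeasure_labels_half (G := G)
  have := isProbabilityMeasure_labels (G := G) ht0 ht1
  have hs := measurable_shift s
  have h1 : (joint t μ).map (Prod.map (shift s) (Prod.map (shift s) (shift s))) = joint t μ := by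
    rw [joint, ← Measure.map_prod_map _ _ hs (hs.prodMap hs), ← Measure.map_prod_map _ _ hs hs,
      map_shift_labels (by norm_num) (by norm_num), map_shift_labels ht0 ht1, hμ s]
  have h2 : shift s ∘ resampleActive L U U' =
      resampleActive L U U' ∘ Prod.map (shift s) (Prod.map (shift s) (shift s)) := by
    ext1 z
    simp only [Function.comp, resampleActive, resample, shift_repl, Prod.map_fst, Prod.map_snd]
    congr 1
    ext g
    simp only [trigger, Set.mem_ofPred_eq, mem_active_shift_iff, matches_shift, shift_apply]
  rw [mixture, Measure.map_map hs (measurable_resampleActive L U U'), h2, ← Measure.map_map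
    (measurable_resampleActive L U U') (hs.prodMap (hs.prodMap hs)), h1]

/-- Average the gain for fixed sites over the labels. Concavity of entropy passes the bound to the
mixture, and the mean number of active sites in the core is its size times the density. -/
theorem exists_ofReal_le_shannonEntropy_mixture [IsProbabilityMeasure μ] (ht0 : 0 < t) (ht1 : t < 1)
    (hne : ∃ l ∈ L, U l ≠ U' l)    (hμ : IsShiftInvariant μ) (hfin : shannonEntropy μ {1} ≠ ∞) {p q : ℝ} (hp : 0 < p)
    (hpU : μ.real (cyl L (pat L U)) = p) (hqU : μ.real (cyl L (pat L U')) = q) :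
    ∃ Q : Finset G, ∀ F : Finset G,
      ENNReal.ofReal ((shannonEntropy μ F).toReal + (core L F).card *
        ((labels G (1 / 2)).real {a | 1 ∈ active L a} *
          (t * p * Real.log ((1 - t) * p / (q + t * p)))) -
        (F.card - (core Q F).card) * (shannonEntropy μ {1}).toReal) ≤
      shannonEntropy (mixture L U U' t μ) F := by
  classical
  obtain ⟨Q, hQ⟩ := exists_ofReal_le_shannonEntropy_law (U := U) (U' := U') hne ht0 ht1 hμ hfin hp
    hpU hqU
  refine ⟨Q, fun F => ?_⟩
  have := isProbabilityMeasure_labels_half (G := G)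
  have := isProbabilityMeasure_labels (G := G) ht0 ht1
  have := isProbabilityMeasure_mixture (L := L) (U := U) (U' := U') (μ := μ) ht0 ht1
  have h0 := fun a => isProbabilityMeasure_law (L := L) (U := U) (U' := U') (A := active L a)
    ht0 ht1 μ
  have hlaw : ∀ a, ∀ w, law L U U' t μ (active L a) (cyl F w) =
      (μ.prod (labels G t)) (Prod.mk a ⁻¹' (resampleActive L U U' ⁻¹' cyl F w)) := fun a w => by
    rw [law, Measure.map_apply (measurable_resample L U U' _) (measurableSet_cyl F w)]
    rfl
  have hmeas := fun w => measurable_resampleActive L U U' (measurableSet_cyl F w)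
  have h1 := lintegral_shannonEntropy_le (mixture L U U' t μ) (labels G (1 / 2))
    (fun a => law L U U' t μ (active L a)) F
    (fun w => by simp only [hlaw]; exact measurable_measure_prodMk_left (hmeas w))
    (fun w => by
      simp only [hlaw]
      rw [mixture, Measure.map_apply (measurable_resampleActive L U U') (measurableSet_cyl F w),
        joint, Measure.prod_apply (hmeas w)])
  refine le_trans ?_ ((lintegral_mono fun a => hQ F (active L a) (isSep_active L a)).trans h1)
  obtain ⟨hi, hint⟩ := integral_card_filter (labels G (1 / 2)) (measurableSet_mem_active L)
    (r := (labels G (1 / 2)).real {a | 1 ∈ active L a})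
    (fun g => congrArg ENNReal.toReal (labels_mem_active (by norm_num) (by norm_num) L g))
    (core L F)
  set κ := t * p * Real.log ((1 - t) * p / (q + t * p))
  have hcard : ((F \ core Q F).card : ℝ) = F.card - (core Q F).card := by
    rw [Finset.card_sdiff_of_subset (core_subset Q F), Nat.cast_sub
      (Finset.card_le_card (core_subset Q F))]
  have hi1 := (integrable_const (μ := labels G (1 / 2)) (shannonEntropy μ F).toReal).add
    (hi.mul_const κ)
  have hi2 := integrable_const (μ := labels G (1 / 2))
    (((F \ core Q F).card : ℝ) * (shannonEntropy μ {1}).toReal)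
  refine le_trans (ENNReal.ofReal_le_ofReal (le_of_eq ?_))
    (ofReal_integral_le_lintegral_ofReal (hi1.sub hi2))
  refine Eq.trans ?_ (integral_sub' hi1 hi2).symm
  rw [integral_add' (integrable_const _) (hi.mul_const κ), integral_mul_const, hint, hcard]
  simp only [integral_const, probReal_univ, one_smul]
  ring

theorem joint_mem_trigger [IsProbabilityMeasure μ] (ht0 : 0 < t) (ht1 : t < 1)
    (hμ : IsShiftInvariant μ) {p : ℝ} (hpU : μ.real (cyl L (pat L U)) = p) (g : G) :
    (joint t μ).real {z | g ∈ trigger L U (active L z.1) z.2.1 z.2.2} =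
      (labels G (1 / 2)).real {a | 1 ∈ active L a} * (p * t) := by
  have := isProbabilityMeasure_labels_half (G := G)
  have := isProbabilityMeasure_labels (G := G) ht0 ht1
  have h1 : {z : Config G × Config G × Config G |
      g ∈ trigger L U (active L z.1) z.2.1 z.2.2} =
      {a | g ∈ active L a} ×ˢ ({x | Matches L U g x} ×ˢ {b | b g = 1}) := by
    ext z
    simp only [trigger, Set.mem_ofPred_eq, Set.mem_prod]
    tauto
  rw [h1, measureReal_def, joint, Measure.prod_prod, Measure.prod_prod, hμ.measure_matches,
    labels_eq_one ht0 ht1, labels_mem_active (by norm_num) (by norm_num), ENNReal.toReal_mul,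
    ENNReal.toReal_mul, ENNReal.toReal_ofReal ht0.le, ← hpU]
  rfl

theorem integral_energy {φ : Config G → ℝ} {ν : Measure (Config G)} (hν : IsShiftInvariant ν)
    (hφ : Integrable φ ν) (F : Finset G) :
    Integrable (energy φ F) ν ∧ ∫ x, energy φ F x ∂ν = F.card * ∫ x, φ x ∂ν := by
  have h1 : ∀ g ∈ F, Integrable (fun x => φ (shift g x)) ν := fun g _ =>
    Integrable.comp_measurable (by rwa [hν g]) (measurable_shift g)
  have h2 : ∀ g ∈ F, ∫ x, φ (shift g x) ∂ν = ∫ x, φ x ∂ν := fun g _ => by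
    conv_rhs => rw [← hν g]
    rw [integral_map (measurable_shift g).aemeasurable (by rw [hν g]; exact hφ.1)]
  refine ⟨integrable_finsetSum F h1, ?_⟩
  unfold energy
  rw [integral_finsetSum F h1, Finset.sum_congr rfl h2]
  simp

variable [Countable G] {φ : Config G → ℝ}

theorem IsRegular.integrable_mixture [IsProbabilityMeasure μ] (ht0 : 0 < t) (ht1 : t < 1)
    (hφ : IsRegular φ) (hint : Integrable φ μ) : Integrable φ (mixture L U U' t μ) := by
  have := isProbabilityMeasure_joint (μ := μ) ht0 ht1
  obtain ⟨C, -, hC⟩ := hφ.exists_abs_sub_repl_le L U U'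
  have hm := measurable_resampleActive L U U'
  rw [mixture, integrable_map_measure hφ.measurable.aestronglyMeasurable hm.aemeasurable]
  have h1 := (integrable_comp_joint ht0 ht1 hint).1
  refine (h1.norm.add (integrable_const C)).mono'
    (hφ.measurable.comp hm).aestronglyMeasurable (ae_of_all _ fun z => ?_)
  have h2 := hC (trigger L U (active L z.1) z.2.1 z.2.2) z.2.1 1
    ((isSep_active L z.1).mono (trigger_subset _ _)) fun g hg => hg.2.2
  rw [shift_one, shift_one] at h2
  change |φ (repl L U' (trigger L U (active L z.1) z.2.1 z.2.2) z.2.1)| ≤ |φ z.2.1| + C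
  have h3 := abs_sub_abs_le_abs_sub
    (φ (repl L U' (trigger L U (active L z.1) z.2.1 z.2.2) z.2.1)) (φ z.2.1)
  linarith

/-- Integrate the pathwise energy bound. By independence, a site is replaced with probability
density times `p t`. -/
theorem IsRegular.exists_le_integral_mixture [IsProbabilityMeasure μ] (ht0 : 0 < t) (ht1 : t < 1)
    (hφ : IsRegular φ) (hμ : IsShiftInvariant μ) (hint : Integrable φ μ) {p : ℝ}
    (hpU : μ.real (cyl L (pat L U)) = p) {c : ℝ}
    (hc : ∀ x, c ≤ energyDiff φ (glue L (pat L U) x) (glue L (pat L U') x)) {ε : ℝ} (hε : 0 < ε) :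
    ∃ (T Q : Finset G) (C : ℝ), ∀ F : Finset G,
      F.card * ∫ x, φ x ∂μ + (core T F).card *
        ((labels G (1 / 2)).real {a | 1 ∈ active L a} * (p * t) * (c - ε)) - ε * F.card
        - (F.card - (core Q F).card) * C ≤ F.card * ∫ x, φ x ∂(mixture L U U' t μ) := by
  classical
  have := isProbabilityMeasure_joint (μ := μ) ht0 ht1
  obtain ⟨T, Q, C, -, hC⟩ := hφ.exists_le_energy_repl_set hc hε
  refine ⟨T, Q, C, fun F => ?_⟩
  have hm := measurable_resampleActive L U U'
  have hν := integral_energy (isShiftInvariant_mixture (L := L) (U := U) (U' := U') ht0 ht1 hμ)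
    (hφ.integrable_mixture ht0 ht1 hint) F
  obtain ⟨hi, hcard⟩ := integral_card_filter (joint t μ) (measurableSet_mem_trigger_active L U)
    (joint_mem_trigger ht0 ht1 hμ hpU) (core T F)
  obtain ⟨he, he'⟩ := integral_energy hμ hint F
  obtain ⟨hj, hj'⟩ := integrable_comp_joint ht0 ht1 he
  have hk : Integrable (fun _ => ε * F.card + C * (F \ core Q F).card : _ → ℝ) (joint t μ) :=
    integrable_const _
  have hcardQ : ((F \ core Q F).card : ℝ) = F.card - (core Q F).card := by
    rw [Finset.card_sdiff_of_subset (core_subset Q F), Nat.cast_sub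
      (Finset.card_le_card (core_subset Q F))]
  rw [← hν.2, mixture, integral_map hm.aemeasurable hν.1.1]
  refine le_trans (le_of_eq ?_) (integral_mono ((hj.add (hi.mul_const (c - ε))).sub hk)
    (hν.1.comp_measurable hm) fun z => ?_)
  · rw [integral_sub' (hj.add (hi.mul_const (c - ε))) hk, integral_add' hj (hi.mul_const (c - ε)),
      integral_mul_const, hcard, hj', he', hcardQ]
    simp only [integral_const, probReal_univ, one_smul]
    ring
  · have := hC F (trigger L U (active L z.1) z.2.1 z.2.2) z.2.1
      ((isSep_active L z.1).mono (trigger_subset _ _)) fun g hg => hg.2.2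
    simp only [Pi.add_apply, Pi.sub_apply]
    rw [← sub_sub]
    exact this

end Mixture

end GibbsShift

namespace GibbsShift

variable {G : Type*} [Group G] {L : Finset G} {U U' : Config G}

/-! ### Passage to densities and the variational comparison. -/

section Variational

theorem IsAmenable.neBot (hG : IsAmenable G) : (moreInvariant G).NeBot := by
  refine ⟨fun h => ?_⟩
  have h1 : (∅ : Set (Finset G)) ∈ moreInvariant G := by rw [h]; exact mem_bot
  obtain ⟨K, hK, δ, hδ, h2⟩ := h1
  obtain ⟨F, hF⟩ := hG K hK δ hδ
  exact h2 F hF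

/-- Boundary terms are `o(|F|)`. The absolute values of `A` and `B` in the tolerance allow either
sign. -/
theorem eventually_le_core_mul (Q T : Finset G) (A B : ℝ) {η : ℝ} (hη : 0 < η) :
    ∀ᶠ F in moreInvariant G, 0 < F.card ∧
      F.card * (A - η) ≤ (core T F).card * A - (F.card - (core Q F).card) * B := by
  classical
  have h0 : 0 < η / (|A| + |B| + 1) := by positivity
  have hcard : ∀ Q F : Finset G, ((F \ core Q F).card : ℝ) = F.card - (core Q F).card :=
    fun Q F => by
      rw [Finset.card_sdiff_of_subset (core_subset Q F), Nat.cast_sub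
        (Finset.card_le_card (core_subset Q F))]
  filter_upwards [eventually_card_sdiff_core_le Q h0, eventually_card_sdiff_core_le T h0]
    with F hQ hT
  refine ⟨hQ.1, ?_⟩
  have h1 := hQ.2
  have h2 := hT.2
  rw [hcard] at h1 h2
  have h3 : (core Q F).card ≤ F.card := Finset.card_le_card (core_subset Q F)
  have h4 : (core T F).card ≤ F.card := Finset.card_le_card (core_subset T F)
  have h3' : (0 : ℝ) ≤ F.card - (core Q F).card := sub_nonneg.2 (by exact_mod_cast h3)
  have h4' : (0 : ℝ) ≤ F.card - (core T F).card := sub_nonneg.2 (by exact_mod_cast h4)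
  have h5 : (F.card - (core T F).card : ℝ) * A ≤ η / (|A| + |B| + 1) * F.card * |A| :=
    (mul_le_mul_of_nonneg_left (le_abs_self A) h4').trans
      (mul_le_mul_of_nonneg_right h2 (abs_nonneg A))
  have h6 : (F.card - (core Q F).card : ℝ) * B ≤ η / (|A| + |B| + 1) * F.card * |B| :=
    (mul_le_mul_of_nonneg_left (le_abs_self B) h3').trans
      (mul_le_mul_of_nonneg_right h1 (abs_nonneg B))
  have h7 : η / (|A| + |B| + 1) * F.card * (|A| + |B| + 1) = η * F.card := by
    field_simp
  have h8 : 0 ≤ η / (|A| + |B| + 1) * F.card := by positivity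
  nlinarith

variable {t : ℝ} {μ : Measure (Config G)}

theorem IsShiftInvariant.entropy_le [IsProbabilityMeasure μ] (hμ : IsShiftInvariant μ) :
    entropy μ ≤ shannonEntropy μ {1} := by
  refine limsup_le_of_le (h := Eventually.of_forall fun F => ?_)
  refine ENNReal.div_le_of_le_mul ?_
  rw [mul_comm]
  exact hμ.shannonEntropy_le F

theorem ofReal_le_entropy_mixture [IsProbabilityMeasure μ] (hG : IsAmenable G) (ht0 : 0 < t)
    (ht1 : t < 1)
    (hne : ∃ l ∈ L, U l ≠ U' l) (hμ : IsShiftInvariant μ) (hfin : shannonEntropy μ {1} ≠ ∞)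
    {p q : ℝ} (hp : 0 < p) (hpU : μ.real (cyl L (pat L U)) = p)
    (hqU : μ.real (cyl L (pat L U')) = q) :
    ENNReal.ofReal ((entropy μ).toReal + (labels G (1 / 2)).real {a | 1 ∈ active L a} *
      (t * p * Real.log ((1 - t) * p / (q + t * p)))) ≤ entropy (mixture L U U' t μ) := by
  have := hG.neBot
  obtain ⟨Q, hQ⟩ := exists_ofReal_le_shannonEntropy_mixture (U := U) (U' := U') ht0 ht1 hne hμ hfin
    hp hpU hqU
  set A := (labels G (1 / 2)).real {a | 1 ∈ active L a} *
    (t * p * Real.log ((1 - t) * p / (q + t * p)))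
  have hent : entropy μ ≠ ∞ := ne_top_of_le_ne_top hfin hμ.entropy_le
  have key : ∀ η : ℝ, 0 < η → ENNReal.ofReal ((entropy μ).toReal + A - 2 * η) ≤
      entropy (mixture L U U' t μ) := by
    intro η hη
    -- `entropy` is an upper limit, so near-optimal windows for `μ` occur frequently. The error
    -- bounds hold eventually, and together they bound the upper limit for the mixture without any
    -- convergence.
    have h1 : ∃ᶠ F in moreInvariant G,
        (entropy μ).toReal - η ≤ (shannonEntropy μ F / (F.card : ℝ≥0∞)).toReal := by
      rcases lt_or_ge ((entropy μ).toReal - η) 0 with h | h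
      · exact (Eventually.of_forall fun F => h.le.trans ENNReal.toReal_nonneg).frequently
      · have h2 : ENNReal.ofReal ((entropy μ).toReal - η) < entropy μ := by
          rw [ENNReal.ofReal_lt_iff_lt_toReal h hent]
          linarith
        refine (frequently_lt_of_lt_limsup (by isBoundedDefault) h2).mono fun F hF => ?_
        refine (ENNReal.ofReal_le_iff_le_toReal ?_).1 hF.le
        refine ne_top_of_le_ne_top hfin (ENNReal.div_le_of_le_mul ?_)
        rw [mul_comm]
        exact hμ.shannonEntropy_le F
    refine le_limsup_of_frequently_le' ?_
    refine (h1.and_eventually (eventually_le_core_mul Q L A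
      (shannonEntropy μ {1}).toReal hη)).mono fun F hF => ?_
    obtain ⟨hF1, hF0, hF2⟩ := hF
    have hF0' : (0 : ℝ) < F.card := by exact_mod_cast hF0
    rw [ENNReal.le_div_iff_mul_le (Or.inl (by exact_mod_cast hF0.ne'))
      (Or.inl (ENNReal.natCast_ne_top _)), ← ENNReal.ofReal_natCast, ← ENNReal.ofReal_mul'
      hF0'.le]
    refine (ENNReal.ofReal_le_ofReal ?_).trans (hQ F)
    rw [ENNReal.toReal_div, ENNReal.toReal_natCast, le_div_iff₀ hF0'] at hF1
    linarith
  refine le_of_tendsto (f := fun η : ℝ => ENNReal.ofReal ((entropy μ).toReal + A - 2 * η))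
    (x := 𝓝[>] 0) ?_ (eventually_mem_nhdsWithin.mono fun η hη => key η hη)
  have h3 : Continuous fun η : ℝ => ENNReal.ofReal ((entropy μ).toReal + A - 2 * η) :=
    ENNReal.continuous_ofReal.comp (by fun_prop)
  have h4 := (h3.tendsto 0).mono_left (nhdsWithin_le_nhds (s := Set.Ioi 0))
  simpa using h4

variable [Countable G] {φ : Config G → ℝ}

theorem IsRegular.le_integral_mixture [IsProbabilityMeasure μ] (hG : IsAmenable G) (ht0 : 0 < t)
    (ht1 : t < 1)
    (hφ : IsRegular φ) (hμ : IsShiftInvariant μ) (hint : Integrable φ μ) {p : ℝ}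
    (hpU : μ.real (cyl L (pat L U)) = p) {c : ℝ}
    (hc : ∀ x, c ≤ energyDiff φ (glue L (pat L U) x) (glue L (pat L U') x)) :
    ∫ x, φ x ∂μ + (labels G (1 / 2)).real {a | 1 ∈ active L a} * (p * t) * c ≤
      ∫ x, φ x ∂(mixture L U U' t μ) := by
  have := hG.neBot
  set ρ := (labels G (1 / 2)).real {a | 1 ∈ active L a} * (p * t)
  have key : ∀ ε : ℝ, 0 < ε → ∫ x, φ x ∂μ + ρ * (c - ε) - 2 * ε ≤
      ∫ x, φ x ∂(mixture L U U' t μ) := by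
    intro ε hε
    obtain ⟨T, Q, C, hC⟩ := hφ.exists_le_integral_mixture (U := U) (U' := U') ht0 ht1 hμ hint hpU
      hc hε
    obtain ⟨F, hF0, hF⟩ := (eventually_le_core_mul Q T (ρ * (c - ε)) C hε).exists
    have hF0' : (0 : ℝ) < F.card := by exact_mod_cast hF0
    refine le_of_mul_le_mul_left ?_ hF0'
    linarith [hC F]
  refine le_of_tendsto (f := fun ε : ℝ => ∫ x, φ x ∂μ + ρ * (c - ε) - 2 * ε)
    (x := 𝓝[>] 0) ?_ (eventually_mem_nhdsWithin.mono fun η hη => key η hη)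
  have h3 : Continuous fun ε : ℝ => ∫ x, φ x ∂μ + ρ * (c - ε) - 2 * ε := by fun_prop
  have h4 := (h3.tendsto 0).mono_left (nhdsWithin_le_nhds (s := Set.Ioi 0))
  simpa using h4

/-- For an equilibrium measure, replacing one pattern by another cannot increase the free energy. -/
theorem IsEquilibrium.exp_mul_le (hG : IsAmenable G) (hφ : IsRegular φ) (hexp : ExpSummable φ)
    (hμ : IsEquilibrium φ μ) {c : ℝ}
    (hc : ∀ x, c ≤ energyDiff φ (glue L (pat L U) x) (glue L (pat L U') x)) :
    Real.exp c * μ.real (cyl L (pat L U)) ≤ μ.real (cyl L (pat L U')) := by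
  have hP := hμ.admissible.isProbabilityMeasure
  have hinv := hμ.admissible.invariant
  have hint := hμ.admissible.integrable
  set p := μ.real (cyl L (pat L U)) with hpU
  set q := μ.real (cyl L (pat L U')) with hqU
  have hq0 : 0 ≤ q := measureReal_nonneg
  by_contra! hlt
  have hp : 0 < p := by
    by_contra! h
    exact absurd (mul_nonpos_of_nonneg_of_nonpos (Real.exp_pos c).le h) (by linarith)
  -- If the patterns coincided on `L`, then `c ≤ 0` and `p = q`, and there would be nothing to
  -- contradict.
  have hne : ∃ l ∈ L, U l ≠ U' l := by
    by_contra! h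
    have h1 : pat L U = pat L U' := funext fun l => h l l.2
    have h2 := hc 0
    rw [h1, energyDiff_self] at h2
    have h3 : q = p := by rw [hpU, hqU, h1]
    rw [h3] at hlt
    have h4 : Real.exp c * p ≤ 1 * p := mul_le_mul_of_nonneg_right (Real.exp_le_one_iff.2 h2) hp.le
    linarith
  have hB : 0 < Real.exp c * p + p := by positivity
  obtain ⟨t, ht0, ht1, ht⟩ : ∃ t : ℝ, 0 < t ∧ t < 1 ∧
      q + t * p < (1 - t) * p * Real.exp c := by
    -- The requirement reads `t (e^c p + p) < e^c p - q`; this is half of the critical value.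
    refine ⟨(Real.exp c * p - q) / (2 * (Real.exp c * p + p)), by
      have := sub_pos.2 hlt; positivity, ?_, ?_⟩
    · rw [div_lt_one (by positivity)]
      linarith
    · have h1 : (Real.exp c * p - q) / (2 * (Real.exp c * p + p)) * (Real.exp c * p + p) =
          (Real.exp c * p - q) / 2 := by field_simp
      nlinarith
  have hden : 0 < q + t * p := by positivity
  have hgain : 0 < Real.log ((1 - t) * p / (q + t * p)) + c := by
    have ht' : 0 < 1 - t := sub_pos.2 ht1
    have h1 : Real.log (q + t * p) < Real.log ((1 - t) * p * Real.exp c) := Real.log_lt_log hden ht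
    rw [Real.log_mul (by positivity) (Real.exp_pos c).ne', Real.log_exp] at h1
    rw [Real.log_div (by positivity) hden.ne']
    linarith
  have hfin := hexp.shannonEntropy_one_ne_top μ hint
  have hent : entropy μ ≠ ∞ := ne_top_of_le_ne_top hfin hinv.entropy_le
  have h1 := ofReal_le_entropy_mixture hG ht0 ht1 hne hinv hfin hp hpU.symm hqU.symm
  have h2 := hφ.le_integral_mixture (U := U) (U' := U') hG ht0 ht1 hinv hint hpU.symm hc
  set ρ := (labels G (1 / 2)).real {a | 1 ∈ active L a}
  have hρ : 0 < ρ := ENNReal.toReal_pos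
    (labels_one_mem_active_pos (by norm_num) (by norm_num) L).ne'
    (ne_top_of_le_ne_top ENNReal.one_ne_top (by
      have := isProbabilityMeasure_labels_half (G := G)
      exact prob_le_one))
  set ν := mixture L U U' t μ
  have hν : IsAdmissible φ ν := ⟨isProbabilityMeasure_mixture ht0 ht1,
    isShiftInvariant_mixture ht0 ht1 hinv, hφ.integrable_mixture ht0 ht1 hint⟩
  have h3 : (entropy ν : EReal) + ((∫ x, φ x ∂ν : ℝ) : EReal) ≤
      (entropy μ : EReal) + ((∫ x, φ x ∂μ : ℝ) : EReal) := by
    rw [hμ.maximizes]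
    exact le_iSup₂_of_le ν hν le_rfl
  set κ := ρ * (t * p * Real.log ((1 - t) * p / (q + t * p)))
  have h4 : (((entropy μ).toReal + κ : ℝ) : EReal) ≤ (entropy ν : EReal) := by
    refine le_trans ?_ (EReal.coe_ennreal_le_coe_ennreal_iff.2 h1)
    rw [EReal.coe_ennreal_ofReal]
    exact EReal.coe_le_coe_iff.2 (le_max_left _ _)
  have h5 := (add_le_add_left h4 ((∫ x, φ x ∂ν : ℝ) : EReal)).trans h3
  rw [← ENNReal.ofReal_toReal hent, EReal.coe_ennreal_ofReal, max_eq_left ENNReal.toReal_nonneg,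
    ← EReal.coe_add, ← EReal.coe_add, EReal.coe_le_coe_iff,
    ENNReal.toReal_ofReal ENNReal.toReal_nonneg] at h5
  -- A lower bound for the excess of `entropy + ∫ φ` of the competitor over that of `μ`; its
  -- positivity contradicts `h5`.
  have h6 : 0 < ρ * (p * t) * (Real.log ((1 - t) * p / (q + t * p)) + c) := by positivity
  have h7 : κ = ρ * (p * t) * Real.log ((1 - t) * p / (q + t * p)) := by ring
  linarith

end Variational

end GibbsShift

namespace GibbsShift

variable {G : Type*} [Group G] {φ : Config G → ℝ}

/-! ### Local energies and Boltzmann weights. -/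

section Local

/-- The energy of the pattern `w` on `K` relative to the zero pattern, given the outside
configuration. -/
noncomputable def localEnergy (φ : Config G → ℝ) (K : Finset G) (w : K → ℕ) (x : Config G) : ℝ :=
  energyDiff φ (glue K 0 x) (glue K w x)

theorem localEnergy_glue (K : Finset G) (w v : K → ℕ) (x : Config G) :
    localEnergy φ K w (glue K v x) = localEnergy φ K w x := by
  simp only [localEnergy, glue_glue]

theorem localEnergy_zero (K : Finset G) (x : Config G) : localEnergy φ K 0 x = 0 :=
  energyDiff_self _

theorem IsRegular.energyDiff_glue (hφ : IsRegular φ) (K : Finset G) (w v : K → ℕ) (x : Config G) :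
    energyDiff φ (glue K w x) (glue K v x) = localEnergy φ K v x - localEnergy φ K w x := by
  have := hφ.energyDiff_add (glue_eq_glue_of_notMem 0 w x) (glue_eq_glue_of_notMem w v x)
  simp only [localEnergy]
  linarith

theorem energy_sub_energy (F : Finset G) (x y : Config G) :
    energy φ F y - energy φ F x = ∑ g ∈ F, (φ (shift g y) - φ (shift g x)) := by
  rw [energy, energy, Finset.sum_sub_distrib]

/-- The sums over `E m` are partial sums of an unconditionally convergent series. This yields the
measurability of local energies and, later, the limit of the Gibbs ratios. -/
theorem IsExhausting.tendsto_localEnergy {E : ℕ → Finset G} (hE : IsExhausting E)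
    (hφ : IsRegular φ) (K : Finset G) (w : K → ℕ) (x : Config G) :
    Tendsto (fun m => energy φ (E m) (glue K w x) - energy φ (E m) (glue K 0 x)) atTop
      (𝓝 (localEnergy φ K w x)) := by
  simp only [energy_sub_energy]
  exact (hφ.summable_energyDiff (glue_eq_glue_of_notMem 0 w x)).hasSum.comp
    (tendsto_atTop_finset_of_monotone hE.strictMono.monotone hE.exhausts)

theorem measurable_energy [Countable G] (hφ : IsRegular φ) (F : Finset G) :
    Measurable (energy φ F) :=
  Finset.measurable_sum F fun g _ => hφ.measurable.comp (measurable_shift g)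

theorem IsExhausting.measurable_localEnergy [Countable G] {E : ℕ → Finset G} (hE : IsExhausting E)
    (hφ : IsRegular φ) (K : Finset G) (w : K → ℕ) : Measurable (localEnergy φ K w) :=
  measurable_of_tendsto_metrizable
    (fun m => ((measurable_energy hφ (E m)).comp (measurable_glue K w)).sub
      ((measurable_energy hφ (E m)).comp (measurable_glue K 0)))
    (tendsto_pi_nhds.2 fun x => hE.tendsto_localEnergy hφ K w x)

/-- Local energies depend weakly on far away coordinates. -/
theorem IsRegular.exists_abs_localEnergy_sub_le (hφ : IsRegular φ) (K : Finset G) (w : K → ℕ)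
    {ε : ℝ} (hε : 0 < ε) : ∃ W : Finset G, ∀ x y : Config G, (∀ g ∈ W, g ∉ K → x g = y g) →
      |localEnergy φ K w x - localEnergy φ K w y| ≤ ε := by
  classical
  obtain ⟨T, hT⟩ := hφ.exists_finset_abs_sum_sub_energyDiff_le K (ε := ε / 4) (by positivity)
  obtain ⟨V, hV⟩ := hφ.uniform (ε / (4 * (T.card + 1))) (by positivity)
  refine ⟨V * T, fun x y hxy => ?_⟩
  have h1 := fun x => hT T subset_rfl (glue K 0 x) (glue K w x) (glue_eq_glue_of_notMem 0 w x)
  have h2 : ∀ v : K → ℕ, ∀ g ∈ T, |φ (shift g (glue K v x)) - φ (shift g (glue K v y))| ≤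
      ε / (4 * (T.card + 1)) := fun v g hg => hV _ _ fun e he =>
    glue_eq_glue_of_eq v (hxy _ (Finset.mul_mem_mul he hg))
  have h3 : |∑ g ∈ T, (φ (shift g (glue K w x)) - φ (shift g (glue K 0 x))) -
      ∑ g ∈ T, (φ (shift g (glue K w y)) - φ (shift g (glue K 0 y)))| ≤ ε / 2 := by
    rw [← Finset.sum_sub_distrib]
    calc _ ≤ ∑ g ∈ T, |φ (shift g (glue K w x)) - φ (shift g (glue K 0 x)) -
          (φ (shift g (glue K w y)) - φ (shift g (glue K 0 y)))| := Finset.abs_sum_le_sum_abs _ _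
      _ ≤ ∑ g ∈ T, 2 * (ε / (4 * (T.card + 1))) := Finset.sum_le_sum fun g hg => by
          have ha := h2 w g hg
          have hb := h2 0 g hg
          rw [abs_le] at ha hb ⊢
          constructor <;> linarith [ha.1, ha.2, hb.1, hb.2]
      _ = (T.card / (T.card + 1)) * (ε / 2) := by
          rw [Finset.sum_const, nsmul_eq_mul]
          field_simp
          norm_num
      _ ≤ 1 * (ε / 2) := by
          gcongr
          exact (div_le_one (by positivity)).2 (by linarith)
      _ = ε / 2 := one_mul _
  have hx := h1 x
  have hy := h1 y
  simp only [localEnergy]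
  rw [abs_le] at hx hy h3 ⊢
  constructor <;> linarith [hx.1, hx.2, hy.1, hy.2, h3.1, h3.2]

/-- Uniformity in the outside configuration makes the cross measures finite. Up to `1` only finitely
many sites matter, and at each the symbols on `K` are prescribed while the others do not change. -/
theorem IsRegular.exists_localEnergy_le (hφ : IsRegular φ) (K : Finset G) (w : K → ℕ) :
    ∃ M : ℝ, ∀ x, localEnergy φ K w x ≤ M := by
  obtain ⟨T, hT⟩ := hφ.exists_finset_abs_sum_sub_energyDiff_le K one_pos
  obtain ⟨δ, hδ⟩ := hφ.bounded
  have hδ0 : 0 ≤ δ := (abs_nonneg _).trans (hδ 0 0 rfl)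
  refine ⟨∑ g ∈ T, (2 * δ + |φ (fun _ => glue K w 0 g) - φ 0|) + 1, fun x => ?_⟩
  have h1 := hT T subset_rfl (glue K 0 x) (glue K w x) (glue_eq_glue_of_notMem 0 w x)
  have h2 : ∑ g ∈ T, (φ (shift g (glue K w x)) - φ (shift g (glue K 0 x))) ≤
      ∑ g ∈ T, (2 * δ + |φ (fun _ => glue K w 0 g) - φ 0|) := by
    refine Finset.sum_le_sum fun g _ => ?_
    by_cases hg : g ∈ K
    · have ha := hδ (shift g (glue K w x)) (fun _ => glue K w 0 g) (by
        rw [shift_apply, one_mul, glue_of_mem _ _ hg, glue_of_mem _ _ hg])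
      have hb := hδ (shift g (glue K 0 x)) 0 (by
        rw [shift_apply, one_mul, glue_of_mem _ _ hg]; rfl)
      have hc := le_abs_self (φ (fun _ => glue K w 0 g) - φ 0)
      rw [abs_le] at ha hb
      linarith [ha.2, hb.1]
    · have ha := hδ (shift g (glue K w x)) (shift g (glue K 0 x)) (by
        rw [shift_apply, shift_apply, one_mul, glue_of_notMem _ _ hg, glue_of_notMem _ _ hg])
      have hc := abs_nonneg (φ (fun _ => glue K w 0 g) - φ 0)
      rw [abs_le] at ha
      linarith [ha.2]
  simp only [localEnergy]
  rw [abs_le] at h1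
  linarith [h1.1]

/-- The Boltzmann weight of the pattern `w` on `K`. -/
noncomputable def weight (φ : Config G → ℝ) (K : Finset G) (w : K → ℕ) (x : Config G) : ℝ≥0∞ :=
  ENNReal.ofReal (Real.exp (localEnergy φ K w x))

theorem weight_glue (K : Finset G) (w v : K → ℕ) (x : Config G) :
    weight φ K w (glue K v x) = weight φ K w x := by
  simp only [weight, localEnergy_glue]

theorem IsExhausting.measurable_weight [Countable G] {E : ℕ → Finset G} (hE : IsExhausting E)
    (hφ : IsRegular φ) (K : Finset G) (w : K → ℕ) : Measurable (weight φ K w) :=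
  (Real.measurable_exp.comp (hE.measurable_localEnergy hφ K w)).ennreal_ofReal

end Local

/-! ### Detailed balance between patterns on a finite set. -/

section Exchange

variable {μ : Measure (Config G)}

/-- The outside marginal of `μ` on the event that the pattern on `K` is `w`, weighted by `v`. -/
noncomputable def crossMeasure (φ : Config G → ℝ) (μ : Measure (Config G)) (K : Finset G)
    (w v : K → ℕ) : Measure (Config G) :=
  ((μ.restrict (cyl K w)).withDensity (weight φ K v)).map (glue K 0)

theorem crossMeasure_apply (K : Finset G) (w v : K → ℕ) {S : Set (Config G)}
    (hS : MeasurableSet S) :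
    crossMeasure φ μ K w v S = ∫⁻ x in glue K 0 ⁻¹' S ∩ cyl K w, weight φ K v x ∂μ := by
  have h := measurable_glue K 0 hS
  rw [crossMeasure, Measure.map_apply (measurable_glue K 0) hS, withDensity_apply _ h,
    Measure.restrict_restrict h]

theorem isFiniteMeasure_crossMeasure [IsFiniteMeasure μ] (hφ : IsRegular φ) (K : Finset G)
    (w v : K → ℕ) : IsFiniteMeasure (crossMeasure φ μ K w v) := by
  obtain ⟨M, hM⟩ := hφ.exists_localEnergy_le K v
  constructor
  rw [crossMeasure_apply K w v MeasurableSet.univ]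
  refine (lintegral_mono fun x => ENNReal.ofReal_le_ofReal (Real.exp_le_exp.2 (hM x))).trans_lt ?_
  rw [lintegral_const]
  exact ENNReal.mul_lt_top ENNReal.ofReal_lt_top (measure_lt_top _ _)

/-- On a cylinder over `L` both local energies are constant up to `ε`, so the variational comparison
applies to the two fillings of `K`. It costs `2ε`, and freezing the two weights costs `ε` each. -/
theorem IsEquilibrium.crossMeasure_cyl_le [Countable G] (hG : IsAmenable G) (hφ : IsRegular φ)
    (hexp : ExpSummable φ) (hμ : IsEquilibrium φ μ) {K L : Finset G} (hKL : K ⊆ L) {w v : K → ℕ}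
    {ε : ℝ} (hw : ∀ x y : Config G, (∀ g ∈ L, g ∉ K → x g = y g) →
      |localEnergy φ K w x - localEnergy φ K w y| ≤ ε)
    (hv : ∀ x y : Config G, (∀ g ∈ L, g ∉ K → x g = y g) →
      |localEnergy φ K v x - localEnergy φ K v y| ≤ ε) (z : L → ℕ) :
    crossMeasure φ μ K w v (cyl L z) ≤
      ENNReal.ofReal (Real.exp (4 * ε)) * crossMeasure φ μ K v w (cyl L z) := by
  have hP := hμ.admissible.isProbabilityMeasure
  rw [crossMeasure_apply K w v (measurableSet_cyl L z),
    crossMeasure_apply K v w (measurableSet_cyl L z)]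
  set x₀ : Config G := glue L z 0 with hx₀
  have hpat : pat L x₀ = z := pat_glue z 0
  -- The cross measures live on configurations vanishing on `K`; if `z` does not vanish there, the
  -- left side is zero.
  by_cases hz : glue K 0 x₀ = x₀
  · have hset : ∀ u : K → ℕ, glue K 0 ⁻¹' cyl L z ∩ cyl K u = cyl L (pat L (glue K u x₀)) := by
      intro u
      ext x
      simp only [Set.mem_inter_iff, Set.mem_preimage]
      constructor
      · rintro ⟨h1, h2⟩ g
        by_cases hg : (g : G) ∈ K
        · exact (h2 ⟨g, hg⟩).trans (glue_of_mem u x₀ hg).symm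
        · have h3 := h1 g
          rw [glue_of_notMem _ _ hg, ← hpat] at h3
          exact h3.trans (glue_of_notMem u x₀ hg).symm
      · intro h
        refine ⟨fun g => ?_, fun g => ?_⟩
        · rw [← hpat, ← hz]
          refine glue_eq_glue_of_eq 0 fun hg => ?_
          exact (h g).trans (glue_of_notMem u x₀ hg)
        · exact (h ⟨g, hKL g.2⟩).trans (glue_of_mem u x₀ g.2)
    have hag : ∀ u : K → ℕ, ∀ x ∈ cyl L (pat L (glue K u x₀)), ∀ g ∈ L, g ∉ K → x g = x₀ g :=
      fun u x hx g hg hgK => (hx ⟨g, hg⟩).trans (glue_of_notMem u x₀ hgK)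
    rw [hset, hset]
    have h1 : ∫⁻ x in cyl L (pat L (glue K w x₀)), weight φ K v x ∂μ ≤
        ENNReal.ofReal (Real.exp (localEnergy φ K v x₀ + ε)) *
          μ (cyl L (pat L (glue K w x₀))) := by
      rw [← setLIntegral_const]
      refine setLIntegral_mono' (measurableSet_cyl _ _) fun x hx =>
        ENNReal.ofReal_le_ofReal (Real.exp_le_exp.2 ?_)
      linarith [(abs_le.1 (hv x x₀ (hag w x hx))).2]
    have h2 : ENNReal.ofReal (Real.exp (localEnergy φ K w x₀ - ε)) *
          μ (cyl L (pat L (glue K v x₀))) ≤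
        ∫⁻ x in cyl L (pat L (glue K v x₀)), weight φ K w x ∂μ := by
      rw [← setLIntegral_const]
      refine setLIntegral_mono' (measurableSet_cyl _ _) fun x hx =>
        ENNReal.ofReal_le_ofReal (Real.exp_le_exp.2 ?_)
      linarith [(abs_le.1 (hw x x₀ (hag v x hx))).1]
    have h3 := hμ.exp_mul_le hG hφ hexp (L := L) (U := glue K w x₀) (U' := glue K v x₀)
      (c := localEnergy φ K v x₀ - localEnergy φ K w x₀ - 2 * ε) (fun x => by
        rw [glue_pat_glue hKL, glue_pat_glue hKL, hφ.energyDiff_glue]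
        have hy : ∀ g ∈ L, g ∉ K → glue L (pat L x₀) x g = x₀ g := fun g hg _ =>
          glue_of_mem _ _ hg
        linarith [(abs_le.1 (hw _ x₀ hy)).2, (abs_le.1 (hv _ x₀ hy)).1])
    have h4 : ENNReal.ofReal (Real.exp (localEnergy φ K v x₀ - localEnergy φ K w x₀ - 2 * ε)) *
        μ (cyl L (pat L (glue K w x₀))) ≤ μ (cyl L (pat L (glue K v x₀))) := by
      rw [← ofReal_measureReal (μ := μ), ← ofReal_measureReal (μ := μ),
        ← ENNReal.ofReal_mul (Real.exp_pos _).le]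
      exact ENNReal.ofReal_le_ofReal h3
    have hmul : ∀ a b : ℝ, ENNReal.ofReal (Real.exp (a + b)) =
        ENNReal.ofReal (Real.exp a) * ENNReal.ofReal (Real.exp b) := fun a b => by
      rw [Real.exp_add, ENNReal.ofReal_mul (Real.exp_pos _).le]
    calc _ ≤ _ := h1
      _ = ENNReal.ofReal (Real.exp (localEnergy φ K w x₀ + 3 * ε)) *
          (ENNReal.ofReal (Real.exp (localEnergy φ K v x₀ - localEnergy φ K w x₀ - 2 * ε)) *
            μ (cyl L (pat L (glue K w x₀)))) := by
          rw [← mul_assoc, ← hmul]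
          congr 3
          ring
      _ ≤ ENNReal.ofReal (Real.exp (localEnergy φ K w x₀ + 3 * ε)) *
          μ (cyl L (pat L (glue K v x₀))) := by gcongr
      _ = ENNReal.ofReal (Real.exp (4 * ε)) *
          (ENNReal.ofReal (Real.exp (localEnergy φ K w x₀ - ε)) *
            μ (cyl L (pat L (glue K v x₀)))) := by
          rw [← mul_assoc, ← hmul]
          congr 3
          ring
      _ ≤ _ := by gcongr
  · have : glue K 0 ⁻¹' cyl L z ∩ cyl K w = ∅ := by
      ext x
      simp only [Set.mem_inter_iff, Set.mem_preimage, Set.mem_empty_iff_false, iff_false]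
      rintro ⟨h1, -⟩
      refine hz (funext fun g => ?_)
      by_cases hg : g ∈ K
      · have h2 := h1 ⟨g, hKL hg⟩
        rw [glue_of_mem _ _ hg] at h2 ⊢
        rw [hx₀, glue_of_mem _ _ (hKL hg)]
        exact h2
      · rw [glue_of_notMem _ _ hg]
    rw [this]
    simp

/-- Enlarge the window and let `ε → 0` to get inequalities in both directions on cylinders. Finite
measures agreeing on cylinders are equal. -/
theorem IsEquilibrium.crossMeasure_comm [Countable G] (hG : IsAmenable G) (hφ : IsRegular φ)
    (hexp : ExpSummable φ) (hμ : IsEquilibrium φ μ) (K : Finset G) (w v : K → ℕ) :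
    crossMeasure φ μ K w v = crossMeasure φ μ K v w := by
  classical
  have hP := hμ.admissible.isProbabilityMeasure
  have hfin := fun w v => isFiniteMeasure_crossMeasure (μ := μ) hφ K w v
  have hle : ∀ (w v : K → ℕ) (I : Finset G) (z : I → ℕ),
      crossMeasure φ μ K w v (cyl I z) ≤ crossMeasure φ μ K v w (cyl I z) := by
    intro w v I z
    have key : ∀ ε : ℝ, 0 < ε → crossMeasure φ μ K w v (cyl I z) ≤
        ENNReal.ofReal (Real.exp (4 * ε)) * crossMeasure φ μ K v w (cyl I z) := by
      intro ε hε
      obtain ⟨A, hA⟩ := hφ.exists_abs_localEnergy_sub_le K w hε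
      obtain ⟨B, hB⟩ := hφ.exists_abs_localEnergy_sub_le K v hε
      refine measure_cyl_le_of_subset (L := I ∪ K ∪ A ∪ B) (fun g hg => by simp [hg])
        (hμ.crossMeasure_cyl_le hG hφ hexp (fun g hg => by simp [hg]) ?_ ?_) z
      · exact fun x y hxy => hA x y fun g hg => hxy g (by simp [hg])
      · exact fun x y hxy => hB x y fun g hg => hxy g (by simp [hg])
    refine ge_of_tendsto (x := 𝓝[>] (0 : ℝ)) (f := fun ε => ENNReal.ofReal (Real.exp (4 * ε)) *
      crossMeasure φ μ K v w (cyl I z)) ?_ (eventually_mem_nhdsWithin.mono fun ε hε => key ε hε)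
    have h3 : Continuous fun ε : ℝ => ENNReal.ofReal (Real.exp (4 * ε)) :=
      ENNReal.continuous_ofReal.comp (by fun_prop)
    have h4 := (h3.tendsto 0).mono_left (nhdsWithin_le_nhds (s := Set.Ioi 0))
    have h5 := ENNReal.Tendsto.mul_const (b := crossMeasure φ μ K v w (cyl I z)) h4
      (Or.inr (measure_ne_top _ _))
    simpa using h5
  refine IsProjectiveLimit.unique (P := fun I => (crossMeasure φ μ K v w).map I.restrict) ?_
    fun I => rfl
  intro I
  refine Measure.ext_of_singleton fun z => ?_
  have hpre : (I.restrict : Config G → (I → ℕ)) ⁻¹' {z} = cyl I z := by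
    rw [cyl_eq_preimage]; rfl
  have hm : Measurable (I.restrict : Config G → (I → ℕ)) := Finset.measurable_restrict I
  rw [Measure.map_apply hm (measurableSet_singleton z),
    Measure.map_apply hm (measurableSet_singleton z), hpre]
  exact le_antisymm (hle w v I z) (hle v w I z)

theorem IsEquilibrium.setLIntegral_exchange [Countable G] (hG : IsAmenable G) {E : ℕ → Finset G}
    (hE : IsExhausting E) (hφ : IsRegular φ)
    (hexp : ExpSummable φ) (hμ : IsEquilibrium φ μ) (K : Finset G) (w v : K → ℕ)
    {f : Config G → ℝ≥0∞} (hf : Measurable f) (hfK : ∀ x, f (glue K 0 x) = f x) :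
    ∫⁻ x in cyl K w, f x * weight φ K v x ∂μ = ∫⁻ x in cyl K v, f x * weight φ K w x ∂μ := by
  have key : ∀ w v : K → ℕ, ∫⁻ x, f x ∂(crossMeasure φ μ K w v) =
      ∫⁻ x in cyl K w, f x * weight φ K v x ∂μ := by
    intro w v
    rw [crossMeasure, lintegral_map hf (measurable_glue K 0), lintegral_congr hfK,
      lintegral_withDensity_eq_lintegral_mul _ (hE.measurable_weight hφ K v) hf]
    exact lintegral_congr fun x => mul_comm _ _
  rw [← key, ← key, hμ.crossMeasure_comm hG hφ hexp]

end Exchange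

end GibbsShift

namespace GibbsShift

variable {G : Type*} [Group G] {φ : Config G → ℝ}

/-! ### Convergence of the Gibbsian kernels. -/

section Specification

/-- The sum is the total mass of a finite product of finite measures on `ℕ`. -/
theorem tsum_prod_ofReal_ne_top {f : ℕ → ℝ} (hf : Summable f) (κ : Type*) [Fintype κ] :
    ∑' w : κ → ℕ, ∏ k, ENNReal.ofReal (f (w k)) ≠ ∞ := by
  let m : Measure ℕ := Measure.sum fun a => ENNReal.ofReal (f a) • Measure.dirac a
  have hm : ∀ a, m {a} = ENNReal.ofReal (f a) := fun a => by
    rw [Measure.sum_apply _ (measurableSet_singleton a), tsum_eq_single a fun b hb => by simp [hb]]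
    simp
  have hfin : IsFiniteMeasure m := ⟨by
    rw [Measure.sum_apply _ MeasurableSet.univ]
    simpa using hf.tsum_ofReal_lt_top⟩
  have h1 : ∑' w : κ → ℕ, ∏ k, ENNReal.ofReal (f (w k)) =
      Measure.pi (fun _ : κ => m) Set.univ := by
    rw [← lintegral_one, lintegral_countable']
    simp [Measure.pi_singleton, hm]
  rw [h1]
  exact measure_ne_top _ _

/-- The finite-volume weights are dominated by a summable function of the pattern. -/
theorem IsRegular.exists_bound_weight (hφ : IsRegular φ) (hexp : ExpSummable φ) (K : Finset G)
    (x : Config G) : ∃ b : (K → ℕ) → ℝ≥0∞, ∑' w, b w ≠ ∞ ∧ ∀ F : Finset G, K ⊆ F → ∀ w : K → ℕ,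
      ENNReal.ofReal (Real.exp (energy φ F (glue K w x) - energy φ F (glue K 0 x))) ≤ b w := by
  classical
  obtain ⟨f, hf, hφf⟩ := hexp.exists_bound
  obtain ⟨r, hr, hr0, h⟩ := hφ.decay
  have hs := summable_majorant hr K
  have h0 : ∀ g, 0 ≤ majorant r K g := fun g => Finset.sum_nonneg fun _ _ => hr0 _
  -- Off `K`, the pattern changes the energy by at most the total majorant, whatever `w` and `F`
  -- are. On `K`, the reference energy is subtracted, and `exp φ` at `k` is at most `f (w k)`.
  set c : ℝ := ∑' g, majorant r K g - ∑ k ∈ K, φ (shift k (glue K 0 x))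
  refine ⟨fun w => ENNReal.ofReal (Real.exp c) * ∏ k : K, ENNReal.ofReal (f (w k)), ?_,
    fun F hF w => ?_⟩
  · rw [ENNReal.tsum_mul_left]
    exact ENNReal.mul_ne_top ENNReal.ofReal_ne_top (tsum_prod_ofReal_ne_top hf K)
  · have h1 : energy φ F (glue K w x) - energy φ F (glue K 0 x) ≤
        c + ∑ k ∈ K, φ (shift k (glue K w x)) := by
      rw [energy_sub_energy, ← Finset.sum_sdiff hF, Finset.sum_sub_distrib (s := K)]
      have h2 : ∑ g ∈ F \ K, (φ (shift g (glue K w x)) - φ (shift g (glue K 0 x))) ≤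
          ∑' g, majorant r K g :=
        (Finset.sum_le_sum fun g hg => (le_abs_self _).trans (h K _ _
          (glue_eq_glue_of_notMem 0 w x) g (Finset.mem_sdiff.1 hg).2)).trans
          (hs.sum_le_tsum _ fun g _ => h0 g)
      linarith
    have h3 : ∏ k : K, ENNReal.ofReal (f (w k)) = ENNReal.ofReal (∏ k : K, f (w k)) :=
      (ENNReal.ofReal_prod_of_nonneg fun k _ =>
        (Real.exp_pos _).le.trans (hφf fun _ => w k)).symm
    change _ ≤ ENNReal.ofReal (Real.exp c) * ∏ k : K, ENNReal.ofReal (f (w k))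
    rw [h3, ← ENNReal.ofReal_mul (Real.exp_pos _).le]
    refine ENNReal.ofReal_le_ofReal ((Real.exp_le_exp.2 h1).trans ?_)
    rw [Real.exp_add, Real.exp_sum, ← Finset.prod_coe_sort]
    refine mul_le_mul_of_nonneg_left (Finset.prod_le_prod (fun _ _ => (Real.exp_pos _).le)
      fun k _ => ?_) (Real.exp_pos _).le
    refine (hφf _).trans (le_of_eq ?_)
    rw [shift_apply, one_mul, glue_of_mem _ _ k.2]

/-- The total weight of the patterns `w` on `K` with `w x ∈ B`. -/
noncomputable def weightSum (φ : Config G → ℝ) (K : Finset G) (B : Set (Config G))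
    (x : Config G) : ℝ≥0∞ :=
  ∑' w : K → ℕ, B.indicator 1 (glue K w x) * weight φ K w x

theorem weightSum_glue (K : Finset G) (B : Set (Config G)) (v : K → ℕ) (x : Config G) :
    weightSum φ K B (glue K v x) = weightSum φ K B x := by
  simp only [weightSum, glue_glue, weight_glue]

/-- The zero pattern has weight `1`, so the normalisation never vanishes. -/
theorem one_le_weightSum_univ (K : Finset G) (x : Config G) : 1 ≤ weightSum φ K Set.univ x := by
  refine le_trans ?_ (ENNReal.le_tsum (0 : K → ℕ))
  simp [weight, localEnergy_zero]

theorem weightSum_mono {K : Finset G} {A B : Set (Config G)} (h : A ⊆ B) (x : Config G) :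
    weightSum φ K A x ≤ weightSum φ K B x :=
  ENNReal.tsum_le_tsum fun w => by
    gcongr

variable {E : ℕ → Finset G}

/-- Dominated convergence for counting measure on patterns, once `E m ⊇ K`. -/
theorem IsExhausting.tendsto_tsum_indicator (hE : IsExhausting E) (hφ : IsRegular φ)
    (hexp : ExpSummable φ) (K : Finset G) (B : Set (Config G)) (x : Config G) :
    weightSum φ K B x ≠ ∞ ∧ Tendsto (fun m => ∑' w : K → ℕ, B.indicator 1 (glue K w x) *
      ENNReal.ofReal (Real.exp (energy φ (E m) (glue K w x) - energy φ (E m) (glue K 0 x)))) atTop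
      (𝓝 (weightSum φ K B x)) := by
  obtain ⟨b, hb, hbound⟩ := hφ.exists_bound_weight hexp K x
  have hK : ∀ᶠ m in atTop, K ⊆ E m :=
    (tendsto_atTop_finset_of_monotone hE.strictMono.monotone hE.exhausts).eventually
      (eventually_ge_atTop K)
  have hlim : ∀ w : K → ℕ, Tendsto (fun m => ENNReal.ofReal (Real.exp
      (energy φ (E m) (glue K w x) - energy φ (E m) (glue K 0 x)))) atTop
      (𝓝 (weight φ K w x)) := fun w =>
    ((ENNReal.continuous_ofReal.comp Real.continuous_exp).tendsto _).comp
      (hE.tendsto_localEnergy hφ K w x)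
  have hind : ∀ w : K → ℕ, B.indicator (1 : Config G → ℝ≥0∞) (glue K w x) ≤ 1 := fun w =>
    Set.indicator_le_self _ _ _
  have hle : ∀ (w : K → ℕ) (a : ℝ≥0∞), B.indicator 1 (glue K w x) * a ≤ a := fun w a => by
    calc _ ≤ 1 * a := by gcongr; exact hind w
      _ = a := one_mul a
  refine ⟨ne_top_of_le_ne_top hb (ENNReal.tsum_le_tsum fun w => (hle w _).trans
    (le_of_tendsto (hlim w) (hK.mono fun m hm => hbound _ hm w))), ?_⟩
  simp only [weightSum, ← lintegral_count]
  rw [← lintegral_count] at hb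
  refine tendsto_lintegral_filter_of_dominated_convergence b
    (Eventually.of_forall fun m => measurable_of_countable _)
    (hK.mono fun m hm => ae_of_all _ fun w => (hle w _).trans (hbound _ hm w)) hb
    (ae_of_all _ fun w => ?_)
  exact ENNReal.Tendsto.const_mul (hlim w) (Or.inr (ne_top_of_le_ne_top ENNReal.one_ne_top (hind w)))

theorem IsExhausting.tendsto_gibbsRatio (hE : IsExhausting E) (hφ : IsRegular φ)
    (hexp : ExpSummable φ) (K : Finset G) (B : Set (Config G)) (x : Config G) :
    Tendsto (fun m => gibbsRatio φ (E m) K B x) atTop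
      (𝓝 (weightSum φ K B x / weightSum φ K Set.univ x)) := by
  have hratio : ∀ m, gibbsRatio φ (E m) K B x =
      (∑' w : K → ℕ, B.indicator 1 (glue K w x) * ENNReal.ofReal (Real.exp
        (energy φ (E m) (glue K w x) - energy φ (E m) (glue K 0 x)))) /
      ∑' w : K → ℕ, Set.univ.indicator 1 (glue K w x) * ENNReal.ofReal (Real.exp
        (energy φ (E m) (glue K w x) - energy φ (E m) (glue K 0 x))) := by
    intro m
    -- The energies themselves need not converge; dividing out that of the zero filling leaves
    -- differences that do.
    set c := ENNReal.ofReal (Real.exp (energy φ (E m) (glue K 0 x))) with hc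
    have hc0 : c ≠ 0 := (ENNReal.ofReal_pos.2 (Real.exp_pos _)).ne'
    have hexp' : ∀ w : K → ℕ, ENNReal.ofReal (Real.exp (energy φ (E m) (glue K w x))) =
        c * ENNReal.ofReal (Real.exp
          (energy φ (E m) (glue K w x) - energy φ (E m) (glue K 0 x))) := fun w => by
      rw [hc, ← ENNReal.ofReal_mul (Real.exp_pos _).le, ← Real.exp_add]
      congr 2
      ring
    have hnum : ∀ B : Set (Config G), ∑' w : K → ℕ,
        B.indicator (fun y => ENNReal.ofReal (Real.exp (energy φ (E m) y))) (glue K w x) =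
        c * ∑' w : K → ℕ, B.indicator 1 (glue K w x) * ENNReal.ofReal (Real.exp
          (energy φ (E m) (glue K w x) - energy φ (E m) (glue K 0 x))) := fun B => by
      rw [← ENNReal.tsum_mul_left]
      refine tsum_congr fun w => ?_
      by_cases hw : glue K w x ∈ B
      · simp [hw, hexp']
      · simp [hw]
    have hden := hnum Set.univ
    simp only [Set.indicator_univ] at hden
    rw [gibbsRatio, hnum, hden]
    simp only [Set.indicator_univ]
    exact ENNReal.mul_div_mul_left _ _ hc0 ENNReal.ofReal_ne_top
  simp only [hratio]
  have h1 := hE.tendsto_tsum_indicator hφ hexp K B x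
  have h2 := hE.tendsto_tsum_indicator hφ hexp K Set.univ x
  exact ENNReal.Tendsto.div h1.2 (Or.inr (zero_lt_one.trans_le (one_le_weightSum_univ K x)).ne')
    h2.2 (Or.inr h1.1)

end Specification

/-! ### The DLR equations. -/

section DLR

variable [Countable G] {E : ℕ → Finset G} {μ : Measure (Config G)}

theorem IsExhausting.measurable_weightSum (hE : IsExhausting E) (hφ : IsRegular φ) (K : Finset G)
    {B : Set (Config G)} (hB : MeasurableSet B) : Measurable (weightSum φ K B) :=
  Measurable.tsum fun w => ((measurable_one.indicator hB).comp (measurable_glue K w)).mul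
    (hE.measurable_weight hφ K w)

/-- The Gibbsian kernel integrates over an outside event to the measure of the intersection. -/
theorem IsEquilibrium.setLIntegral_weightSum (hG : IsAmenable G) (hE : IsExhausting E)
    (hφ : IsRegular φ) (hexp : ExpSummable φ) (hμ : IsEquilibrium φ μ) (K : Finset G)
    {A B : Set (Config G)}
    (hA : MeasurableSet[cylinderEvents (X := fun _ : G => ℕ) (K : Set G)ᶜ] A)
    (hB : MeasurableSet B) :
    ∫⁻ x in A, weightSum φ K B x / weightSum φ K Set.univ x ∂μ = μ (A ∩ B) := by
  have hA' : MeasurableSet A := cylinderEvents_le_pi A hA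
  have hZ : ∀ x, weightSum φ K Set.univ x ≠ ∞ := fun x =>
    (hE.tendsto_tsum_indicator hφ hexp K Set.univ x).1
  have hZ0 : ∀ x, weightSum φ K Set.univ x ≠ 0 := fun x =>
    (zero_lt_one.trans_le (one_le_weightSum_univ K x)).ne'
  let f : (K → ℕ) → Config G → ℝ≥0∞ := fun w x =>
    A.indicator 1 x * (B.indicator 1 (glue K w x) * (weightSum φ K Set.univ x)⁻¹)
  have hf : ∀ w, Measurable (f w) := fun w =>
    (measurable_one.indicator hA').mul (((measurable_one.indicator hB).comp
      (measurable_glue K w)).mul (hE.measurable_weightSum hφ K MeasurableSet.univ).inv)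
  have hAind : ∀ (v : K → ℕ) (x : Config G), A.indicator (1 : Config G → ℝ≥0∞) (glue K v x) =
      A.indicator 1 x := fun v x => by
    have h1 := glue_mem_iff_of_measurableSet hA v x
    by_cases hx : x ∈ A
    · rw [Set.indicator_of_mem hx, Set.indicator_of_mem (h1.2 hx)]; rfl
    · rw [Set.indicator_of_notMem hx, Set.indicator_of_notMem fun h => hx (h1.1 h)]
  have hfK : ∀ w x, f w (glue K 0 x) = f w x := fun w x => by
    change A.indicator 1 (glue K 0 x) * (B.indicator 1 (glue K w (glue K 0 x)) *
      (weightSum φ K Set.univ (glue K 0 x))⁻¹) = _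
    rw [hAind, glue_glue, weightSum_glue]
  calc ∫⁻ x in A, weightSum φ K B x / weightSum φ K Set.univ x ∂μ
      = ∫⁻ x, ∑' w, f w x * weight φ K w x ∂μ := by
        rw [← lintegral_indicator hA']
        refine lintegral_congr fun x => ?_
        by_cases hx : x ∈ A
        · simp only [f, Set.indicator_of_mem hx, Pi.one_apply, one_mul]
          rw [weightSum, div_eq_mul_inv, ← ENNReal.tsum_mul_right]
          exact tsum_congr fun w => by ring
        · simp [f, hx]
    _ = ∑' v : K → ℕ, ∑' w : K → ℕ, ∫⁻ x in cyl K v, f w x * weight φ K w x ∂μ := by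
        rw [lintegral_eq_tsum_cyl K]
        exact tsum_congr fun v => lintegral_tsum fun w =>
          ((hf w).mul (hE.measurable_weight hφ K w)).aemeasurable
    -- Detailed balance moves the integral to the cylinder of `w`. There `f w` is the normalised
    -- indicator of `A ∩ B`, and summing the weights over `v` restores the normalisation.
    _ = ∑' v : K → ℕ, ∑' w : K → ℕ, ∫⁻ x in cyl K w, f w x * weight φ K v x ∂μ :=
        tsum_congr fun v => tsum_congr fun w =>
          hμ.setLIntegral_exchange hG hE hφ hexp K v w (hf w) (hfK w)
    _ = ∑' w : K → ℕ, ∫⁻ x in cyl K w, ∑' v : K → ℕ, f w x * weight φ K v x ∂μ := by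
        rw [ENNReal.tsum_comm]
        exact tsum_congr fun w => (lintegral_tsum fun v =>
          ((hf w).mul (hE.measurable_weight hφ K v)).aemeasurable).symm
    _ = ∑' w : K → ℕ, ∫⁻ x in cyl K w, (A ∩ B).indicator 1 x ∂μ := by
        refine tsum_congr fun w => setLIntegral_congr_fun (measurableSet_cyl K w) fun x hx => ?_
        have h1 : ∑' v : K → ℕ, weight φ K v x = weightSum φ K Set.univ x := by
          simp [weightSum]
        change ∑' v : K → ℕ, f w x * weight φ K v x = _
        rw [ENNReal.tsum_mul_left, h1]
        change A.indicator 1 x * (B.indicator 1 (glue K w x) * (weightSum φ K Set.univ x)⁻¹) *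
          weightSum φ K Set.univ x = _
        rw [glue_eq_self hx, mul_assoc, mul_assoc, ENNReal.inv_mul_cancel (hZ0 x) (hZ x), mul_one]
        by_cases h1 : x ∈ A <;> by_cases h2 : x ∈ B <;> simp [h1, h2]
    _ = μ (A ∩ B) := by
        rw [← lintegral_eq_tsum_cyl K, lintegral_indicator_one (hA'.inter hB)]

theorem IsEquilibrium.isDLR (hG : IsAmenable G) (hE : IsExhausting E)
    (hφ : IsRegular φ) (hexp : ExpSummable φ) (hμ : IsEquilibrium φ μ) : IsDLR E φ μ where
  isProbabilityMeasure := hμ.admissible.isProbabilityMeasure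
  condProb K _ B hB := by
    have hP := hμ.admissible.isProbabilityMeasure
    set γ : Config G → ℝ≥0∞ := fun x => weightSum φ K B x / weightSum φ K Set.univ x with hγ
    have hγ1 : ∀ x, γ x ≤ 1 := fun x =>
      ENNReal.div_le_of_le_mul (by simpa using weightSum_mono (Set.subset_univ B) x)
    have hγtop : ∀ x, γ x ≠ ∞ := fun x => ne_top_of_le_ne_top ENNReal.one_ne_top (hγ1 x)
    have hm := cylinderEvents_le_pi (X := fun _ : G => ℕ) (Δ := (K : Set G)ᶜ)
    have hγpi : Measurable γ :=
      (hE.measurable_weightSum hφ K hB).div (hE.measurable_weightSum hφ K MeasurableSet.univ)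
    -- The kernel does not see the coordinates in `K`: it factors through the measurable map `glue K
    -- 0` of the outside coordinates.
    have hγm : Measurable[cylinderEvents (X := fun _ : G => ℕ) (K : Set G)ᶜ] γ := by
      have h1 : γ = γ ∘ glue K 0 := by
        ext x
        simp only [hγ, Function.comp, weightSum_glue]
      rw [h1]
      exact hγpi.comp (measurable_cylinderEvents_glue K 0)
    have hint : Integrable (fun x => (γ x).toReal) μ := by
      refine Integrable.of_mem_Icc 0 1 hγpi.ennreal_toReal.aemeasurable (ae_of_all _ fun x =>
        ⟨ENNReal.toReal_nonneg, ?_⟩)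
      exact ENNReal.toReal_le_of_le_ofReal zero_le_one (by simpa using hγ1 x)
    have hce : (fun x => (γ x).toReal) =ᵐ[μ]
        μ⟦B | cylinderEvents (X := fun _ : G => ℕ) (K : Set G)ᶜ⟧ := by
      refine ae_eq_condExp_of_forall_setIntegral_eq hm
        ((integrable_const (1 : ℝ)).indicator hB) (fun s _ _ => hint.integrableOn)
        (fun s hs _ => ?_) (hγm.ennreal_toReal.stronglyMeasurable.aestronglyMeasurable)
      rw [integral_toReal hγpi.aemeasurable (ae_of_all _ fun x => (hγtop x).lt_top),
        hμ.setLIntegral_weightSum hG hE hφ hexp K hs hB, setIntegral_indicator hB]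
      simp [measureReal_def]
    filter_upwards [hce] with x hx
    rw [← hx, ENNReal.ofReal_toReal (hγtop x)]
    exact hE.tendsto_gibbsRatio hφ hexp K B x

end DLR

end GibbsShift

theorem mainTheorem7 {G : Type*} [Group G] [Countable G] (hG : GibbsShift.IsAmenable G)
    (E : ℕ → Finset G) (hE : GibbsShift.IsExhausting E)
    (φ : GibbsShift.Config G → ℝ) (hexp : GibbsShift.ExpSummable φ)
    (hvar : GibbsShift.HasSummableVariation E φ)
    (μ : Measure (GibbsShift.Config G)) (hμ : GibbsShift.IsEquilibrium φ μ) :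
    GibbsShift.IsDLR E φ μ :=
  hμ.isDLR hG hE (hE.isRegular hvar) hexp
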